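/- **Operadic model categories.** Let $\mathcal D$ be an operadic model category: a simplicial model category (mapping spaces $\mathrm{Map}(-,-)$, finite simplicial tensors and cotensors, axiom SM7) with a symmetric monoidal product $\otimes$ with unit $\mathbb I$, simplicially enriched (it acts on mapping spaces by maps $\mathrm{Map}(x,y)\times \mathrm{Map}(x',y')\to \mathrm{Map}(x\otimes x',y\otimes y')$ compatible with composition and with the associativity, unit and symmetry isomorphisms), such that: the pushout product axiom for cofibrations holds; the product with an initial object (on either side) is initial; $f\otimes x$ and $x\otimes f$ are weak equivalences whenever $f$ is a weak equivalence and $x$ is cofibrant; for finite simplicial sets $K$, writing $K\cdot x$ for the simplicial tensor, the canonical comparison maps identify $K\cdot x$ with both $x\otimes (K\cdot\mathbb I)$ and $(K\cdot\mathbb I)\otimes x$; and $\mathrm{Map}(\mathbb I,-)$ preserves fibrations and acyclic fibrations. **Weak function objects.** Write $\otimes^{\mathbb L}$ and $\mathbb R\mathrm{Map}$ for the derived tensor product and the derived mapping spaces on $ho(\mathcal D)$. A weak function object is a functor $F\colon ho(\mathcal D)^{op}\times ho(\mathcal D)\to ho(\mathcal D)$ with a natural transformation $\mathbb R\mathrm{Map}(a\otimes^{\mathbb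 L}b,c)\to\mathbb R\mathrm{Map}(a,F(b,c))$ in the homotopy category of spaces. It provides an adjoint for $a\otimes^{\mathbb L}b\to c$ if this map is an isomorphism for these $a,b,c$. A morphism $\eta\colon x\to y$ of $ho(\mathcal D)$ is rigid if $\eta^*\colon F(y,y)\to F(x,y)$ is an isomorphism in $ho(\mathcal D)$. **Operads.** Operads are symmetric operads in simplicial sets, with operations of all arities $n\ge 0$; weak equivalences and fibrations are defined levelwise, and an operad is cofibrant if every map out of it lifts through all acyclic fibrations. $\mathrm{Map}_{operad}$ denotes the simplicial mapping space of operads. For an object $X$ of $\mathcal D$, $\mathrm{End}(X)(n)=\mathrm{Map}(X^{\otimes n},X)$. For a morphism $f\colon X\to Y$ of $\mathcal D$, $\mathrm{End}(f)(n)=\mathrm{Map}(X^{\otimes n},X)\times_{\mathrm{Map}(X^{\otimes n},Y)}\mathrm{Map}(Y^{\otimes n},Y)$, and $\mathrm{End}(f)\to \mathrm{End}(X)$ is the projection. For $\eta\colon x\to y$ in $ho(\mathcal D)$, the map $\mathbb R\mathrm{End}(\eta)\to\mathbb R\mathrm{End}(x)$ is the map $\mathrm{End}(f)\to\mathrm{End}(X)$,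 where $f\colon X\to Y$ is a fibration between cofibrant-fibrant objects of $\mathcal D$ whose image in $ho(\mathcal D)$ is isomorphic, as an arrow, to $\eta$. **Theorem.** Let $F$ be a weak function object for the operadic model category $\mathcal D$, and let $\eta\colon x\to y$ be a rigid morphism of $ho(\mathcal D)$. Suppose that for all $n,m\ge 0$ the weak function object provides adjoints for $$(x^{\otimes^{\mathbb L}n}\otimes^{\mathbb L}y^{\otimes^{\mathbb L}m})\otimes^{\mathbb L}x\to y\qquad\text{and}\qquad (x^{\otimes^{\mathbb L}n}\otimes^{\mathbb L}y^{\otimes^{\mathbb L}m})\otimes^{\mathbb L}y\to y.$$ Then $\eta$ is represented by some fibration $f\colon X\to Y$ between cofibrant-fibrant objects, and for every such representative $f$: 1. the map of operads $\mathrm{End}(f)\to\mathrm{End}(X)$ (that is, $\mathbb R\mathrm{End}(\eta)\to\mathbb R\mathrm{End}(x)$) is a weak equivalence of operads; 2. for every cofibrant operad $\mathcal O$ and every $\mathcal O$-algebra structure $\theta\colon\mathcal O\to\mathrm{End}(X)$, the homotopy fiber over $\theta$ of $$\mathrm{Map}_{operad}(\mathcal O,\mathrm{End}(f))\to\mathrm{Map}_{operad}(\mathcal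 O,\mathrm{End}(X))$$ is contractible. -/

import Mathlib

universe v u

open CategoryTheory MonoidalCategory Opposite HomotopicalAlgebra
open CategoryTheory.SimplicialCategory

set_option linter.unusedSectionVars false
set_option linter.unusedVariables false

noncomputable section

namespace OperadicRigidity

lemma app_congr {K L : SSet.{v}} {f g : K ⟶ L} (h : f = g) (q : SimplexCategoryᵒᵖ) (x : K.obj q) :
    f.app q x = g.app q x := by rw [h]

lemma app_map {K L : SSet.{v}} (f : K ⟶ L) {q r : SimplexCategoryᵒᵖ} (a : q ⟶ r) (x : K.obj q) :
    f.app r (K.map a x) = L.map a (f.app q x) := NatTrans.naturality_apply f a x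

section
variable {D : Type u} [Category.{v} D] [SimplicialCategory D]

/-- `LHom q X Y` is the set of `q`-simplices of the mapping space from `X` to `Y`. -/
def LHom (q : SimplexCategoryᵒᵖ) (X Y : D) : Type v := (sHom X Y).obj q

/-- Composition of `q`-simplices of mapping spaces. -/
def lcomp {q : SimplexCategoryᵒᵖ} {X Y Z : D} (f : LHom q X Y) (g : LHom q Y Z) : LHom q X Z :=
  (sHomComp X Y Z).app q (f, g)

infixr:80 " ≫ₗ " => lcomp

/-- A morphism of `D`, viewed as a (degenerate) `q`-simplex of the mapping space. -/
def degen (q : SimplexCategoryᵒᵖ) {X Y : D} (f : X ⟶ Y) : LHom q X Y :=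
  (eHomEquiv SSet f).app q PUnit.unit

/-- The simplicial structure maps of the mapping spaces. -/
def LHom.op {q r : SimplexCategoryᵒᵖ} (a : q ⟶ r) {X Y : D} (f : LHom q X Y) : LHom r X Y :=
  (sHom X Y).map a f

variable {q r : SimplexCategoryᵒᵖ} {W X Y Z : D}

@[simp] lemma lcomp_assoc (f : LHom q W X) (g : LHom q X Y) (h : LHom q Y Z) :
    (f ≫ₗ g) ≫ₗ h = f ≫ₗ g ≫ₗ h :=
  app_congr (e_assoc SSet W X Y Z) q (f, (g, h))

lemma degen_comp (f : X ⟶ Y) (g : Y ⟶ Z) :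
    degen q (f ≫ g) = degen q f ≫ₗ degen q g := by
  unfold degen; rw [eHomEquiv_comp]; rfl

@[simp] lemma id_lcomp (f : LHom q X Y) : degen q (𝟙 X) ≫ₗ f = f := by
  unfold degen; rw [eHomEquiv_id]; exact app_congr (e_id_comp SSet X Y) q f

@[simp] lemma lcomp_id (f : LHom q X Y) : f ≫ₗ degen q (𝟙 Y) = f := by
  unfold degen; rw [eHomEquiv_id]; exact app_congr (e_comp_id SSet X Y) q f

lemma degen_comp_assoc (f : X ⟶ Y) (g : Y ⟶ Z) {T : D} (h : LHom q Z T) :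
    degen q f ≫ₗ degen q g ≫ₗ h = degen q (f ≫ g) ≫ₗ h := by
  rw [degen_comp, lcomp_assoc]

lemma op_lcomp (a : q ⟶ r) (f : LHom q X Y) (g : LHom q Y Z) :
    (f ≫ₗ g).op a = f.op a ≫ₗ g.op a :=
  (app_map (sHomComp X Y Z) a (f, g)).symm

lemma op_degen (a : q ⟶ r) (f : X ⟶ Y) : (degen q f).op a = degen r f :=
  (app_map (eHomEquiv SSet f) a PUnit.unit).symm

lemma lop_id (f : LHom q X Y) : f.op (𝟙 q) = f := by simp [LHom.op]; rfl

lemma lop_op {s : SimplexCategoryᵒᵖ} (a : q ⟶ r) (b : r ⟶ s) (f : LHom q X Y) :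
    f.op (a ≫ b) = (f.op a).op b := by simp [LHom.op]; rfl

end

/-- A simplicial enrichment of the symmetric monoidal category `D`: the tensor product acts on
mapping spaces, compatibly with simplicial composition, and the
associativity, unit and symmetry isomorphisms are simplicially natural. (Elements of the
mapping spaces are written in each simplicial degree `q`.) -/
class SymmetricMonoidalEnrichment (D : Type u) [Category.{v} D] [SimplicialCategory D]
    [MonoidalCategory D] [SymmetricCategory D] where
  tensorMap (X X' Y Y' : D) : sHom X Y ⊗ sHom X' Y' ⟶ sHom (X ⊗ X') (Y ⊗ Y')
  tensorMap_degen {X X' Y Y' : D} (q : SimplexCategoryᵒᵖ) (f : X ⟶ Y) (f' : X' ⟶ Y') :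
    (tensorMap X X' Y Y').app q (degen q f, degen q f') = degen q (f ⊗ₘ f')
  tensorMap_comp {X X' Y Y' Z Z' : D} {q : SimplexCategoryᵒᵖ} (f : LHom q X Y) (f' : LHom q X' Y')
    (g : LHom q Y Z) (g' : LHom q Y' Z') :
    (tensorMap X X' Z Z').app q (f ≫ₗ g, f' ≫ₗ g') =
      lcomp ((tensorMap X X' Y Y').app q (f, f')) ((tensorMap Y Y' Z Z').app q (g, g'))
  associator_natural {X X' X'' Y Y' Y'' : D} {q : SimplexCategoryᵒᵖ} (f : LHom q X Y)
    (f' : LHom q X' Y') (f'' : LHom q X'' Y'') :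
    lcomp ((tensorMap (X ⊗ X') X'' (Y ⊗ Y') Y'').app q ((tensorMap X X' Y Y').app q (f, f'), f''))
      (degen q (α_ Y Y' Y'').hom) =
    degen q (α_ X X' X'').hom ≫ₗ
      ((tensorMap X (X' ⊗ X'') Y (Y' ⊗ Y'')).app q (f, (tensorMap X' X'' Y' Y'').app q (f', f'')))
  leftUnitor_natural {X Y : D} {q : SimplexCategoryᵒᵖ} (f : LHom q X Y) :
    lcomp ((tensorMap (𝟙_ D) X (𝟙_ D) Y).app q (degen q (𝟙 (𝟙_ D)), f)) (degen q (λ_ Y).hom) =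
      degen q (λ_ X).hom ≫ₗ f
  rightUnitor_natural {X Y : D} {q : SimplexCategoryᵒᵖ} (f : LHom q X Y) :
    lcomp ((tensorMap X (𝟙_ D) Y (𝟙_ D)).app q (f, degen q (𝟙 (𝟙_ D)))) (degen q (ρ_ Y).hom) =
      degen q (ρ_ X).hom ≫ₗ f
  braiding_natural {X X' Y Y' : D} {q : SimplexCategoryᵒᵖ} (f : LHom q X Y) (f' : LHom q X' Y') :
    lcomp ((tensorMap X X' Y Y').app q (f, f')) (degen q (β_ Y Y').hom) =
      degen q (β_ X X').hom ≫ₗ ((tensorMap X' X Y' Y).app q (f', f))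

section
variable {D : Type u} [Category.{v} D] [SimplicialCategory D] [MonoidalCategory D]
  [SymmetricCategory D] [SymmetricMonoidalEnrichment D]

/-- Tensor product of `q`-simplices of mapping spaces. -/
def ltens {q : SimplexCategoryᵒᵖ} {X X' Y Y' : D} (f : LHom q X Y) (f' : LHom q X' Y') :
    LHom q (X ⊗ X') (Y ⊗ Y') :=
  (SymmetricMonoidalEnrichment.tensorMap X X' Y Y').app q (f, f')

infixr:81 " ⊗ₗ " => ltens

variable {q r : SimplexCategoryᵒᵖ} {X X' X'' Y Y' Y'' Z Z' : D}

lemma degen_tens (f : X ⟶ Y) (f' : X' ⟶ Y') : degen q (f ⊗ₘ f') = degen q f ⊗ₗ degen q f' :=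
  (SymmetricMonoidalEnrichment.tensorMap_degen q f f').symm

lemma ltens_comp (f : LHom q X Y) (f' : LHom q X' Y') (g : LHom q Y Z) (g' : LHom q Y' Z') :
    (f ≫ₗ g) ⊗ₗ (f' ≫ₗ g') = (f ⊗ₗ f') ≫ₗ (g ⊗ₗ g') :=
  SymmetricMonoidalEnrichment.tensorMap_comp f f' g g'

lemma lassoc (f : LHom q X Y) (f' : LHom q X' Y') (f'' : LHom q X'' Y'') :
    ((f ⊗ₗ f') ⊗ₗ f'') ≫ₗ degen q (α_ Y Y' Y'').hom =
      degen q (α_ X X' X'').hom ≫ₗ (f ⊗ₗ f' ⊗ₗ f'') :=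
  SymmetricMonoidalEnrichment.associator_natural f f' f''

lemma lunit (f : LHom q X Y) :
    (degen q (𝟙 (𝟙_ D)) ⊗ₗ f) ≫ₗ degen q (λ_ Y).hom = degen q (λ_ X).hom ≫ₗ f :=
  SymmetricMonoidalEnrichment.leftUnitor_natural f

lemma runit (f : LHom q X Y) :
    (f ⊗ₗ degen q (𝟙 (𝟙_ D))) ≫ₗ degen q (ρ_ Y).hom = degen q (ρ_ X).hom ≫ₗ f :=
  SymmetricMonoidalEnrichment.rightUnitor_natural f

lemma lbraid (f : LHom q X Y) (f' : LHom q X' Y') :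
    (f ⊗ₗ f') ≫ₗ degen q (β_ Y Y').hom = degen q (β_ X X').hom ≫ₗ (f' ⊗ₗ f) :=
  SymmetricMonoidalEnrichment.braiding_natural f f'

lemma op_ltens (a : q ⟶ r) (f : LHom q X Y) (f' : LHom q X' Y') :
    (f ⊗ₗ f').op a = f.op a ⊗ₗ f'.op a :=
  (app_map (SymmetricMonoidalEnrichment.tensorMap X X' Y Y') a (f, f')).symm

end
section Coherence

variable {D : Type u} [Category.{v} D] [MonoidalCategory D] {ι κ : Type}

/-- The right-bracketed tensor product of the objects labelled by a list. -/
def tl (X : ι → D) : List ι → D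
  | [] => 𝟙_ D
  | a :: L => X a ⊗ tl X L

/-- Formal composites of transpositions of adjacent, distinct labels. -/
inductive Pm : List ι → List ι → Type
  | nil : Pm [] []
  | cons (a : ι) {L L' : List ι} (p : Pm L L') : Pm (a :: L) (a :: L')
  | swap (a b : ι) (L : List ι) (h : a ≠ b) : Pm (a :: b :: L) (b :: a :: L)
  | trans {L L' L'' : List ι} (p : Pm L L') (p' : Pm L' L'') : Pm L L''

/-- The identity. -/
def Pm.refl : ∀ L : List ι, Pm L L
  | [] => .nil
  | a :: L => .cons a (Pm.refl L)

/-- The inverse. -/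
def Pm.symm : ∀ {L L' : List ι}, Pm L L' → Pm L' L
  | _, _, .nil => .nil
  | _, _, .cons a p => .cons a p.symm
  | _, _, .swap a b L h => .swap b a L h.symm
  | _, _, .trans p p' => .trans p'.symm p.symm

lemma Pm.exists_of_perm {L L' : List ι} (h : L.Perm L') (hL : L.Nodup) : Nonempty (Pm L L') := by
  induction h with
  | nil => exact ⟨.nil⟩
  | cons a _ ih => obtain ⟨p⟩ := ih (List.nodup_cons.1 hL).2; exact ⟨.cons a p⟩
  | swap a b L =>
    refine ⟨.swap b a L ?_⟩
    rintro rfl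
    simp at hL
  | trans h1 _ ih1 ih2 =>
    obtain ⟨p⟩ := ih1 hL
    obtain ⟨p'⟩ := ih2 (h1.nodup_iff.1 hL)
    exact ⟨.trans p p'⟩

/-- Extraction of a label to the front of a list. -/
inductive Fr (a : ι) : List ι → List ι → Type
  | here (L : List ι) : Fr a (a :: L) L
  | there (b : ι) {L M : List ι} (h : a ≠ b) (f : Fr a L M) : Fr a (b :: L) (b :: M)

lemma Fr.eq {a : ι} : ∀ {L M M' : List ι} (f : Fr a L M) (f' : Fr a L M'), M = M' ∧ HEq f f'
  | _, _, _, .here L, .here _ => ⟨rfl, HEq.rfl⟩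
  | _, _, _, .here L, .there _ h _ => (h rfl).elim
  | _, _, _, .there _ h _, .here _ => (h rfl).elim
  | _, _, _, .there b h f, .there _ _ f' => by
      obtain ⟨rfl, h⟩ := Fr.eq f f'
      cases h
      exact ⟨rfl, HEq.rfl⟩

variable [SymmetricCategory D]

/-- Exchange of two factors. -/
def sw (A B C : D) : A ⊗ (B ⊗ C) ⟶ B ⊗ (A ⊗ C) :=
  (α_ A B C).inv ≫ (β_ A B).hom ▷ C ≫ (α_ B A C).hom

lemma sw_sw (A B C : D) : sw A B C ≫ sw B A C = 𝟙 _ := by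
  simp [sw, ← comp_whiskerRight_assoc]

lemma sw_natural (A B : D) {C C' : D} (f : C ⟶ C') :
    A ◁ B ◁ f ≫ sw A B C' = sw A B C ≫ B ◁ A ◁ f := by
  simp only [sw, associator_inv_naturality_right_assoc, Category.assoc,
    whisker_exchange_assoc, associator_naturality_right]

lemma sw_braid (A B C E : D) :
    sw A B (C ⊗ E) ≫ B ◁ sw A C E ≫ sw B C (A ⊗ E) =
      A ◁ sw B C E ≫ sw A C (B ⊗ E) ≫ C ◁ sw A B E := by
  have h := congrArg (fun t => 𝟙 (A ⊗ B ⊗ C ⊗ E) ⊗≫ t ▷ E ⊗≫ 𝟙 (C ⊗ B ⊗ A ⊗ E))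
    (BraidedCategory.yang_baxter' A B C)
  calc _ = 𝟙 _ ⊗≫ ((β_ A B).hom ▷ C ⊗≫ B ◁ (β_ A C).hom ⊗≫ (β_ B C).hom ▷ A) ▷ E ⊗≫ 𝟙 _ := by
        simp only [sw]; monoidal
    _ = _ := h.trans (by simp only [sw]; monoidal)

lemma move_cons {A B L L' M M' : D} {p : L ⟶ L'} {f' : L' ⟶ B ⊗ M'} {f : L ⟶ B ⊗ M}
    {p' : M ⟶ M'} (e : p ≫ f' = f ≫ B ◁ p') :
    A ◁ p ≫ (A ◁ f' ≫ sw A B M') = (A ◁ f ≫ sw A B M) ≫ B ◁ A ◁ p' := by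
  rw [Category.assoc, ← sw_natural, ← whiskerLeft_comp_assoc, ← whiskerLeft_comp_assoc, e]

lemma move_swap (A B C : D) {L M : D} (f : L ⟶ C ⊗ M) :
    sw A B L ≫ B ◁ (A ◁ f ≫ sw A C M) ≫ sw B C (A ⊗ M) =
      (A ◁ (B ◁ f ≫ sw B C M) ≫ sw A C (B ⊗ M)) ≫ C ◁ sw A B M := by
  simp only [whiskerLeft_comp, Category.assoc]
  rw [← sw_braid, ← Category.assoc, ← sw_natural, Category.assoc]

/-- The isomorphism given by a formal composite of transpositions. -/
def Pm.ev (X : ι → D) : ∀ {L L' : List ι}, Pm L L' → (tl X L ⟶ tl X L')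
  | _, _, .nil => 𝟙 _
  | _, _, .cons a p => X a ◁ p.ev X
  | _, _, .swap a b L _ => sw (X a) (X b) (tl X L)
  | _, _, .trans p p' => p.ev X ≫ p'.ev X

/-- The isomorphism moving a factor to the front. -/
def Fr.ev (X : ι → D) {a : ι} : ∀ {L M : List ι}, Fr a L M → (tl X L ⟶ X a ⊗ tl X M)
  | _, _, .here _ => 𝟙 _
  | _, _, .there b (M := M) _ f => X b ◁ f.ev X ≫ sw (X b) (X a) (tl X M)

@[simp] lemma Pm.ev_refl (X : ι → D) : ∀ L : List ι, (Pm.refl L).ev X = 𝟙 _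
  | [] => rfl
  | a :: L => by simp [Pm.refl, Pm.ev, Pm.ev_refl X L, tl]

lemma Pm.move (X : ι → D) {a : ι} : ∀ {L L' M' : List ι} (p : Pm L L') (f' : Fr a L' M'),
    ∃ (M : List ι) (f : Fr a L M) (p' : Pm M M'), p.ev X ≫ f'.ev X = f.ev X ≫ X a ◁ p'.ev X
  | _, _, _, .nil, f' => nomatch f'
  | _, _, _, .cons _ p, .here _ =>
      ⟨_, .here _, p, (Category.comp_id (X a ◁ p.ev X)).trans (Category.id_comp _).symm⟩
  | _, _, _, .cons b p, .there _ h f' => by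
      obtain ⟨M, f, p', e⟩ := Pm.move X p f'
      exact ⟨_, .there b h f, .cons b p', move_cons e⟩
  | _, _, _, .swap x y L h, f' => by
      cases f' with
      | here =>
        refine ⟨_, .there x h.symm (.here _), .refl _, ?_⟩
        have : sw (X x) (X a) (tl X L) ≫ 𝟙 _ =
          (X x ◁ 𝟙 _ ≫ sw (X x) (X a) (tl X L)) ≫ X a ◁ 𝟙 _ := by simp
        rw [Pm.ev_refl]; exact this
      | there _ h' f' =>
        cases f' with
        | here =>
          refine ⟨_, .here _, .refl _, ?_⟩
          have : sw (X a) (X y) (tl X L) ≫ (X y ◁ 𝟙 _ ≫ sw (X y) (X a) (tl X L)) =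
            𝟙 _ ≫ X a ◁ 𝟙 _ := by simp [sw_sw]
          rw [Pm.ev_refl]; exact this
        | there _ h'' f =>
          exact ⟨_, .there x h'' (.there y h' f), .swap x y _ h,
            move_swap (X x) (X y) (X a) (f.ev X)⟩
  | _, _, _, .trans p p', f' => by
      obtain ⟨M, f, q, e⟩ := Pm.move X p' f'
      obtain ⟨M', f', q', e'⟩ := Pm.move X p f
      exact ⟨M', f', .trans q' q, by simp [Pm.ev, e, reassoc_of% e']⟩

lemma Pm.ev_nil (X : ι → D) : ∀ {L L' : List ι} (p : Pm L L'), L' = [] →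
    ∃ h : L = L', p.ev X = eqToHom (by rw [h])
  | _, _, .nil, _ => ⟨rfl, rfl⟩
  | _, _, .trans p p', h => by
      obtain ⟨rfl, e⟩ := Pm.ev_nil X p' h
      obtain ⟨rfl, e'⟩ := Pm.ev_nil X p h
      exact ⟨rfl, by simp [Pm.ev, e, e']⟩

/-- Coherence: formal composites of transpositions of distinct labels with the same source and
target have the same value. -/
theorem Pm.ev_unique (X : ι → D) : ∀ {L' L : List ι} (p q : Pm L L'), p.ev X = q.ev X
  | [], _, p, q => by
      obtain ⟨rfl, e⟩ := Pm.ev_nil X p rfl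
      obtain ⟨_, e'⟩ := Pm.ev_nil X q rfl
      rw [e, e']
  | a :: L', _, p, q => by
      obtain ⟨M, f, p', e⟩ := Pm.move X p (.here _)
      obtain ⟨M', f', q', e'⟩ := Pm.move X q (.here _)
      obtain ⟨rfl, h⟩ := Fr.eq f f'
      cases h
      have := Pm.ev_unique X p' q'
      simp only [Fr.ev] at e e'
      rw [← Category.comp_id (p.ev X), ← Category.comp_id (q.ev X)]
      exact e.trans ((by rw [this] : _ = _).trans e'.symm)

lemma Pm.ev_symm (X : ι → D) {L L' : List ι} (p : Pm L L') : p.ev X ≫ p.symm.ev X = 𝟙 _ := by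
  rw [← Pm.ev_refl X L]
  exact Pm.ev_unique X (.trans p p.symm) (.refl _)

lemma Pm.symm_ev (X : ι → D) {L L' : List ι} (p : Pm L L') : p.symm.ev X ≫ p.ev X = 𝟙 _ := by
  rw [← Pm.ev_refl X L']
  exact Pm.ev_unique X (.trans p.symm p) (.refl _)


/-! Canonical morphisms -/

def Pm.appendRight (M : List ι) : ∀ {L L' : List ι}, Pm L L' → Pm (L ++ M) (L' ++ M)
  | _, _, .nil => .refl M
  | _, _, .cons a p => .cons a (p.appendRight M)
  | _, _, .swap a b L h => .swap a b (L ++ M) h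
  | _, _, .trans p p' => .trans (p.appendRight M) (p'.appendRight M)

def Pm.appendLeft {M M' : List ι} (q : Pm M M') : ∀ L : List ι, Pm (L ++ M) (L ++ M')
  | [] => q
  | a :: L => .cons a (q.appendLeft L)

def Pm.appendAssoc : ∀ L M N : List ι, Pm ((L ++ M) ++ N) (L ++ (M ++ N))
  | [], M, N => .refl (M ++ N)
  | a :: L, M, N => .cons a (Pm.appendAssoc L M N)

def Pm.appendNil : ∀ L : List ι, Pm (L ++ []) L
  | [] => .nil
  | a :: L => .cons a (Pm.appendNil L)

/-- Concatenation of right-bracketed tensor products. -/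
def app (X : ι → D) : ∀ L L' : List ι, tl X L ⊗ tl X L' ≅ tl X (L ++ L')
  | [], L' => λ_ (tl X L')
  | a :: L, L' => α_ (X a) (tl X L) (tl X L') ≪≫ whiskerLeftIso (X a) (app X L L')

lemma appendRight_ev_cons {A P P' M Q Q' : D} {p : P ⟶ P'} {f : P ⊗ M ⟶ Q} {f' : P' ⊗ M ⟶ Q'}
    {q : Q ⟶ Q'} (e : p ▷ M ≫ f' = f ≫ q) :
    (A ◁ p) ▷ M ≫ ((α_ A P' M).hom ≫ A ◁ f') = ((α_ A P M).hom ≫ A ◁ f) ≫ A ◁ q := by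
  simp only [whisker_assoc, Category.assoc, Iso.inv_hom_id_assoc, ← whiskerLeft_comp, e]

lemma appendRight_ev_swap {A B P M Q : D} (f : P ⊗ M ⟶ Q) :
    sw A B P ▷ M ≫ ((α_ B (A ⊗ P) M).hom ≫ B ◁ ((α_ A P M).hom ≫ A ◁ f)) =
      ((α_ A (B ⊗ P) M).hom ≫ A ◁ ((α_ B P M).hom ≫ B ◁ f)) ≫ sw A B Q := by
  have : sw A B P ▷ M ≫ (α_ B (A ⊗ P) M).hom ≫ B ◁ (α_ A P M).hom =
    (α_ A (B ⊗ P) M).hom ≫ A ◁ (α_ B P M).hom ≫ sw A B (P ⊗ M) := by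
    simp only [sw]; monoidal
  simp only [whiskerLeft_comp, Category.assoc, sw_natural]
  rw [reassoc_of% this]

lemma Pm.appendRight_ev (X : ι → D) (M : List ι) : ∀ {L L' : List ι} (p : Pm L L'),
    p.ev X ▷ tl X M ≫ (app X L' M).hom = (app X L M).hom ≫ (p.appendRight M).ev X
  | _, _, .nil => by
      have : (𝟙 (𝟙_ D)) ▷ tl X M ≫ (λ_ (tl X M)).hom = (λ_ (tl X M)).hom ≫ 𝟙 _ := by simp
      exact this.trans (congrArg (fun t => (λ_ (tl X M)).hom ≫ t) (Pm.ev_refl X M).symm)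
  | _, _, .cons a p => appendRight_ev_cons (p.appendRight_ev X M)
  | _, _, .swap a b L h => appendRight_ev_swap (app X L M).hom
  | _, _, .trans p p' => by
      have h1 := p.appendRight_ev X M
      have h2 := p'.appendRight_ev X M
      simp only [Pm.ev, Pm.appendRight, comp_whiskerRight, Category.assoc]
      rw [h2, reassoc_of% h1]

lemma Pm.appendLeft_ev (X : ι → D) {M M' : List ι} (q : Pm M M') : ∀ L : List ι,
    tl X L ◁ q.ev X ≫ (app X L M').hom = (app X L M).hom ≫ (q.appendLeft L).ev X
  | [] => leftUnitor_naturality _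
  | a :: L => by
      have h := q.appendLeft_ev X L
      have : (X a ⊗ tl X L) ◁ q.ev X ≫ ((α_ (X a) (tl X L) (tl X M')).hom ≫
        X a ◁ (app X L M').hom) = ((α_ (X a) (tl X L) (tl X M)).hom ≫
        X a ◁ (app X L M).hom) ≫ X a ◁ (q.appendLeft L).ev X := by
        simp only [tensor_whiskerLeft, Category.assoc, Iso.inv_hom_id_assoc, ← whiskerLeft_comp, h]
      exact this

lemma Pm.appendAssoc_ev (X : ι → D) : ∀ L M N : List ι,
    (α_ (tl X L) (tl X M) (tl X N)).hom ≫ tl X L ◁ (app X M N).hom ≫ (app X L (M ++ N)).hom =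
      (app X L M).hom ▷ tl X N ≫ (app X (L ++ M) N).hom ≫ (Pm.appendAssoc L M N).ev X
  | [], M, N => by
      have : (α_ (𝟙_ D) (tl X M) (tl X N)).hom ≫ 𝟙_ D ◁ (app X M N).hom ≫ (λ_ _).hom =
        (λ_ (tl X M)).hom ▷ tl X N ≫ (app X M N).hom ≫ 𝟙 _ := by simp
      exact this.trans (congrArg (fun t => (λ_ (tl X M)).hom ▷ tl X N ≫ (app X M N).hom ≫ t)
        (Pm.ev_refl X (M ++ N)).symm)
  | a :: L, M, N => by
      have h := Pm.appendAssoc_ev X L M N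
      have : (α_ (X a ⊗ tl X L) (tl X M) (tl X N)).hom ≫ (X a ⊗ tl X L) ◁ (app X M N).hom ≫
          ((α_ (X a) (tl X L) (tl X (M ++ N))).hom ≫ X a ◁ (app X L (M ++ N)).hom) =
        ((α_ (X a) (tl X L) (tl X M)).hom ≫ X a ◁ (app X L M).hom) ▷ tl X N ≫
          ((α_ (X a) (tl X (L ++ M)) (tl X N)).hom ≫ X a ◁ (app X (L ++ M) N).hom) ≫
          X a ◁ (Pm.appendAssoc L M N).ev X := by
        simp only [tensor_whiskerLeft, comp_whiskerRight, whisker_assoc, Category.assoc,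
          Iso.inv_hom_id_assoc, ← whiskerLeft_comp, ← h]
        simp
      exact this

lemma appendNil_ev_cons {A B C : D} {f : B ⊗ 𝟙_ D ⟶ C} {g : C ⟶ B} (h : (ρ_ B).hom = f ≫ g) :
    (ρ_ (A ⊗ B)).hom = ((α_ A B (𝟙_ D)).hom ≫ A ◁ f) ≫ A ◁ g := by
  rw [Category.assoc, ← whiskerLeft_comp, ← h]; simp

lemma Pm.appendNil_ev (X : ι → D) : ∀ L : List ι,
    (ρ_ (tl X L)).hom = (app X L []).hom ≫ (Pm.appendNil L).ev X
  | [] => by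
      have : (ρ_ (𝟙_ D)).hom = (λ_ (𝟙_ D)).hom ≫ 𝟙 _ := by simp [unitors_equal]
      exact this
  | _ :: L => appendNil_ev_cons (Pm.appendNil_ev X L)

variable {X : ι → D} {A A' A'' B B' B'' C : D} {L L' L'' M M' N : List ι}

/-- `Can a b f` means that, under the identifications `a` and `b`, the morphism `f` is a
composite of symmetries permuting the labels. -/
def Can (a : A ≅ tl X L) (b : B ≅ tl X L') (f : A ⟶ B) : Prop :=
  ∃ p : Pm L L', f ≫ b.hom = a.hom ≫ p.ev X

lemma Can.unique {a : A ≅ tl X L} {b : B ≅ tl X L'} {f g : A ⟶ B} (hf : Can a b f)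
    (hg : Can a b g) : f = g := by
  obtain ⟨p, hp⟩ := hf
  obtain ⟨q, hq⟩ := hg
  rw [← cancel_mono b.hom, hp, hq, Pm.ev_unique X p q]

lemma Can.id (a : A ≅ tl X L) : Can a a (𝟙 A) := ⟨.refl L, by simp⟩

lemma Can.comp {a : A ≅ tl X L} {b : A' ≅ tl X L'} {c : A'' ≅ tl X L''} {f : A ⟶ A'}
    {g : A' ⟶ A''} (hf : Can a b f) (hg : Can b c g) : Can a c (f ≫ g) := by
  obtain ⟨p, hp⟩ := hf
  obtain ⟨q, hq⟩ := hg
  exact ⟨.trans p q, by simp [Pm.ev, hq, reassoc_of% hp]⟩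

lemma Can.inv {a : A ≅ tl X L} {b : B ≅ tl X L'} {e : A ≅ B} (h : Can a b e.hom) :
    Can b a e.inv := by
  obtain ⟨p, hp⟩ := h
  refine ⟨p.symm, ?_⟩
  rw [← cancel_epi e.hom, reassoc_of% hp, Pm.ev_symm]; simp

/-- Tensor product of identifications. -/
def dt (a : A ≅ tl X L) (b : B ≅ tl X L') : A ⊗ B ≅ tl X (L ++ L') := (a ⊗ᵢ b) ≪≫ app X L L'

lemma Can.tens {a : A ≅ tl X L} {a' : A' ≅ tl X L'} {b : B ≅ tl X M} {b' : B' ≅ tl X M'}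
    {f : A ⟶ A'} {g : B ⟶ B'} (hf : Can a a' f) (hg : Can b b' g) :
    Can (dt a b) (dt a' b') (f ⊗ₘ g) := by
  obtain ⟨p, hp⟩ := hf
  obtain ⟨q, hq⟩ := hg
  refine ⟨.trans (p.appendRight M) (q.appendLeft L'), ?_⟩
  simp only [dt, Iso.trans_hom, tensorIso_hom, tensorHom_comp_tensorHom_assoc, hp, hq,
    Pm.ev, Category.assoc]
  rw [← reassoc_of% (Pm.appendRight_ev X M p), ← Pm.appendLeft_ev,
    ← tensorHom_comp_tensorHom_assoc, tensorHom_def (p.ev X), Category.assoc]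

lemma assoc_aux {A B C A' B' C' E F G H : D} (a : A ⟶ A') (b : B ⟶ B') (c : C ⟶ C')
    {f : B' ⊗ C' ⟶ E} {g : A' ⊗ E ⟶ F} {f' : A' ⊗ B' ⟶ G} {g' : G ⊗ C' ⟶ H} {k : H ⟶ F}
    (h : (α_ A' B' C').hom ≫ A' ◁ f ≫ g = f' ▷ C' ≫ g' ≫ k) :
    (α_ A B C).hom ≫ (a ⊗ₘ ((b ⊗ₘ c) ≫ f)) ≫ g = ((((a ⊗ₘ b) ≫ f') ⊗ₘ c) ≫ g') ≫ k := by
  have h1 : a ⊗ₘ ((b ⊗ₘ c) ≫ f) = (a ⊗ₘ b ⊗ₘ c) ≫ A' ◁ f := by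
    rw [← id_tensorHom, tensorHom_comp_tensorHom, Category.comp_id]
  have h2 : ((a ⊗ₘ b) ≫ f') ⊗ₘ c = ((a ⊗ₘ b) ⊗ₘ c) ≫ f' ▷ C' := by
    rw [← tensorHom_id, tensorHom_comp_tensorHom, Category.comp_id]
  rw [h1, h2, Category.assoc, Category.assoc, Category.assoc, ← h, associator_naturality_assoc]

lemma Can.assoc (a : A ≅ tl X L) (b : B ≅ tl X M) (c : C ≅ tl X N) :
    Can (dt (dt a b) c) (dt a (dt b c)) (α_ A B C).hom :=
  ⟨.appendAssoc L M N, assoc_aux a.hom b.hom c.hom (Pm.appendAssoc_ev X L M N)⟩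

/-- The empty product. -/
def dnil (X : ι → D) : 𝟙_ D ≅ tl X [] := Iso.refl (𝟙_ D)

lemma Can.lunit (a : A ≅ tl X L) : Can (dt (dnil X) a) a (λ_ A).hom := by
  refine ⟨.refl L, ?_⟩
  have : (λ_ A).hom ≫ a.hom = ((𝟙 (𝟙_ D) ⊗ₘ a.hom) ≫ (λ_ _).hom) ≫ 𝟙 _ := by simp
  exact this.trans (congrArg (fun t => ((𝟙 (𝟙_ D) ⊗ₘ a.hom) ≫ (λ_ (tl X L)).hom) ≫ t)
    (Pm.ev_refl X L).symm)

lemma Can.runit (a : A ≅ tl X L) : Can (dt a (dnil X)) a (ρ_ A).hom := by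
  refine ⟨.appendNil L, ?_⟩
  have : (ρ_ A).hom ≫ a.hom = (a.hom ⊗ₘ 𝟙 (𝟙_ D)) ≫ (ρ_ (tl X L)).hom := by simp
  rw [this, Pm.appendNil_ev]
  exact (Category.assoc _ _ _).symm


lemma Can.pre (e : B ≅ A) (a : A ≅ tl X L) : Can (e ≪≫ a) a e.hom := ⟨.refl L, by simp⟩

lemma Can.hom (a : A ≅ tl X L) : Can a (Iso.refl _) a.hom := ⟨.refl L, by simp⟩

lemma Can.cast {a : A ≅ tl X L} {b : B ≅ tl X L'} {f g : A ⟶ B} (hf : Can a b f) (h : f = g) :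
    Can a b g := h ▸ hf

/-- A one-fold product. -/
def ds (X : ι → D) (a : ι) : X a ≅ tl X [a] := (ρ_ (X a)).symm

lemma dt_ds (X : ι → D) (a : ι) (L : List ι) :
    dt (ds X a) (Iso.refl (tl X L)) = Iso.refl (tl X (a :: L)) := by
  ext
  have : ((ρ_ (X a)).inv ⊗ₘ 𝟙 (tl X L)) ≫ (α_ (X a) (𝟙_ D) (tl X L)).hom ≫
    X a ◁ (λ_ (tl X L)).hom = 𝟙 _ := by simp
  exact this

lemma Can.braid_symm {a : A ≅ tl X L} {b : B ≅ tl X M} (h : Can (dt a b) (dt b a) (β_ A B).hom) :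
    Can (dt b a) (dt a b) (β_ B A).hom :=
  h.inv.cast (by rw [← cancel_epi (β_ A B).hom]; simp)

lemma Can.braid_tens {a : A ≅ tl X L} {b : B ≅ tl X M} {c : C ≅ tl X N}
    (h : Can (dt a b) (dt b a) (β_ A B).hom) (h' : Can (dt a c) (dt c a) (β_ A C).hom) :
    Can (dt a (dt b c)) (dt (dt b c) a) (β_ A (B ⊗ C)).hom := by
  refine ((Can.assoc a b c).inv.comp ((h.tens (.id c)).comp ((Can.assoc b a c).comp
    ((Can.tens (.id b) h').comp (Can.assoc b c a).inv)))).cast ?_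
  simp

lemma Can.braid_single (X : ι → D) (a b : ι) (h : a ≠ b) :
    Can (dt (ds X a) (ds X b)) (dt (ds X b) (ds X a)) (β_ (X a) (X b)).hom := by
  refine ⟨.swap a b [] h, ?_⟩
  have key (A B : D) : ((ρ_ A).inv ⊗ₘ (ρ_ B).inv) ≫ (α_ A (𝟙_ D) (B ⊗ 𝟙_ D)).hom ≫
      A ◁ (λ_ (B ⊗ 𝟙_ D)).hom = A ◁ (ρ_ B).inv := by
    rw [tensorHom_def']; simp
  have : (β_ (X a) (X b)).hom ≫ (((ρ_ (X b)).inv ⊗ₘ (ρ_ (X a)).inv) ≫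
      (α_ (X b) (𝟙_ D) (X a ⊗ 𝟙_ D)).hom ≫ X b ◁ (λ_ (X a ⊗ 𝟙_ D)).hom) =
    (((ρ_ (X a)).inv ⊗ₘ (ρ_ (X b)).inv) ≫
      (α_ (X a) (𝟙_ D) (X b ⊗ 𝟙_ D)).hom ≫ X a ◁ (λ_ (X b ⊗ 𝟙_ D)).hom) ≫
      sw (X a) (X b) (𝟙_ D) := by
    rw [key, key]
    simp only [sw]
    have h1 : X a ◁ (ρ_ (X b)).inv ≫ (α_ (X a) (X b) (𝟙_ D)).inv = (ρ_ (X a ⊗ X b)).inv := by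
      simp
    have h2 : (ρ_ (X b ⊗ X a)).inv ≫ (α_ (X b) (X a) (𝟙_ D)).hom = X b ◁ (ρ_ (X a)).inv := by
      simp
    rw [reassoc_of% h1, ← h2, rightUnitor_inv_naturality_assoc]
  exact this

lemma Can.braid_cons (X : ι → D) (a : ι) : ∀ M : List ι, (∀ b ∈ M, a ≠ b) →
    Can (dt (ds X a) (Iso.refl (tl X M))) (dt (Iso.refl (tl X M)) (ds X a))
      (β_ (X a) (tl X M)).hom
  | [], _ => ((Can.runit (ds X a)).comp (Can.lunit (ds X a)).inv).cast
      (braiding_tensorUnit_right (X a)).symm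
  | b :: M, h => by
      have := (Can.braid_single X a b (h b (by simp))).braid_tens
        (Can.braid_cons X a M fun c hc => h c (by simp [hc]))
      rw [dt_ds X b M] at this
      exact this

lemma Can.braid_refl (X : ι → D) (M : List ι) : ∀ L : List ι, (∀ a ∈ L, ∀ b ∈ M, a ≠ b) →
    Can (dt (Iso.refl (tl X L)) (Iso.refl (tl X M))) (dt (Iso.refl (tl X M)) (Iso.refl (tl X L)))
      (β_ (tl X L) (tl X M)).hom
  | [], _ => ((Can.lunit _).comp (Can.runit _).inv).cast (braiding_tensorUnit_left _).symm
  | a :: L, h => by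
      have := ((Can.braid_cons X a M (h a (by simp))).braid_symm.braid_tens
        (Can.braid_refl X M L fun c hc => h c (by simp [hc])).braid_symm).braid_symm
      rw [dt_ds X a L] at this
      exact this

lemma Can.braid (a : A ≅ tl X L) (b : B ≅ tl X M) (h : ∀ x ∈ L, ∀ y ∈ M, x ≠ y) :
    Can (dt a b) (dt b a) (β_ A B).hom := by
  refine (((Can.hom a).tens (Can.hom b)).comp ((Can.braid_refl X M L h).comp
    (Can.inv (e := b ⊗ᵢ a) ((Can.hom b).tens (Can.hom a))))).cast ?_
  rw [← Category.assoc, BraidedCategory.braiding_naturality, Category.assoc]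
  simp

/-- Concatenation of the lists `M a`, for `a` in a list. -/
def fm (M : ι → List κ) : List ι → List κ
  | [] => []
  | a :: L => M a ++ fm M L

/-- Substitution of products into a product. -/
def dl {X : κ → D} {Y : ι → D} {M : ι → List κ} (y : ∀ i, Y i ≅ tl X (M i)) :
    ∀ L : List ι, tl Y L ≅ tl X (fm M L)
  | [] => Iso.refl (𝟙_ D)
  | a :: L => dt (y a) (dl y L)

section
variable {X : κ → D} {Y : ι → D} {M : ι → List κ} (y : ∀ i, Y i ≅ tl X (M i))

lemma Can.sub_ev (h : ∀ i j, i ≠ j → ∀ a ∈ M i, ∀ b ∈ M j, a ≠ b) : ∀ {L L' : List ι}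
    (p : Pm L L'), Can (dl y L) (dl y L') (p.ev Y)
  | _, _, .nil => Can.id _
  | _, _, .cons a p => ((Can.id (y a)).tens (Can.sub_ev h p)).cast (id_tensorHom _ _)
  | _, _, .swap a b L hab =>
      ((Can.assoc (y a) (y b) (dl y L)).inv.comp (((Can.braid (y a) (y b) (h a b hab)).tens
        (Can.id (dl y L))).comp (Can.assoc (y b) (y a) (dl y L)))).cast (by simp; rfl)
  | _, _, .trans p p' => (Can.sub_ev h p).comp (Can.sub_ev h p')

lemma Can.sub (h : ∀ i j, i ≠ j → ∀ a ∈ M i, ∀ b ∈ M j, a ≠ b) {L L' : List ι} {w : A ≅ tl Y L}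
    {w' : A' ≅ tl Y L'} {f : A ⟶ A'} (hf : Can w w' f) :
    Can (w ≪≫ dl y L) (w' ≪≫ dl y L') f := by
  obtain ⟨p, hp⟩ := hf
  obtain ⟨q, hq⟩ := Can.sub_ev y h p
  exact ⟨q, by simp [reassoc_of% hp, hq]⟩

lemma Can.dl_app : ∀ L L' : List ι,
    Can (app Y L L' ≪≫ dl y (L ++ L')) (dt (dl y L) (dl y L')) (𝟙 _)
  | [], L' => ((Can.pre (λ_ (tl Y L')) (dl y L')).comp (Can.lunit (dl y L')).inv).cast (by simp; rfl)
  | a :: L, L' => by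
      have h := (Can.pre (α_ (Y a) (tl Y L) (tl Y L')) (dt (y a) (app Y L L' ≪≫ dl y (L ++ L')))).comp
        (((Can.id (y a)).tens (Can.dl_app L L')).comp (Can.assoc (y a) (dl y L) (dl y L')).inv)
      have e : app Y (a :: L) L' ≪≫ dl y (a :: L ++ L') =
          α_ (Y a) (tl Y L) (tl Y L') ≪≫ dt (y a) (app Y L L' ≪≫ dl y (L ++ L')) := by
        ext
        have : ((α_ (Y a) (tl Y L) (tl Y L')).hom ≫ Y a ◁ (app Y L L').hom) ≫
          (((y a).hom ⊗ₘ (dl y (L ++ L')).hom) ≫ (app X (M a) (fm M (L ++ L'))).hom) =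
          (α_ (Y a) (tl Y L) (tl Y L')).hom ≫ ((y a).hom ⊗ₘ ((app Y L L').hom ≫
            (dl y (L ++ L')).hom)) ≫ (app X (M a) (fm M (L ++ L'))).hom := by
          rw [← id_tensorHom, Category.assoc, tensorHom_comp_tensorHom_assoc, Category.id_comp]
        exact this
      rw [e]
      exact h.cast (by simp; rfl)

lemma Can.dl_dt {L L' : List ι} (w : A ≅ tl Y L) (z : B ≅ tl Y L') :
    Can (dt w z ≪≫ dl y (L ++ L')) (dt (w ≪≫ dl y L) (z ≪≫ dl y L')) (𝟙 _) := by
  obtain ⟨p, hp⟩ := Can.dl_app y L L'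
  refine ⟨p, ?_⟩
  simp only [Category.id_comp, Iso.trans_hom, dt, tensorIso_hom] at hp
  simp only [dt, Iso.trans_hom, tensorIso_hom, Category.id_comp, Category.assoc]
  rw [← tensorHom_comp_tensorHom_assoc, hp, Category.assoc]

lemma Can.dl_ds (a : ι) : Can (y a) (ds Y a ≪≫ dl y [a]) (𝟙 _) :=
  Can.inv (e := Iso.refl _) (((Can.pre (ds Y a) (dl y [a])).comp (Can.runit (y a))).cast
    (Iso.inv_hom_id _))
end

/-- The right-bracketed tensor product of a finite sequence of objects. -/
def tpr : ∀ n : ℕ, (Fin n → D) → D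
  | 0, _ => 𝟙_ D
  | n + 1, A => A 0 ⊗ tpr n fun i => A i.succ

/-- The tensor product of a finite sequence of morphisms. -/
def tmap : ∀ {n : ℕ} {A B : Fin n → D}, (∀ i, A i ⟶ B i) → (tpr n A ⟶ tpr n B)
  | 0, _, _, _ => 𝟙 _
  | _ + 1, _, _, f => f 0 ⊗ₘ tmap fun i => f i.succ

/-- Concatenation of a finite sequence of lists. -/
def fl : ∀ {n : ℕ}, (Fin n → List κ) → List κ
  | 0, _ => []
  | _ + 1, M => M 0 ++ fl fun i => M i.succ

lemma mem_fl {x : κ} : ∀ {n : ℕ} {M : Fin n → List κ}, x ∈ fl M ↔ ∃ i, x ∈ M i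
  | 0, _ => by simp [fl]
  | n + 1, M => by simp [fl, mem_fl, Fin.exists_fin_succ]

lemma nodup_fl : ∀ {n : ℕ} {M : Fin n → List κ}, (∀ i, (M i).Nodup) →
    (∀ i j x, x ∈ M i → x ∈ M j → i = j) → (fl M).Nodup
  | 0, _, _, _ => by simp [fl]
  | n + 1, M, h, h' => by
      refine List.Nodup.append (h 0) (nodup_fl (fun i => h i.succ) fun i j x hi hj =>
        Fin.succ_injective _ (h' _ _ x hi hj)) ?_
      intro x hx hx'
      obtain ⟨i, hi⟩ := mem_fl.1 hx'
      exact Fin.succ_ne_zero i (h' _ _ x hi hx)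

/-- The product of a finite sequence of labelled products. -/
def dtp {X : κ → D} : ∀ {n : ℕ} {A : Fin n → D} {M : Fin n → List κ}, (∀ i, A i ≅ tl X (M i)) →
    (tpr n A ≅ tl X (fl M))
  | 0, _, _, _ => Iso.refl (𝟙_ D)
  | _ + 1, _, _, a => dt (a 0) (dtp fun i => a i.succ)

lemma tmap_id : ∀ {n : ℕ} (A : Fin n → D), tmap (fun i => 𝟙 (A i)) = 𝟙 (tpr n A)
  | 0, _ => rfl
  | n + 1, A => by
      have := tmap_id fun i => A (Fin.succ i)
      simp only [tmap, this]
      exact id_tensorHom_id _ _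

lemma Can.tpr {X : κ → D} : ∀ {n : ℕ} {A B : Fin n → D} {M N : Fin n → List κ}
    {a : ∀ i, A i ≅ tl X (M i)} {b : ∀ i, B i ≅ tl X (N i)} {f : ∀ i, A i ⟶ B i},
    (∀ i, Can (a i) (b i) (f i)) → Can (dtp a) (dtp b) (tmap f)
  | 0, _, _, _, _, _, _, _, _ => Can.id _
  | _ + 1, _, _, _, _, _, _, _, h => (h 0).tens (Can.tpr fun i => h i.succ)

section
variable {X : κ → D} {Y : ι → D} {M : ι → List κ} (y : ∀ i, Y i ≅ tl X (M i))

lemma Can.dl_tpr : ∀ {n : ℕ} {A : Fin n → D} {K : Fin n → List ι} (w : ∀ i, A i ≅ tl Y (K i)),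
    Can (dtp fun i => w i ≪≫ dl y (K i)) (dtp w ≪≫ dl y (fl K)) (𝟙 _)
  | 0, _, _, _ => ⟨.nil, by simp; rfl⟩
  | n + 1, A, K, w => by
      have h := (Can.id (w 0 ≪≫ dl y (K 0))).tens (Can.dl_tpr fun i => w i.succ)
      have h' := Can.inv (e := Iso.refl _) (Can.dl_dt y (w 0) (dtp fun i => w i.succ))
      exact (h.comp h').cast (by simp; rfl)

lemma Can.dl_cmp {n : ℕ} {A : Fin n → D} {K : Fin n → List ι} {N : Fin n → List κ}
    {w : ∀ i, A i ≅ tl Y (K i)} {y' : ∀ i, A i ≅ tl X (N i)}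
    (h : ∀ i, Can (y' i) (w i ≪≫ dl y (K i)) (𝟙 _)) :
    Can (dtp y') (dtp w ≪≫ dl y (fl K)) (𝟙 _) :=
  ((Can.tpr h).comp (Can.dl_tpr y w)).cast (by rw [tmap_id, Category.id_comp])

end

section
variable {m n : ℕ} {k : Fin n → ℕ}

lemma perm_aux {M N : List κ} (hM : M.Nodup) (hN : N.Nodup) (h : ∀ x, x ∈ M ↔ x ∈ N) :
    Nonempty (Pm M N) := Pm.exists_of_perm ((List.perm_ext_iff_of_nodup hM hN).2 h) hM

lemma nodup_single : (fl fun i : Fin m => [i]).Nodup :=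
  nodup_fl (fun _ => by simp) (by simp +contextual)

lemma nodup_relabel (σ : Equiv.Perm (Fin m)) : (fl fun i : Fin m => [σ i]).Nodup :=
  nodup_fl (fun _ => by simp) (by simp only [List.mem_singleton]; rintro i j x rfl h; simpa using h)

lemma nodup_split (e : (Σ i : Fin n, Fin (k i)) ≃ Fin m) :
    (fl fun i => fl fun c => [e ⟨i, c⟩]).Nodup := by
  refine nodup_fl (fun i => nodup_fl (fun _ => by simp) ?_) ?_
  · simp only [List.mem_singleton]
    rintro a b x rfl h
    simpa using h
  · simp only [mem_fl, List.mem_singleton]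
    rintro i j x ⟨a, rfl⟩ ⟨b, h⟩
    exact congrArg Sigma.fst (e.injective h)

/-- A chosen composite of adjacent transpositions; any two choices have the same value. -/
def relabelPm (σ : Equiv.Perm (Fin m)) : Pm (fl fun i : Fin m => [i]) (fl fun i => [σ i]) :=
  Classical.choice <| perm_aux nodup_single (nodup_relabel σ) fun x => by
    simp only [mem_fl, List.mem_singleton, exists_eq', true_iff]
    exact ⟨σ.symm x, by simp⟩

/-- A chosen composite of adjacent transpositions; any two choices have the same value. -/
def splitPm (e : (Σ i : Fin n, Fin (k i)) ≃ Fin m) :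
    Pm (fl fun i : Fin m => [i]) (fl fun i => fl fun c => [e ⟨i, c⟩]) :=
  Classical.choice <| perm_aux nodup_single (nodup_split e) fun x => by
    simp only [mem_fl, List.mem_singleton, exists_eq', true_iff]
    exact ⟨(e.symm x).1, (e.symm x).2, by simp⟩

/-- The symmetry isomorphism permuting the factors: the `i`-th factor of the target is the
`σ i`-th factor of the source. -/
def relabel (σ : Equiv.Perm (Fin m)) (Y : Fin m → D) : tpr m Y ⟶ tpr m fun i => Y (σ i) :=
  (dtp fun i => ds Y i).hom ≫ (relabelPm σ).ev Y ≫ (dtp fun i => ds Y (σ i)).inv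

/-- The symmetry isomorphism grouping factors: the `c`-th factor in the `i`-th group is the
`e ⟨i, c⟩`-th factor of the source. -/
def split (e : (Σ i : Fin n, Fin (k i)) ≃ Fin m) (Y : Fin m → D) :
    tpr m Y ⟶ tpr n fun i => tpr (k i) fun c => Y (e ⟨i, c⟩) :=
  (dtp fun i => ds Y i).hom ≫ (splitPm e).ev Y ≫ (dtp fun i => dtp fun c => ds Y (e ⟨i, c⟩)).inv

variable {X : κ → D} {Y : Fin m → D} {M : Fin m → List κ}

lemma relabel_can (σ : Equiv.Perm (Fin m)) (y : ∀ i, Y i ≅ tl X (M i))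
    (h : ∀ i j, i ≠ j → ∀ a ∈ M i, ∀ b ∈ M j, a ≠ b) :
    Can (dtp y) (dtp fun i => y (σ i)) (relabel σ Y) := by
  have h0 : Can (dtp fun i => ds Y i) (dtp fun i => ds Y (σ i)) (relabel σ Y) :=
    ⟨relabelPm σ, by simp [relabel]⟩
  exact ((Can.dl_cmp y fun i => Can.dl_ds y i).comp ((Can.sub y h h0).comp
    (Can.inv (e := Iso.refl _) (Can.dl_cmp y fun i => Can.dl_ds y (σ i))))).cast (by simp)

lemma split_can (e : (Σ i : Fin n, Fin (k i)) ≃ Fin m) (y : ∀ i, Y i ≅ tl X (M i))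
    (h : ∀ i j, i ≠ j → ∀ a ∈ M i, ∀ b ∈ M j, a ≠ b) :
    Can (dtp y) (dtp fun i => dtp fun c => y (e ⟨i, c⟩)) (split e Y) := by
  have h0 : Can (dtp fun i => ds Y i) (dtp fun i => dtp fun c => ds Y (e ⟨i, c⟩)) (split e Y) :=
    ⟨splitPm e, by simp [split]⟩
  exact ((Can.dl_cmp y fun i => Can.dl_ds y i).comp ((Can.sub y h h0).comp
    (Can.inv (e := Iso.refl _) (Can.dl_cmp y fun i => Can.dl_cmp y fun c =>
      Can.dl_ds y (e ⟨i, c⟩))))).cast (by simp)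

end

end Coherence

section Naturality

variable {D : Type u} [Category.{v} D] [SimplicialCategory D] [MonoidalCategory D]
  [SymmetricCategory D] [SymmetricMonoidalEnrichment D] {ι κ : Type} {q r : SimplexCategoryᵒᵖ}
  {A A' B B' C C' A₂ A₂' B₂ B₂' : D}

/-- Commutative squares in simplicial degree `q` with two vertical sides in `D`. -/
def LSq (u : LHom q A A') (w : LHom q B B') (f : A ⟶ B) (f' : A' ⟶ B') : Prop :=
  u ≫ₗ degen q f' = degen q f ≫ₗ w

lemma LSq.id (u : LHom q A A') : LSq u u (𝟙 A) (𝟙 A') := by simp [LSq]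

lemma LSq.comp {u : LHom q A A'} {w : LHom q B B'} {z : LHom q C C'} {f : A ⟶ B} {f' : A' ⟶ B'}
    {g : B ⟶ C} {g' : B' ⟶ C'} (h : LSq u w f f') (h' : LSq w z g g') :
    LSq u z (f ≫ g) (f' ≫ g') := by
  unfold LSq at *
  rw [degen_comp, degen_comp, ← lcomp_assoc, h, lcomp_assoc, h', lcomp_assoc]

lemma LSq.inv {u : LHom q A A'} {w : LHom q B B'} {e : A ≅ B} {e' : A' ≅ B'}
    (h : LSq u w e.hom e'.hom) : LSq w u e.inv e'.inv := by
  unfold LSq at *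
  have : degen q e.inv ≫ₗ (u ≫ₗ degen q e'.hom) ≫ₗ degen q e'.inv =
      degen q e.inv ≫ₗ (degen q e.hom ≫ₗ w) ≫ₗ degen q e'.inv := by rw [h]
  rw [lcomp_assoc, lcomp_assoc, ← degen_comp, degen_comp_assoc, e.inv_hom_id, e'.hom_inv_id,
    id_lcomp, lcomp_id] at this
  exact this.symm

lemma LSq.tens {u : LHom q A A'} {w : LHom q B B'} {f : A ⟶ B} {f' : A' ⟶ B'}
    {u₂ : LHom q A₂ A₂'} {w₂ : LHom q B₂ B₂'} {f₂ : A₂ ⟶ B₂} {f₂' : A₂' ⟶ B₂'}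
    (h : LSq u w f f') (h₂ : LSq u₂ w₂ f₂ f₂') :
    LSq (u ⊗ₗ u₂) (w ⊗ₗ w₂) (f ⊗ₘ f₂) (f' ⊗ₘ f₂') := by
  unfold LSq at *
  rw [degen_tens, degen_tens, ← ltens_comp, ← ltens_comp, h, h₂]

lemma LSq.sw (u : LHom q A A') (w : LHom q B B') (z : LHom q C C') :
    LSq (u ⊗ₗ w ⊗ₗ z) (w ⊗ₗ u ⊗ₗ z) (sw A B C) (sw A' B' C') := by
  have h : LSq ((u ⊗ₗ w) ⊗ₗ z) ((w ⊗ₗ u) ⊗ₗ z) ((β_ A B).hom ⊗ₘ 𝟙 C) ((β_ A' B').hom ⊗ₘ 𝟙 C') :=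
    LSq.tens (lbraid u w) (LSq.id z)
  have h1 : LSq ((u ⊗ₗ w) ⊗ₗ z) _ (α_ A B C).hom (α_ A' B' C').hom := lassoc u w z
  have h2 : LSq ((w ⊗ₗ u) ⊗ₗ z) _ (α_ B A C).hom (α_ B' A' C').hom := lassoc w u z
  rw [tensorHom_id, tensorHom_id] at h
  exact h1.inv.comp (h.comp h2)

/-- The tensor product of `q`-simplices of mapping spaces labelled by a list. -/
def ltl {Y Y' : ι → D} (g : ∀ a, LHom q (Y a) (Y' a)) : ∀ L : List ι, LHom q (tl Y L) (tl Y' L)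
  | [] => degen q (𝟙 (𝟙_ D))
  | a :: L => g a ⊗ₗ ltl g L

/-- The tensor product of a finite sequence of `q`-simplices of mapping spaces. -/
def ltp : ∀ {n : ℕ} {A B : Fin n → D}, (∀ i, LHom q (A i) (B i)) → LHom q (tpr n A) (tpr n B)
  | 0, _, _, _ => degen q (𝟙 (𝟙_ D))
  | _ + 1, _, _, f => f 0 ⊗ₗ ltp fun i => f i.succ

lemma degen_tmap : ∀ {n : ℕ} {A B : Fin n → D} (f : ∀ i, A i ⟶ B i),
    degen q (tmap f) = ltp fun i => degen q (f i)
  | 0, _, _, _ => rfl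
  | _ + 1, _, _, f => (degen_tens _ _).trans (congrArg (fun t => degen q (f 0) ⊗ₗ t)
      (degen_tmap fun i => f i.succ))

lemma ltp_comp : ∀ {n : ℕ} {A B C : Fin n → D} (f : ∀ i, LHom q (A i) (B i))
    (g : ∀ i, LHom q (B i) (C i)), ltp (fun i => f i ≫ₗ g i) = ltp f ≫ₗ ltp g
  | 0, _, _, _, _, _ => (id_lcomp _).symm
  | _ + 1, _, _, _, f, g => (congrArg (fun t => (f 0 ≫ₗ g 0) ⊗ₗ t)
      (ltp_comp (fun i => f i.succ) fun i => g i.succ)).trans (ltens_comp _ _ _ _)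

lemma op_ltp (a : q ⟶ r) : ∀ {n : ℕ} {A B : Fin n → D} (f : ∀ i, LHom q (A i) (B i)),
    (ltp f).op a = ltp fun i => (f i).op a
  | 0, _, _, _ => op_degen a _
  | _ + 1, _, _, f => (op_ltens a _ _).trans (congrArg (fun t => (f 0).op a ⊗ₗ t)
      (op_ltp a fun i => f i.succ))

section
variable {Y Y' : ι → D} (g : ∀ a, LHom q (Y a) (Y' a))

lemma LSq.ev : ∀ {L L' : List ι} (p : Pm L L'), LSq (ltl g L) (ltl g L') (p.ev Y) (p.ev Y')
  | _, _, .nil => LSq.id _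
  | _, _, .cons a p => by
      have := (LSq.id (g a)).tens (LSq.ev p)
      rw [id_tensorHom, id_tensorHom] at this
      exact this
  | _, _, .swap a b L _ => LSq.sw (g a) (g b) (ltl g L)
  | _, _, .trans p p' => (LSq.ev p).comp (LSq.ev p')

lemma LSq.app : ∀ L L' : List ι,
    LSq (ltl g L ⊗ₗ ltl g L') (ltl g (L ++ L')) (app Y L L').hom (app Y' L L').hom
  | [], L' => lunit (ltl g L')
  | a :: L, L' => by
      have h : LSq ((g a ⊗ₗ ltl g L) ⊗ₗ ltl g L') _ (α_ (Y a) (tl Y L) (tl Y L')).hom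
        (α_ (Y' a) (tl Y' L) (tl Y' L')).hom := lassoc (g a) (ltl g L) (ltl g L')
      have h' := (LSq.id (g a)).tens (LSq.app L L')
      rw [id_tensorHom, id_tensorHom] at h'
      exact h.comp h'

lemma LSq.ds (a : ι) : LSq (g a) (ltl g [a]) (ds Y a).hom (ds Y' a).hom :=
  LSq.inv (e := ρ_ (Y a)) (e' := ρ_ (Y' a)) (runit (g a))

lemma LSq.dtp : ∀ {n : ℕ} {A B : Fin n → D} {M : Fin n → List ι} {u : ∀ i, LHom q (A i) (B i)}
    {a : ∀ i, A i ≅ tl Y (M i)} {b : ∀ i, B i ≅ tl Y' (M i)},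
    (∀ i, LSq (u i) (ltl g (M i)) (a i).hom (b i).hom) →
    LSq (ltp u) (ltl g (fl M)) (dtp a).hom (dtp b).hom
  | 0, _, _, _, _, _, _, _ => LSq.id _
  | _ + 1, _, _, _, _, _, _, h => ((h 0).tens (LSq.dtp fun i => h i.succ)).comp (LSq.app g _ _)

end

variable {m n : ℕ} {k : Fin n → ℕ} {Y Y' : Fin m → D} (g : ∀ i, LHom q (Y i) (Y' i))

lemma relabel_natural (σ : Equiv.Perm (Fin m)) :
    ltp g ≫ₗ degen q (relabel σ Y') = degen q (relabel σ Y) ≫ₗ ltp fun i => g (σ i) :=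
  (LSq.dtp g fun i => LSq.ds g i).comp ((LSq.ev g _).comp
    (LSq.dtp g fun i => LSq.ds g (σ i)).inv)

lemma split_natural (e : (Σ i : Fin n, Fin (k i)) ≃ Fin m) :
    ltp g ≫ₗ degen q (split e Y') =
      degen q (split e Y) ≫ₗ ltp fun i => ltp fun c => g (e ⟨i, c⟩) :=
  (LSq.dtp g fun i => LSq.ds g i).comp ((LSq.ev g _).comp
    (LSq.dtp g fun i => LSq.dtp g fun c => LSq.ds g (e ⟨i, c⟩)).inv)

end Naturality

section Powers

variable {D : Type u} [Category.{v} D] [MonoidalCategory D] [SymmetricCategory D]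
  {m n : ℕ} {k : Fin n → ℕ} (x : D)

/-- The tensor power of an object. -/
abbrev pw (n : ℕ) (x : D) : D := tpr n fun _ => x

/-- The labelled object all of whose labels are `x`. -/
def cst (m : ℕ) (x : D) : Fin m → D := fun _ => x

/-- A tensor power of `x`, with factors labelled by `E`. -/
def dpw {n : ℕ} (E : Fin n → Fin m) : pw n x ≅ tl (cst m x) (fl fun i => [E i]) :=
  dtp fun i => ds (cst m x) (E i)

/-- A product of tensor powers of `x`, with factors labelled by `E`. -/
def dpp (E : ∀ i, Fin (k i) → Fin m) :
    tpr n (fun i => pw (k i) x) ≅ tl (cst m x) (fl fun i => fl fun c => [E i c]) :=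
  dtp fun i => dpw x (E i)

/-- The symmetry isomorphisms of a tensor power. -/
def pwRelabel (σ : Equiv.Perm (Fin m)) : pw m x ⟶ pw m x := relabel σ fun _ => x

/-- Decomposition of a tensor power into a product of tensor powers: the `c`-th factor in the
`i`-th group is the `e ⟨i, c⟩`-th factor of the source. -/
def pwSplit (e : (Σ i : Fin n, Fin (k i)) ≃ Fin m) : pw m x ⟶ tpr n fun i => pw (k i) x :=
  split e fun _ => x

lemma single_ne {i j : Fin m} (h : i ≠ j) : ∀ a ∈ [i], ∀ b ∈ [j], a ≠ b := by simpa using h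

lemma pwRelabel_can (σ : Equiv.Perm (Fin m)) (τ : Fin m ↪ Fin n) :
    Can (dpw x τ) (dpw x fun i => τ (σ i)) (pwRelabel x σ) :=
  relabel_can (Y := fun _ => x) σ (fun i => ds (cst n x) (τ i)) fun _ _ h =>
    single_ne fun e => h (τ.injective e)

lemma pwSplit_can {t : ℕ} (e : (Σ i : Fin n, Fin (k i)) ≃ Fin m) (τ : Fin m ↪ Fin t) :
    Can (dpw x τ) (dpp x fun i c => τ (e ⟨i, c⟩)) (pwSplit x e) :=
  split_can (Y := fun _ => x) e (fun i => ds (cst t x) (τ i)) fun _ _ h =>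
    single_ne fun e => h (τ.injective e)

lemma pwSplit_can' {t : ℕ} (e : (Σ i : Fin n, Fin (k i)) ≃ Fin m) (τ : Fin m ↪ Fin t)
    (E : ∀ i, Fin (k i) → Fin t) (h : ∀ i c, τ (e ⟨i, c⟩) = E i c) :
    Can (dpw x τ) (dpp x E) (pwSplit x e) := by
  obtain rfl : (fun i c => τ (e ⟨i, c⟩)) = E := by funext i c; exact h i c
  exact pwSplit_can x e τ

/-- The first tensor power of an object is that object. -/
def pwOne : pw 1 x ⟶ x := (ρ_ x).hom

lemma relabel_one : pwRelabel x (1 : Equiv.Perm (Fin m)) = 𝟙 _ :=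
  (pwRelabel_can x 1 (.refl _)).unique (Can.id _)

lemma relabel_mul (σ τ : Equiv.Perm (Fin m)) :
    pwRelabel x (σ * τ) = pwRelabel x σ ≫ pwRelabel x τ :=
  (pwRelabel_can x (σ * τ) (.refl _)).unique
    ((pwRelabel_can x σ (.refl _)).comp (pwRelabel_can x τ σ.toEmbedding))

lemma relabel_split (σ : Equiv.Perm (Fin m)) (e : (Σ i : Fin n, Fin (k i)) ≃ Fin m) :
    pwRelabel x σ ≫ pwSplit x e = pwSplit x (e.trans σ) :=
  ((pwRelabel_can x σ (.refl _)).comp (pwSplit_can x e σ.toEmbedding)).unique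
    (pwSplit_can x (e.trans σ) (.refl _))

lemma split_relabel (e : (Σ i : Fin n, Fin (k i)) ≃ Fin m) (σ : Equiv.Perm (Fin n))
    (e' : (Σ i : Fin n, Fin (k (σ i))) ≃ Fin m) (h : ∀ i c, e' ⟨i, c⟩ = e ⟨σ i, c⟩) :
    pwSplit x e ≫ relabel σ (fun i => pw (k i) x) = pwSplit x e' := by
  have h1 := (pwSplit_can x e (.refl _)).comp (relabel_can (Y := fun i => pw (k i) x) σ
    (fun i => dpw x fun c => e ⟨i, c⟩) (by
      simp only [mem_fl, List.mem_singleton]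
      rintro i j hij _ ⟨a, rfl⟩ _ ⟨b, rfl⟩ hab
      exact hij (congrArg Sigma.fst (e.injective hab))))
  exact h1.unique (pwSplit_can' x e' (.refl _) _ h)

lemma split_tmap_relabel (e e' : (Σ i : Fin n, Fin (k i)) ≃ Fin m)
    (τ : ∀ i, Equiv.Perm (Fin (k i))) (h : ∀ i c, e' ⟨i, c⟩ = e ⟨i, τ i c⟩) :
    pwSplit x e ≫ tmap (fun i => pwRelabel x (τ i)) = pwSplit x e' := by
  have h1 := (pwSplit_can x e (.refl _)).comp (Can.tpr fun i => pwRelabel_can x (τ i)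
    ⟨fun c => e ⟨i, c⟩, fun a b hab => by simpa using hab⟩)
  exact h1.unique (pwSplit_can' x e' (.refl _) _ h)

lemma split_unit_left (e : (Σ _ : Fin 1, Fin m) ≃ Fin m) (h : ∀ c, e ⟨0, c⟩ = c) :
    pwSplit x e ≫ (ρ_ (pw m x)).hom = 𝟙 _ :=
  ((pwSplit_can' x e (.refl _) (fun _ c => c) fun i c => by
    obtain rfl := Subsingleton.elim i 0; exact h c).comp
      (Can.runit (dpw x fun c : Fin m => c))).unique (Can.id _)

lemma split_unit_right (e : (Σ _ : Fin n, Fin 1) ≃ Fin n) (h : ∀ i, e ⟨i, 0⟩ = i) :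
    pwSplit x e ≫ tmap (fun _ => pwOne x) = 𝟙 _ :=
  ((pwSplit_can' x e (.refl _) (fun i _ => i) fun i c => by
    obtain rfl := Subsingleton.elim c 0; exact h i).comp
      (Can.tpr fun i => Can.runit (ds (cst n x) i))).unique (Can.id _)

lemma split_assoc {t : ℕ} {l : Fin m → ℕ} {s : Fin n → ℕ}
    (e : (Σ i : Fin n, Fin (k i)) ≃ Fin m) (e₂ : (Σ j : Fin m, Fin (l j)) ≃ Fin t)
    (e₃ : (Σ i : Fin n, Fin (s i)) ≃ Fin t)
    (e₁ : ∀ i, (Σ c : Fin (k i), Fin (l (e ⟨i, c⟩))) ≃ Fin (s i))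
    (h : ∀ i c d, e₂ ⟨e ⟨i, c⟩, d⟩ = e₃ ⟨i, e₁ i ⟨c, d⟩⟩) :
    pwSplit x e₂ ≫ split e (fun j => pw (l j) x) =
      pwSplit x e₃ ≫ tmap fun i => pwSplit x (e₁ i) := by
  have h1 := (pwSplit_can x e₂ (.refl _)).comp (split_can (Y := fun j => pw (l j) x) e
    (fun j => dpw x fun c => e₂ ⟨j, c⟩) (by
      simp only [mem_fl, List.mem_singleton]
      rintro i j hij _ ⟨a, rfl⟩ _ ⟨b, rfl⟩ hab
      exact hij (congrArg Sigma.fst (e₂.injective hab))))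
  have h2 := (pwSplit_can x e₃ (.refl _)).comp (Can.tpr fun i => pwSplit_can x (e₁ i)
    ⟨fun c => e₃ ⟨i, c⟩, fun a b hab => by simpa using hab⟩)
  have : (fun i c d => e₂ ⟨e ⟨i, c⟩, d⟩) =
    fun (i : Fin n) (c : Fin (k i)) (d : Fin (l (e ⟨i, c⟩))) => e₃ ⟨i, e₁ i ⟨c, d⟩⟩ := by
    funext i c d; exact h i c d
  have key (E : ∀ (i : Fin n) (c : Fin (k i)), Fin (l (e ⟨i, c⟩)) → Fin t)
    (hE : E = fun i c d => e₃ ⟨i, e₁ i ⟨c, d⟩⟩) {f : pw t x ⟶ _}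
    (hf : Can (dpw x fun i => i) (dtp fun i => dtp fun c => dpw x (E i c)) f) :
    f = pwSplit x e₃ ≫ tmap fun i => pwSplit x (e₁ i) := by
    subst hE
    exact hf.unique h2
  exact key _ this h1

end Powers

/-! Operads -/

/-- A symmetric operad in sets. The set `P n` consists of the operations with `n` inputs. The
composite `comp e p q` is formed from an operation `p` with `n` inputs and operations
`q i` with `k i` inputs; the bijection `e` says which input of the composite is fed
into the `c`-th input of `q i`. -/
structure Operad where
  P : ℕ → Type v
  act {n : ℕ} : Equiv.Perm (Fin n) → P n → P n
  one : P 1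
  comp {m n : ℕ} {k : Fin n → ℕ} (e : (Σ i : Fin n, Fin (k i)) ≃ Fin m) :
    P n → (∀ i, P (k i)) → P m
  one_act {n : ℕ} (p : P n) : act 1 p = p
  mul_act {n : ℕ} (σ τ : Equiv.Perm (Fin n)) (p : P n) : act (σ * τ) p = act σ (act τ p)
  act_comp {m n : ℕ} {k : Fin n → ℕ} (σ : Equiv.Perm (Fin m))
    (e : (Σ i : Fin n, Fin (k i)) ≃ Fin m) (p : P n) (q : ∀ i, P (k i)) :
    act σ (comp e p q) = comp (e.trans σ) p q
  comp_act {m n : ℕ} {k : Fin n → ℕ} (e : (Σ i : Fin n, Fin (k i)) ≃ Fin m)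
    (σ : Equiv.Perm (Fin n)) (e' : (Σ i : Fin n, Fin (k (σ i))) ≃ Fin m)
    (h : ∀ i c, e' ⟨i, c⟩ = e ⟨σ i, c⟩) (p : P n) (q : ∀ i, P (k i)) :
    comp e (act σ p) q = comp e' p fun i => q (σ i)
  comp_act' {m n : ℕ} {k : Fin n → ℕ} (e e' : (Σ i : Fin n, Fin (k i)) ≃ Fin m)
    (τ : ∀ i, Equiv.Perm (Fin (k i))) (h : ∀ i c, e' ⟨i, c⟩ = e ⟨i, τ i c⟩) (p : P n)
    (q : ∀ i, P (k i)) : comp e p (fun i => act (τ i) (q i)) = comp e' p q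
  one_comp {m : ℕ} (e : (Σ _ : Fin 1, Fin m) ≃ Fin m) (h : ∀ c, e ⟨0, c⟩ = c) (q : P m) :
    comp e one (fun _ => q) = q
  comp_one {n : ℕ} (e : (Σ _ : Fin n, Fin 1) ≃ Fin n) (h : ∀ i, e ⟨i, 0⟩ = i) (p : P n) :
    comp e p (fun _ => one) = p
  assoc {m n t : ℕ} {k : Fin n → ℕ} {l : Fin m → ℕ} {s : Fin n → ℕ}
    (e : (Σ i : Fin n, Fin (k i)) ≃ Fin m) (e₂ : (Σ j : Fin m, Fin (l j)) ≃ Fin t)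
    (e₃ : (Σ i : Fin n, Fin (s i)) ≃ Fin t)
    (e₁ : ∀ i, (Σ c : Fin (k i), Fin (l (e ⟨i, c⟩))) ≃ Fin (s i))
    (h : ∀ i c d, e₂ ⟨e ⟨i, c⟩, d⟩ = e₃ ⟨i, e₁ i ⟨c, d⟩⟩)
    (p : P n) (q : ∀ i, P (k i)) (r : ∀ j, P (l j)) :
    comp e₂ (comp e p q) r = comp e₃ p fun i => comp (e₁ i) (q i) fun c => r (e ⟨i, c⟩)

/-- Morphisms of operads. -/
@[ext]
structure Operad.Hom (P Q : Operad.{v}) where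
  app (n : ℕ) : P.P n → Q.P n
  act {n : ℕ} (σ : Equiv.Perm (Fin n)) (p : P.P n) : app n (P.act σ p) = Q.act σ (app n p)
  one : app 1 P.one = Q.one
  comp {m n : ℕ} {k : Fin n → ℕ} (e : (Σ i : Fin n, Fin (k i)) ≃ Fin m) (p : P.P n)
    (q : ∀ i, P.P (k i)) : app m (P.comp e p q) = Q.comp e (app n p) fun i => app (k i) (q i)

instance : Category Operad.{v} where
  Hom := Operad.Hom
  id P := ⟨fun _ p => p, fun _ _ => rfl, rfl, fun _ _ _ => rfl⟩
  comp f g := ⟨fun n p => g.app n (f.app n p), fun σ p => by rw [f.act, g.act],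
    by rw [f.one, g.one], fun e p q => by rw [f.comp, g.comp]⟩

@[ext]
lemma Operad.hom_ext {P Q : Operad.{v}} {f g : P ⟶ Q} (h : ∀ n p, f.app n p = g.app n p) :
    f = g := Operad.Hom.ext (by funext n p; exact h n p)

/-- The functor of operations with `n` inputs. -/
def Operad.arity (n : ℕ) : Operad.{v} ⥤ Type v where
  obj P := P.P n
  map f := ↾(f.app n)

/-- Simplicial operads: these are the same as operads in simplicial sets. -/
abbrev SimplicialOperad := SimplicialObject Operad.{v}

/-- The simplicial set of operations with `n` inputs. -/
def SimplicialOperad.level (n : ℕ) : SimplicialOperad.{v} ⥤ SSet.{v} :=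
  (SimplicialObject.whiskering _ _).obj (Operad.arity n)

section EndOperad

variable {D : Type u} [Category.{v} D] [SimplicialCategory D] [MonoidalCategory D]
  [SymmetricCategory D] [SymmetricMonoidalEnrichment D]

/-- The endomorphism operad of `x` in simplicial degree `q`. -/
def endAt (q : SimplexCategoryᵒᵖ) (x : D) : Operad.{v} where
  P n := LHom q (pw n x) x
  act σ p := degen q (pwRelabel x σ) ≫ₗ p
  one := degen q (pwOne x)
  comp e p g := degen q (pwSplit x e) ≫ₗ ltp g ≫ₗ p
  one_act p := by rw [relabel_one, id_lcomp]
  mul_act σ τ p := by rw [relabel_mul, degen_comp, lcomp_assoc]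
  act_comp σ e p g := by rw [degen_comp_assoc, relabel_split]
  comp_act {m n k} e σ e' h p g := by
    have : ltp g ≫ₗ degen q (pwRelabel x σ) =
      degen q (relabel σ fun i => pw (k i) x) ≫ₗ ltp fun i => g (σ i) := relabel_natural g σ
    rw [← lcomp_assoc (ltp g), this, lcomp_assoc, degen_comp_assoc, split_relabel x e σ e' h]
  comp_act' e e' τ h p g := by
    rw [ltp_comp, ← degen_tmap, lcomp_assoc, degen_comp_assoc, split_tmap_relabel x e e' τ h]
  one_comp {m} e h g := by
    have : (ltp fun _ : Fin 1 => g) ≫ₗ degen q (pwOne x) = degen q (ρ_ (pw m x)).hom ≫ₗ g :=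
      runit g
    have h' := congrArg (fun t => degen q (pwSplit x e) ≫ₗ t) this
    refine h'.trans ?_
    refine (degen_comp_assoc (pwSplit x e) (ρ_ (pw m x)).hom g).trans ?_
    rw [split_unit_left x e h, id_lcomp]
  comp_one e h p := by
    rw [← degen_tmap, degen_comp_assoc, split_unit_right x e h, id_lcomp]
  assoc {m n t k l s} e e₂ e₃ e₁ h p g r := by
    have : ltp r ≫ₗ degen q (pwSplit x e) = degen q (split e fun j => pw (l j) x) ≫ₗ
      ltp fun i => ltp fun c => r (e ⟨i, c⟩) := split_natural r e
    rw [← lcomp_assoc (ltp r), this, lcomp_assoc, degen_comp_assoc, split_assoc x e e₂ e₃ e₁ h,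
      ltp_comp, ltp_comp, ← degen_tmap, degen_comp]
    simp only [lcomp_assoc]

lemma op_endAt_comp {q r : SimplexCategoryᵒᵖ} (a : q ⟶ r) (x : D) {m n : ℕ} {k : Fin n → ℕ}
    (e : (Σ i : Fin n, Fin (k i)) ≃ Fin m) (p : LHom q (pw n x) x)
    (g : ∀ i, LHom q (pw (k i) x) x) : (degen q (pwSplit x e) ≫ₗ ltp g ≫ₗ p).op a =
      degen r (pwSplit x e) ≫ₗ ltp (fun i => (g i).op a) ≫ₗ p.op a := by
  rw [op_lcomp, op_lcomp, op_degen, op_ltp]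

/-- The endomorphism operad of `x`: its simplicial set of operations with `n` inputs is
the mapping space from the `n`-th tensor power of `x` to `x`. -/
def endOperad (x : D) : SimplicialOperad.{v} where
  obj q := endAt q x
  map {q r} a :=
    { app := fun _ p => LHom.op a p
      act := fun σ p => (op_lcomp a _ _).trans (by rw [op_degen]; rfl)
      one := op_degen a _
      comp := fun e p g => op_endAt_comp a x e p g }
  map_id q := by ext n p; exact lop_id p
  map_comp a b := by ext n p; exact lop_op a b p

/-- The tensor power of a morphism. -/
def pmap (n : ℕ) {x y : D} (f : x ⟶ y) : pw n x ⟶ pw n y := tmap fun _ => f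

variable {x y : D} {q : SimplexCategoryᵒᵖ}

lemma degen_pmap (n : ℕ) (f : x ⟶ y) :
    degen q (pmap n f) = ltp fun _ : Fin n => degen q f := degen_tmap _

lemma compat_act (f : x ⟶ y) {n : ℕ} (σ : Equiv.Perm (Fin n)) {a : LHom q (pw n x) x}
    {b : LHom q (pw n y) y} (w : a ≫ₗ degen q f = degen q (pmap n f) ≫ₗ b) :
    (degen q (pwRelabel x σ) ≫ₗ a) ≫ₗ degen q f =
      degen q (pmap n f) ≫ₗ degen q (pwRelabel y σ) ≫ₗ b := by
  have h : ltp (fun _ : Fin n => degen q f) ≫ₗ degen q (pwRelabel y σ) =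
    degen q (pwRelabel x σ) ≫ₗ ltp fun _ => degen q f := relabel_natural _ σ
  rw [lcomp_assoc, w, degen_pmap, ← lcomp_assoc, ← h, lcomp_assoc]

lemma compat_one (f : x ⟶ y) :
    degen q (pwOne x) ≫ₗ degen q f = degen q (pmap 1 f) ≫ₗ degen q (pwOne y) :=
  (runit (degen q f)).symm.trans
    (congrArg (fun t => t ≫ₗ degen q (ρ_ y).hom) (degen_tens f (𝟙 (𝟙_ D))).symm)

lemma compat_comp (f : x ⟶ y) {m n : ℕ} {k : Fin n → ℕ} (e : (Σ i : Fin n, Fin (k i)) ≃ Fin m)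
    {a : LHom q (pw n x) x} {b : LHom q (pw n y) y}
    (w : a ≫ₗ degen q f = degen q (pmap n f) ≫ₗ b) {g : ∀ i, LHom q (pw (k i) x) x}
    {g' : ∀ i, LHom q (pw (k i) y) y}
    (w' : ∀ i, g i ≫ₗ degen q f = degen q (pmap (k i) f) ≫ₗ g' i) :
    (degen q (pwSplit x e) ≫ₗ ltp g ≫ₗ a) ≫ₗ degen q f =
      degen q (pmap m f) ≫ₗ degen q (pwSplit y e) ≫ₗ ltp g' ≫ₗ b := by
  have h : ltp (fun _ : Fin m => degen q f) ≫ₗ degen q (pwSplit y e) =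
    degen q (pwSplit x e) ≫ₗ ltp fun i => ltp fun _ : Fin (k i) => degen q f :=
    split_natural _ e
  have h' : ltp g ≫ₗ ltp (fun _ : Fin n => degen q f) =
      (ltp fun i => ltp fun _ : Fin (k i) => degen q f) ≫ₗ ltp g' := by
    rw [← ltp_comp, ← ltp_comp]
    congr 1
    funext i
    rw [w' i, degen_pmap]
  rw [lcomp_assoc, lcomp_assoc, w, degen_pmap, degen_pmap, ← lcomp_assoc (ltp g), h',
    lcomp_assoc, ← lcomp_assoc, ← h, lcomp_assoc]

/-- The endomorphism operad of a morphism `f : x ⟶ y` in simplicial degree `q`: an operation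
consists of an operation of `x` and an operation of `y` that are compatible with `f`. -/
def endArrowAt (q : SimplexCategoryᵒᵖ) (f : x ⟶ y) : Operad.{v} where
  P n := { p : LHom q (pw n x) x × LHom q (pw n y) y //
    p.1 ≫ₗ degen q f = degen q (pmap n f) ≫ₗ p.2 }
  act σ p := ⟨((endAt q x).act σ p.1.1, (endAt q y).act σ p.1.2), compat_act f σ p.2⟩
  one := ⟨((endAt q x).one, (endAt q y).one), compat_one f⟩
  comp e p g := ⟨((endAt q x).comp e p.1.1 fun i => (g i).1.1,
      (endAt q y).comp e p.1.2 fun i => (g i).1.2), compat_comp f e p.2 fun i => (g i).2⟩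
  one_act p := Subtype.ext (Prod.ext ((endAt q x).one_act _) ((endAt q y).one_act _))
  mul_act σ τ p := Subtype.ext (Prod.ext ((endAt q x).mul_act _ _ _) ((endAt q y).mul_act _ _ _))
  act_comp σ e p g := Subtype.ext (Prod.ext ((endAt q x).act_comp σ e _ _)
    ((endAt q y).act_comp σ e _ _))
  comp_act e σ e' h p g := Subtype.ext (Prod.ext ((endAt q x).comp_act e σ e' h _ _)
    ((endAt q y).comp_act e σ e' h _ _))
  comp_act' e e' τ h p g := Subtype.ext (Prod.ext ((endAt q x).comp_act' e e' τ h _ _)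
    ((endAt q y).comp_act' e e' τ h _ _))
  one_comp e h g := Subtype.ext (Prod.ext ((endAt q x).one_comp e h _)
    ((endAt q y).one_comp e h _))
  comp_one e h p := Subtype.ext (Prod.ext ((endAt q x).comp_one e h _)
    ((endAt q y).comp_one e h _))
  assoc e e₂ e₃ e₁ h p g r := Subtype.ext (Prod.ext ((endAt q x).assoc e e₂ e₃ e₁ h _ _ _)
    ((endAt q y).assoc e e₂ e₃ e₁ h _ _ _))

/-- The endomorphism operad of a morphism `f : x ⟶ y`. Its simplicial set of operations with
`n` inputs is the pullback of the mapping spaces from `x ^ n` to `x` and from `y ^ n` to `y`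
over the mapping space from `x ^ n` to `y`. -/
def endArrow (f : x ⟶ y) : SimplicialOperad.{v} where
  obj q := endArrowAt q f
  map {q r} a :=
    { app := fun n p => ⟨(p.1.1.op a, p.1.2.op a), by
        rw [← op_degen a f, ← op_degen a (pmap n f), ← op_lcomp, ← op_lcomp, p.2]⟩
      act := fun σ p => Subtype.ext (Prod.ext (((endOperad x).map a).act σ p.1.1)
        (((endOperad y).map a).act σ p.1.2))
      one := Subtype.ext (Prod.ext ((endOperad x).map a).one ((endOperad y).map a).one)
      comp := fun e p g => Subtype.ext (Prod.ext (((endOperad x).map a).comp e p.1.1 _)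
        (((endOperad y).map a).comp e p.1.2 _)) }
  map_id q := by ext n p; exact Subtype.ext (Prod.ext (lop_id _) (lop_id _))
  map_comp a b := by ext n p; exact Subtype.ext (Prod.ext (lop_op a b _) (lop_op a b _))

/-- The projection from the endomorphism operad of `f : x ⟶ y` to that of `x`. -/
def endArrowToSource (f : x ⟶ y) : endArrow f ⟶ endOperad x where
  app q :=
    { app := fun _ p => p.1.1
      act := fun _ _ => rfl
      one := rfl
      comp := fun _ _ _ => rfl }

end EndOperad

/-! Homotopy theory of simplicial sets and of simplicial operads -/

section Spaces

open SSet.modelCategoryQuillen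

/-- A map of simplicial sets is a weak equivalence if it induces bijections on
sets of homotopy classes of maps to every Kan complex. -/
def sWeq : MorphismProperty SSet.{v} := fun X Y f =>
  ∀ Z : SSet.{v}, SSet.KanComplex Z →
    Function.Bijective (SSet.mapπ₀ ((MonoidalClosed.pre f).app Z))

/-- The homotopy category of simplicial sets. -/
abbrev HoSSet := (sWeq.{v}).Localization

/-- A simplicial set is contractible if its map to the point is a weak equivalence. -/
def Contractible (X : SSet.{v}) : Prop := sWeq (Limits.terminal.from X)

/-- Evaluation of paths in `Y` at the two endpoints `i = 0, 1`. -/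
def pathEv (Y : SSet.{v}) (i : Fin 2) : (ihom (SSet.stdSimplex.obj (.mk 1))).obj Y ⟶ Y :=
  (λ_ _).inv ≫ SSet.const (SSet.stdSimplex.obj₀Equiv.symm i) ▷ _ ≫ (ihom.ev _).app Y

/-- The homotopy fiber of `p : X ⟶ Y` over a vertex `y` of `Y`: it consists of a point of `X`
together with a path in `Y` from its image to `y`. -/
def homotopyFiber {X Y : SSet.{v}} (p : X ⟶ Y) (y : 𝟙_ SSet.{v} ⟶ Y) : SSet.{v} :=
  Limits.pullback (Limits.pullback.snd p (pathEv Y 0) ≫ pathEv Y 1) y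

/-- Weak equivalences of simplicial operads are defined levelwise. -/
def operadWeq : MorphismProperty SimplicialOperad.{v} := fun _ _ f =>
  ∀ n, sWeq ((SimplicialOperad.level n).map f)

/-- Fibrations of simplicial operads are defined levelwise. -/
def operadFib : MorphismProperty SimplicialOperad.{v} := fun _ _ f =>
  ∀ n, Fibration ((SimplicialOperad.level n).map f)

/-- A simplicial operad is cofibrant if all maps out of it lift through acyclic fibrations. -/
def IsCofibrantOperad (O : SimplicialOperad.{v}) : Prop :=
  ∀ ⦃P Q : SimplicialOperad.{v}⦄ (p : P ⟶ Q), operadFib p → operadWeq p →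
    ∀ g : O ⟶ Q, ∃ h : O ⟶ P, h ≫ p = g

/-- The mapping spaces of simplicial operads: a `q`-simplex of `operadMap O P` is a
morphism from `O` to the cotensor of `P` with the `q`-simplex. -/
abbrev operadMap (O P : SimplicialOperad.{v}) : SSet.{v} := sHom O P

/-- The map on mapping spaces induced by `f : P ⟶ Q`. -/
abbrev operadMapPost (O : SimplicialOperad.{v}) {P Q : SimplicialOperad.{v}} (f : P ⟶ Q) :
    operadMap O P ⟶ operadMap O Q := eHomWhiskerLeft SSet.{v} O f

/-- The vertex of the mapping space given by a morphism of operads. -/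
abbrev operadMapVertex {O P : SimplicialOperad.{v}} (θ : O ⟶ P) : 𝟙_ SSet.{v} ⟶ operadMap O P :=
  eHomEquiv SSet.{v} θ

end Spaces

/-! Operadic model categories -/

section Tensors

variable {D : Type u} [Category.{v} D] [SimplicialCategory D]

/-- The object `T` with `η : K ⟶ Map(x, T)` is the tensor of `x` with the simplicial
set `K`: the induced maps `Map(T, y) ⟶ Map(K, Map(x, y))` are isomorphisms. -/
def IsTensor (K : SSet.{v}) (x T : D) (η : K ⟶ sHom x T) : Prop :=
  ∀ y : D, IsIso (MonoidalClosed.curry (η ▷ sHom T y ≫ sHomComp x T y))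

/-- The object `C` with `ε : K ⟶ Map(C, y)` is the cotensor of `y` with the simplicial
set `K`: the induced maps `Map(x, C) ⟶ Map(K, Map(x, y))` are isomorphisms. -/
def IsCotensor (K : SSet.{v}) (y C : D) (ε : K ⟶ sHom C y) : Prop :=
  ∀ x : D, IsIso (MonoidalClosed.curry ((β_ K (sHom x C)).hom ≫ sHom x C ◁ ε ≫ sHomComp x C y))

end Tensors

section

open SSet.modelCategoryQuillen

/-- Operadic model categories, i.e. simplicial symmetric tensor model categories. The fields say:
finite simplicial tensors and cotensors exist, and the pullback-power of a cofibration and a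
fibration is a fibration of simplicial sets, acyclic if one of the two maps is (so that
`D` is a simplicial model category); the tensor product satisfies the pushout product
axiom, preserves initial objects in either variable, and preserves weak equivalences when the
other input is cofibrant; for finite `K`, the canonical comparison maps between the tensor of
`x` with `K` and the products of `x` with the tensor of the unit with `K` are
isomorphisms; the mapping spaces out of the unit object form a right Quillen functor. -/
class OperadicModelCategory (D : Type u) [Category.{v} D] [ModelCategory D]
    [SimplicialCategory D] [MonoidalCategory D] [SymmetricCategory D]
    [SymmetricMonoidalEnrichment D] : Prop where
  exists_tensor (K : SSet.{v}) [K.Finite] (x : D) : ∃ T η, IsTensor K x T η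
  exists_cotensor (K : SSet.{v}) [K.Finite] (y : D) : ∃ C ε, IsCotensor K y C ε
  sm7 {a b x y : D} (i : a ⟶ b) (p : x ⟶ y) [Cofibration i] [Fibration p]
    (sq : (sHomFunctor D).PullbackObjObj i p) :
    Fibration sq.π ∧ (WeakEquivalence i ∨ WeakEquivalence p → sWeq sq.π)
  pushoutProduct {a b x y : D} (i : a ⟶ b) (j : x ⟶ y) [Cofibration i] [Cofibration j]
    (sq : (curriedTensor D).PushoutObjObj i j) :
    Cofibration sq.ι ∧ (WeakEquivalence i ∨ WeakEquivalence j → WeakEquivalence sq.ι)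
  initial_tensor (a x : D) (h : Nonempty (Limits.IsInitial a)) :
    Nonempty (Limits.IsInitial (a ⊗ x))
  tensor_initial (x a : D) (h : Nonempty (Limits.IsInitial a)) :
    Nonempty (Limits.IsInitial (x ⊗ a))
  weq_whiskerRight {a b : D} (f : a ⟶ b) (x : D) [WeakEquivalence f] [IsCofibrant x] :
    WeakEquivalence (f ▷ x)
  weq_whiskerLeft (x : D) {a b : D} (f : a ⟶ b) [WeakEquivalence f] [IsCofibrant x] :
    WeakEquivalence (x ◁ f)
  tensor_unit_right (K : SSet.{v}) [K.Finite] (T : D) (η : K ⟶ sHom (𝟙_ D) T)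
    (h : IsTensor K (𝟙_ D) T η) (x : D) :
    IsTensor K (x ⊗ 𝟙_ D) (x ⊗ T) ((λ_ K).inv ≫ (eHomEquiv SSet (𝟙 x) ⊗ₘ η) ≫
      SymmetricMonoidalEnrichment.tensorMap x (𝟙_ D) x T)
  tensor_unit_left (K : SSet.{v}) [K.Finite] (T : D) (η : K ⟶ sHom (𝟙_ D) T)
    (h : IsTensor K (𝟙_ D) T η) (x : D) :
    IsTensor K (𝟙_ D ⊗ x) (T ⊗ x) ((ρ_ K).inv ≫ (η ⊗ₘ eHomEquiv SSet (𝟙 x)) ≫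
      SymmetricMonoidalEnrichment.tensorMap (𝟙_ D) x T x)
  unit_fibration {x y : D} (p : x ⟶ y) [Fibration p] :
    Fibration (eHomWhiskerLeft SSet (𝟙_ D) p) ∧
      (WeakEquivalence p → sWeq (eHomWhiskerLeft SSet (𝟙_ D) p))

end

section

variable {D : Type u} [Category.{v} D] [SimplicialCategory D]

/-- The empty simplicial set. -/
def sEmpty : SSet.{v} := (Functor.const _).obj PEmpty

lemma sEmpty_finite : sEmpty.{v}.Finite where
  finite := by
    have : IsEmpty sEmpty.{v}.N := ⟨fun x => (x.simplex : PEmpty).elim⟩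
    infer_instance

lemma sEmpty_hom_ext {W Z : SSet.{v}} (f g : W ⟶ (ihom sEmpty.{v}).obj Z) : f = g := by
  apply MonoidalClosed.uncurry_injective
  ext q x
  exact (x.1 : PEmpty).elim

/-- The simplicial set of maps from the empty simplicial set is a point. -/
def sEmptyTerminal (Z : SSet.{v}) : Limits.IsTerminal ((ihom sEmpty.{v}).obj Z) :=
  Limits.IsTerminal.ofUniqueHom
    (fun W => MonoidalClosed.curry
      { app := fun q => ↾fun x => (x.1 : PEmpty).elim
        naturality := fun q r a => by ext x; exact (x.1 : PEmpty).elim })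
    fun _ _ => sEmpty_hom_ext _ _

end

section Derived

variable (D : Type u) [Category.{v} D] [ModelCategory D]

/-- The homotopy category. -/
abbrev Ho := (weakEquivalences D).Localization

/-- The localization functor to the homotopy category. -/
abbrev toHo : D ⥤ Ho D := (weakEquivalences D).Q

variable [SimplicialCategory D] [MonoidalCategory D]
  [SymmetricCategory D] [SymmetricMonoidalEnrichment D] [OperadicModelCategory D]

/-- The tensor product of cofibrant objects, with values in the homotopy category. -/
def cofTensor : CofibrantObject D ⥤ CofibrantObject D ⥤ Ho D :=
  ((Functor.whiskeringLeft₂ (Ho D)).obj CofibrantObject.ι).obj CofibrantObject.ι |>.obj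
    ((Functor.postcompose₂.obj (toHo D)).obj (curriedTensor D))

/-- Mapping spaces from cofibrant to fibrant objects, with values in the homotopy category of
spaces. -/
def cofFibMap : (CofibrantObject D)ᵒᵖ ⥤ FibrantObject D ⥤ HoSSet.{v} :=
  ((Functor.whiskeringLeft₂ HoSSet.{v}).obj CofibrantObject.ι.op).obj FibrantObject.ι |>.obj
    ((Functor.postcompose₂.obj sWeq.{v}.Q).obj (sHomFunctor D))


variable {D}

lemma exists_terminal : ∃ C : D, Nonempty (Limits.IsTerminal C) ∧
    ∀ x : D, Nonempty (Limits.IsTerminal (sHom x C)) := by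
  have := sEmpty_finite.{v}
  obtain ⟨C, ε, h⟩ := OperadicModelCategory.exists_cotensor sEmpty.{v} (⊤_ D)
  have hC (x : D) : Nonempty (Limits.IsTerminal (sHom x C)) := by
    have := h x
    exact ⟨(sEmptyTerminal _).ofIso (asIso (MonoidalClosed.curry ((β_ sEmpty.{v} (sHom x C)).hom ≫
      sHom x C ◁ ε ≫ sHomComp x C (⊤_ D)))).symm⟩
  refine ⟨C, ⟨Limits.IsTerminal.ofUniqueHom
    (fun x => (eHomEquiv SSet.{v}).symm ((hC x).some.from _)) fun x f => ?_⟩, hC⟩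
  rw [Equiv.eq_symm_apply]
  exact (hC x).some.hom_ext _ _

lemma exists_initial : ∃ T : D, Nonempty (Limits.IsInitial T) ∧
    ∀ y : D, Nonempty (Limits.IsTerminal (sHom T y)) := by
  have := sEmpty_finite.{v}
  obtain ⟨T, η, h⟩ := OperadicModelCategory.exists_tensor sEmpty.{v} (⊤_ D)
  have hT (y : D) : Nonempty (Limits.IsTerminal (sHom T y)) := by
    have := h y
    exact ⟨(sEmptyTerminal _).ofIso (asIso (MonoidalClosed.curry
      (η ▷ sHom T y ≫ sHomComp (⊤_ D) T y))).symm⟩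
  refine ⟨T, ⟨Limits.IsInitial.ofUniqueHom
    (fun y => (eHomEquiv SSet.{v}).symm ((hT y).some.from _)) fun y f => ?_⟩, hT⟩
  rw [Equiv.eq_symm_apply]
  exact (hT y).some.hom_ext _ _

lemma map_trivialCofibration {a b : D} (i : a ⟶ b) (y : D) [Cofibration i] [WeakEquivalence i]
    [IsFibrant y] : sWeq (eHomWhiskerRight SSet.{v} i y) := by
  obtain ⟨C, ⟨hC⟩, hC'⟩ := exists_terminal (D := D)
  have : Fibration (hC.from y) := (isFibrant_iff_of_isTerminal _ hC).1 inferInstance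
  let sq : (sHomFunctor D).PullbackObjObj i (hC.from y) :=
    { pt := sHom a y
      fst := 𝟙 _
      snd := (hC' b).some.from _
      isPullback := by
        have h1 : IsIso (((sHomFunctor D).map i.op).app C) :=
          Limits.isIso_of_isTerminal (hC' b).some (hC' a).some _
        apply +allowSynthFailures IsPullback.of_horiz_isIso
        · exact IsIso.id (sHom a y)
        · exact ⟨(hC' a).some.hom_ext _ _⟩
      π := eHomWhiskerRight SSet.{v} i y
      π_fst := Category.comp_id _
      π_snd := (hC' b).some.hom_ext _ _ }
  exact (OperadicModelCategory.sm7 i (hC.from y) sq).2 (.inl inferInstance)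

lemma map_trivialFibration (x : D) {y z : D} (p : y ⟶ z) [Fibration p] [WeakEquivalence p]
    [IsCofibrant x] : sWeq (eHomWhiskerLeft SSet.{v} x p) := by
  obtain ⟨T, ⟨hT⟩, hT'⟩ := exists_initial (D := D)
  have : Cofibration (hT.to x) := (isCofibrant_iff_of_isInitial _ hT).1 inferInstance
  let sq : (sHomFunctor D).PullbackObjObj (hT.to x) p :=
    { pt := sHom x z
      fst := (hT' y).some.from _
      snd := 𝟙 _
      isPullback := by
        have h1 : IsIso (((sHomFunctor D).obj (op T)).map p) :=
          Limits.isIso_of_isTerminal (hT' y).some (hT' z).some _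
        apply +allowSynthFailures IsPullback.of_vert_isIso
        · exact IsIso.id (sHom x z)
        · exact ⟨(hT' z).some.hom_ext _ _⟩
      π := eHomWhiskerLeft SSet.{v} x p
      π_fst := (hT' y).some.hom_ext _ _
      π_snd := Category.comp_id _ }
  exact (OperadicModelCategory.sm7 (hT.to x) p sq).2 (.inr inferInstance)

lemma isIso_map_weq_left {a b : D} (f : a ⟶ b) (y : D) [IsCofibrant a] [IsCofibrant b]
    [WeakEquivalence f] [IsFibrant y] : IsIso (sWeq.{v}.Q.map (eHomWhiskerRight SSet.{v} f y)) := by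
  let G : Dᵒᵖ ⥤ HoSSet.{v} := (sHomFunctor D).flip.obj y ⋙ sWeq.{v}.Q
  have hG {c d : D} (i : c ⟶ d) [Cofibration i] [WeakEquivalence i] : IsIso (G.map i.op) :=
    Localization.inverts sWeq.Q sWeq _ (map_trivialCofibration i y)
  let h : CofibrantBrownFactorization f := Classical.arbitrary _
  have h1 := hG h.i
  have h2 := hG h.s
  have h3 : G.map h.p.op ≫ G.map h.s.op = 𝟙 _ := by
    rw [← G.map_comp, ← op_comp, h.s_p, op_id, G.map_id]
  have h4 : IsIso (G.map h.p.op) := by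
    rw [show G.map h.p.op = inv (G.map h.s.op) by rw [← cancel_mono (G.map h.s.op), h3]; simp]
    infer_instance
  have h5 : G.map f.op = G.map h.p.op ≫ G.map h.i.op := by
    rw [← G.map_comp, ← op_comp, h.fac]
  change IsIso (G.map f.op)
  rw [h5]
  infer_instance

lemma isIso_map_weq_right (x : D) {y z : D} (f : y ⟶ z) [IsFibrant y] [IsFibrant z]
    [WeakEquivalence f] [IsCofibrant x] :
    IsIso (sWeq.{v}.Q.map (eHomWhiskerLeft SSet.{v} x f)) := by
  let G : D ⥤ HoSSet.{v} := (sHomFunctor D).obj (op x) ⋙ sWeq.{v}.Q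
  have hG {c d : D} (i : c ⟶ d) [Fibration i] [WeakEquivalence i] : IsIso (G.map i) :=
    Localization.inverts sWeq.Q sWeq _ (map_trivialFibration x i)
  let h : FibrantBrownFactorization f := Classical.arbitrary _
  have h1 := hG h.p
  have h2 := hG h.r
  have h3 : G.map h.i ≫ G.map h.r = 𝟙 _ := by
    rw [← G.map_comp, h.i_r, G.map_id]
  have h4 : IsIso (G.map h.i) := by
    rw [show G.map h.i = inv (G.map h.r) by rw [← cancel_mono (G.map h.r), h3]; simp]
    infer_instance
  have h5 : G.map f = G.map h.i ≫ G.map h.p := by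
    rw [← G.map_comp, h.fac]
  change IsIso (G.map f)
  rw [h5]
  infer_instance

variable (D)

lemma cofTensor_inverts : MorphismProperty.IsInvertedBy₂ (weakEquivalences (CofibrantObject D))
    (weakEquivalences (CofibrantObject D)) (cofTensor D) := by
  rintro ⟨a, x⟩ ⟨b, y⟩ ⟨f, g⟩ ⟨hf, hg⟩
  have : WeakEquivalence f.hom := ⟨hf⟩
  have : WeakEquivalence g.hom := ⟨hg⟩
  have h1 : IsIso ((toHo D).map (f.hom ▷ x.obj)) :=
    Localization.inverts _ (weakEquivalences D) _
      (OperadicModelCategory.weq_whiskerRight f.hom x.obj).mem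
  have h2 : IsIso ((toHo D).map (b.obj ◁ g.hom)) :=
    Localization.inverts _ (weakEquivalences D) _
      (OperadicModelCategory.weq_whiskerLeft b.obj g.hom).mem
  exact IsIso.comp_isIso' h1 h2

lemma cofFibMap_inverts : MorphismProperty.IsInvertedBy₂ (weakEquivalences (CofibrantObject D)).op
    (weakEquivalences (FibrantObject D)) (cofFibMap D) := by
  rintro ⟨a, x⟩ ⟨b, y⟩ ⟨f, g⟩ ⟨hf, hg⟩
  have : WeakEquivalence f.unop.hom := ⟨hf⟩
  have : WeakEquivalence g.hom := ⟨hg⟩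
  exact IsIso.comp_isIso' (isIso_map_weq_left f.unop.hom x.obj)
    (isIso_map_weq_right b.unop.obj g.hom)

/-- The derived tensor product. -/
def derivedTensor : Ho D ⥤ Ho D ⥤ Ho D :=
  Localization.lift₂ (cofTensor D) (cofTensor_inverts D) (CofibrantObject.ι ⋙ toHo D)
    (CofibrantObject.ι ⋙ toHo D)

/-- The derived mapping spaces. -/
def derivedMap : (Ho D)ᵒᵖ ⥤ Ho D ⥤ HoSSet.{v} :=
  Localization.lift₂ (cofFibMap D) (cofFibMap_inverts D) (CofibrantObject.ι ⋙ toHo D).op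
    (FibrantObject.ι ⋙ toHo D)

variable {D}

/-- The derived tensor product of two objects. -/
abbrev dtens (x y : Ho D) : Ho D := ((derivedTensor D).obj x).obj y

/-- The derived tensor powers. -/
def dpow (x : Ho D) : ℕ → Ho D
  | 0 => (toHo D).obj (𝟙_ D)
  | n + 1 => dtens (dpow x n) x

/-- The derived mapping space of two objects. -/
abbrev dmap (x y : Ho D) : HoSSet.{v} := ((derivedMap D).obj (op x)).obj y

variable (D)

/-- A weak function object: a functor `F` together with a natural transformation `adj` from the
derived mapping space of `x ⊗ y` and `z` to that of `x` and `F (y, z)`, in the homotopy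
category of spaces. -/
structure WeakFunctionObject where
  F : (Ho D)ᵒᵖ ⥤ Ho D ⥤ Ho D
  adj (x y z : Ho D) : dmap (dtens x y) z ⟶ dmap x ((F.obj (op y)).obj z)
  adj_natural_left {x x' : Ho D} (f : x ⟶ x') (y z : Ho D) :
    ((derivedMap D).map (((derivedTensor D).map f).app y).op).app z ≫ adj x y z =
      adj x' y z ≫ ((derivedMap D).map f.op).app _
  adj_natural_middle (x : Ho D) {y y' : Ho D} (f : y ⟶ y') (z : Ho D) :
    ((derivedMap D).map (((derivedTensor D).obj x).map f).op).app z ≫ adj x y z =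
      adj x y' z ≫ ((derivedMap D).obj (op x)).map ((F.map f.op).app z)
  adj_natural_right (x y : Ho D) {z z' : Ho D} (f : z ⟶ z') :
    ((derivedMap D).obj (op (dtens x y))).map f ≫ adj x y z' =
      adj x y z ≫ ((derivedMap D).obj (op x)).map ((F.obj (op y)).map f)

variable {D}

/-- The weak function object provides an adjoint for maps from the derived tensor product of
`x` and `y` to `z`. -/
def WeakFunctionObject.ProvidesAdjoint (W : WeakFunctionObject D) (x y z : Ho D) : Prop :=
  IsIso (W.adj x y z)

/-- A morphism `η : x ⟶ y` is rigid if `F (y, y) ⟶ F (x, y)` is an isomorphism. -/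
def WeakFunctionObject.IsRigid (W : WeakFunctionObject D) {x y : Ho D} (η : x ⟶ y) : Prop :=
  IsIso ((W.F.map η.op).app y)

/-- The morphism `f` of `D` is a fibration between cofibrant-fibrant objects which represents
the morphism `η` of the homotopy category. -/
structure Represents {X Y : D} (f : X ⟶ Y) {x y : Ho D} (η : x ⟶ y) : Prop where
  fibration : Fibration f
  cofibrant_source : IsCofibrant X
  fibrant_source : IsFibrant X
  cofibrant_target : IsCofibrant Y
  fibrant_target : IsFibrant Y
  iso : Nonempty (Arrow.mk ((toHo D).map f) ≅ Arrow.mk η)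

end Derived

end OperadicRigidity

end

open OperadicRigidity

noncomputable section

/-! Homotopies in simplicial sets -/

namespace OperadicRigidity

section SimplicialSets

open SSet SSet.modelCategoryQuillen Simplicial CartesianMonoidalCategory

/-! In arity n, the map End(f) → End(X) is the base change of f^* : Map(Y^n, Y) → Map(X^n, Y) along
f_* : Map(X^n, X) → Map(X^n, Y) (`level_endArrow_isPullback`). The map f_* is a fibration, because
X^n is cofibrant for n > 0 and because Map(𝕀, -) preserves fibrations for n = 0. Hence it suffices
that f^* is a weak equivalence, in a form that passes to pullbacks along fibrations and to operadic
mapping spaces.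

Rigidity enters in `WeakFunctionObject.derivedLocalMaps_tensor`: for a = x^n ⊗ y^m the adjunction
maps identify the effect of a ⊗ η on derived maps to y with the effect of F(y, y) → F(x, y) on
derived maps out of a, which is invertible. The tensor power of f is obtained by replacing the
factors X by Y one at a time, and up to symmetry each replacement is of this kind
(`localMaps_cofPowMap_whiskerRight`). Since the unit need not be cofibrant, this runs on powers
`cofPow` that start from a cofibrant replacement of the unit; they are compared with the actual
powers afterwards (`sWeq_map_pmap`).

The robust form of "w is a weak equivalence" is that the end point map `cocylEnd w` of its mapping
path space is a trivial fibration; between Kan complexes the two are equivalent. Being a lifting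
property, this is stable under pullback along a fibration without further Kan hypotheses
(`trivFib_cocylEnd_of_isPullback`). It is also preserved by Map(O, -) for cofibrant O, which is
compatible with pullbacks and path objects and turns levelwise trivial fibrations into trivial
fibrations (`trivFib_operadMapPost`, `trivFib_cocylEnd_operadMapPost`). The homotopy fiber over θ is
the strict fiber of such an end point map, so it is contractible. -/

/-- Trivial fibrations of simplicial sets: maps with the right lifting property with respect to
all monomorphisms. -/
abbrev trivFib : MorphismProperty SSet.{v} := (MorphismProperty.monomorphisms SSet.{v}).rlp

/-- The vertex `i` of the interval. -/
abbrev vtx (i : Fin 2) : 𝟙_ SSet.{v} ⟶ Δ[1] := SSet.const (stdSimplex.obj₀Equiv.symm i)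

/-- A horn in the interval is a single vertex: the only face other than the i-th one is the vertex i
itself. Lifting is therefore horn filling with one prescribed face, for which compatibility is an
empty condition. -/
lemma anodyne_vtx (i : Fin 2) : anodyneExtensions (vtx.{v} i) := by
  intro E B p hp
  have : Fibration p := ⟨hp⟩
  refine ⟨fun {e b} sq => ?_⟩
  let T : 𝟙_ SSet.{v} ⟶ Δ[0] := stdSimplex.isTerminalObj₀.from _
  let T' : (Δ[0] : SSet.{v}) ⟶ 𝟙_ SSet.{v} := toUnit _
  have key (i k : Fin 2) (hk : stdSimplex.δ.{v} k = SSet.const (stdSimplex.obj₀Equiv.symm i))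
      (hi : k ≠ i) (hj : ∀ j, j ≠ i → j = k) (sq : CommSq e (vtx i) p b) : sq.HasLift := by
    have hc : horn.IsCompatible (n := 0) (i := i) fun _ _ => T' ≫ e := by
      rw [horn.IsCompatible]; trivial
    obtain ⟨φ, h₁, h₂⟩ := hc.exists_lift p b fun j hj' => by
      obtain rfl := hj j hj'
      rw [hk, Category.assoc, sq.w]; rfl
    have hv : vtx.{v} i = T ≫ stdSimplex.δ k := by rw [hk]; rfl
    exact ⟨⟨{ l := φ, fac_left := by rw [hv, Category.assoc, h₁ k hi]; rfl, fac_right := h₂ }⟩⟩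
  fin_cases i
  · exact key 0 1 stdSimplex.δ_one_eq_const (by decide) (by decide) sq
  · exact key 1 0 stdSimplex.δ_zero_eq_const (by decide) (by decide) sq

/-- The lifting property of a fibration with respect to pushout products. -/
lemma exists_lift_pushoutProduct {C D K L E B : SSet.{v}} {i : C ⟶ D} {j : K ⟶ L} {p : E ⟶ B}
    [Fibration p] (h : (Mono i ∧ anodyneExtensions j) ∨ (anodyneExtensions i ∧ Mono j))
    {f : C ⊗ L ⟶ E} {g : D ⊗ K ⟶ E} {b : D ⊗ L ⟶ B} (h₁ : C ◁ j ≫ f = i ▷ K ≫ g)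
    (h₂ : i ▷ L ≫ b = f ≫ p) (h₃ : D ◁ j ≫ b = g ≫ p) :
    ∃ l : D ⊗ L ⟶ E, i ▷ L ≫ l = f ∧ D ◁ j ≫ l = g ∧ l ≫ p = b := by
  let sq := Functor.PushoutObjObj.ofHasPushout (curriedTensor SSet.{v}) i j
  have hl : HasLiftingProperty sq.ι p := by
    have : anodyneExtensions sq.ι := by
      rcases h with ⟨_, h⟩ | ⟨h, _⟩
      · exact anodyneExtensions_pushoutObjObjι sq h
      · exact anodyneExtensions_pushoutObjObjι' sq h
    exact this p (by rwa [← HomotopicalAlgebra.fibration_iff])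
  have sq' : CommSq (sq.isPushout.desc g f h₁.symm) sq.ι p b := ⟨by
    apply sq.isPushout.hom_ext
    · simp [h₃]
    · simp [h₂]⟩
  refine ⟨sq'.lift, ?_, ?_, sq'.fac_right⟩
  · have h : i ▷ L = sq.inr ≫ sq.ι := sq.inr_ι.symm
    rw [h, Category.assoc, sq'.fac_left]
    exact sq.isPushout.inr_desc _ _ _
  · have h : D ◁ j = sq.inl ≫ sq.ι := sq.inl_ι.symm
    rw [h, Category.assoc, sq'.fac_left]
    exact sq.isPushout.inl_desc _ _ _

/-- The inclusion of `X` into the cylinder on `X` as one of the two ends. -/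
def endpt (i : Fin 2) (X : SSet.{v}) : X ⟶ Δ[1] ⊗ X := (λ_ X).inv ≫ vtx i ▷ X

lemma anodyne_endpt (i : Fin 2) (X : SSet.{v}) : anodyneExtensions (endpt i X) :=
  anodyneExtensions.comp_mem _ _ (anodyneExtensions.of_isIso _) ((anodyne_vtx i).whiskerRight X)

lemma endpt_natural (i : Fin 2) {X Y : SSet.{v}} (f : X ⟶ Y) :
    endpt i X ≫ Δ[1] ◁ f = f ≫ endpt i Y := rfl

lemma endpt_snd (i : Fin 2) (X : SSet.{v}) : endpt i X ≫ snd _ _ = 𝟙 X := rfl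

lemma pathEv_eq (Y : SSet.{v}) (i : Fin 2) :
    pathEv Y i = endpt i _ ≫ (ihom.ev _).app Y := (Category.assoc _ _ _).symm

lemma comp_pathEv {X Y : SSet.{v}} (i : Fin 2) (h : X ⟶ (ihom Δ[1]).obj Y) :
    h ≫ pathEv Y i = endpt i X ≫ MonoidalClosed.uncurry h := by
  rw [MonoidalClosed.uncurry_eq, ← Category.assoc, endpt_natural, pathEv_eq, Category.assoc]

lemma curry_pathEv {X Y : SSet.{v}} (i : Fin 2) (h : Δ[1] ⊗ X ⟶ Y) :
    MonoidalClosed.curry h ≫ pathEv Y i = endpt i X ≫ h := by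
  rw [comp_pathEv, MonoidalClosed.uncurry_curry]

lemma map_pathEv {X Y : SSet.{v}} (i : Fin 2) (f : X ⟶ Y) :
    (ihom Δ[1]).map f ≫ pathEv Y i = pathEv X i ≫ f := by
  rw [pathEv_eq, pathEv_eq, ← reassoc_of% (endpt_natural i), ihom.ev_naturality, Category.assoc]

/-- Constant paths. -/
def constPath (Y : SSet.{v}) : Y ⟶ (ihom Δ[1]).obj Y := MonoidalClosed.curry (snd _ _)

@[simp]
lemma constPath_pathEv (Y : SSet.{v}) (i : Fin 2) : constPath Y ≫ pathEv Y i = 𝟙 Y := by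
  rw [constPath, curry_pathEv, endpt_snd]

lemma curry_snd {X Y : SSet.{v}} (f : X ⟶ Y) :
    MonoidalClosed.curry (snd Δ[1] X ≫ f) = f ≫ constPath Y := by
  rw [constPath, ← MonoidalClosed.curry_natural_left]; rfl

/-- Relative homotopy lifting for a fibration. -/
lemma exists_path_lift (i : Fin 2) {K L E B : SSet.{v}} (k : K ⟶ L) [Mono k] (p : E ⟶ B)
    [Fibration p] (h : K ⟶ (ihom Δ[1]).obj E) (b : L ⟶ (ihom Δ[1]).obj B) (e : L ⟶ E)
    (h₁ : h ≫ pathEv E i = k ≫ e) (h₂ : h ≫ (ihom Δ[1]).map p = k ≫ b)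
    (h₃ : b ≫ pathEv B i = e ≫ p) :
    ∃ H : L ⟶ (ihom Δ[1]).obj E, k ≫ H = h ∧ H ≫ pathEv E i = e ∧ H ≫ (ihom Δ[1]).map p = b := by
  -- After uncurrying, this is lifting against the pushout product of the vertex `i` with `k`, which
  -- is anodyne because the vertex is.
  obtain ⟨l, hl₁, hl₂, hl₃⟩ := exists_lift_pushoutProduct (i := vtx i) (j := k) (p := p)
    (.inr ⟨anodyne_vtx i, inferInstance⟩) (f := (λ_ L).hom ≫ e) (g := MonoidalClosed.uncurry h)
    (b := MonoidalClosed.uncurry b) (by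
      rw [comp_pathEv, endpt] at h₁
      rw [leftUnitor_naturality_assoc, ← h₁]; simp) (by
      rw [comp_pathEv, endpt] at h₃
      rw [Category.assoc, ← h₃]; simp) (by
      rw [← MonoidalClosed.uncurry_natural_left, ← h₂, MonoidalClosed.uncurry_natural_right])
  refine ⟨MonoidalClosed.curry l, ?_, ?_, ?_⟩
  · rw [← MonoidalClosed.curry_natural_left, hl₂, MonoidalClosed.curry_uncurry]
  · rw [curry_pathEv, endpt, Category.assoc, hl₁, Iso.inv_hom_id_assoc]
  · rw [← MonoidalClosed.curry_natural_right, hl₃, MonoidalClosed.curry_uncurry]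

/-- Two points. -/
abbrev twoPts : SSet.{v} := FunctorToTypes.coprod (𝟙_ SSet.{v}) (𝟙_ SSet.{v})

/-- The inclusion of the two ends of the interval. -/
def twoVtx : twoPts.{v} ⟶ Δ[1] := FunctorToTypes.coprod.desc (vtx 0) (vtx 1)

instance : Mono twoVtx.{v} := by
  apply +allowSynthFailures NatTrans.mono_of_mono_app
  intro n
  rw [mono_iff_injective]
  -- The images of the two points can only collide if both vertices have the same degeneracy in
  -- degree `n`; restricting that to degree 0 gives 0 = 1.
  have key (h : (vtx.{v} 0).app n PUnit.unit = (vtx 1).app n PUnit.unit) : False := by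
    have h := congrArg (Δ[1].map (SimplexCategory.const ⦋0⦌ n.unop 0).op) h
    rw [← app_map, ← app_map] at h
    have : (0 : Fin 2) = 1 := congrArg stdSimplex.obj₀Equiv h
    simp at this
  rintro (⟨⟩ | ⟨⟩) (⟨⟩ | ⟨⟩) h
  · rfl
  · exact (key h).elim
  · exact (key h.symm).elim
  · rfl

/-- Maps from two copies of an object. -/
def twoDesc {L E : SSet.{v}} (f g : L ⟶ E) : twoPts.{v} ⊗ L ⟶ E where
  app n := ↾fun x => Sum.elim (fun _ => f.app n x.2) (fun _ => g.app n x.2) x.1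
  naturality n m a := by
    ext ⟨x | x, y⟩
    · exact app_map f a y
    · exact app_map g a y

lemma twoDesc_hom_ext {L E : SSet.{v}} {f g : twoPts.{v} ⊗ L ⟶ E}
    (h₀ : (λ_ L).inv ≫ FunctorToTypes.coprod.inl ▷ L ≫ f =
      (λ_ L).inv ≫ FunctorToTypes.coprod.inl ▷ L ≫ g)
    (h₁ : (λ_ L).inv ≫ FunctorToTypes.coprod.inr ▷ L ≫ f =
      (λ_ L).inv ≫ FunctorToTypes.coprod.inr ▷ L ≫ g) :
    f = g := by
  ext n ⟨x, y⟩
  rcases x with x | x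
  · exact app_congr h₀ n y
  · exact app_congr h₁ n y

/-- Two paths with the same start, and the same image in the base of a fibration, have ends
which are connected by a path over a constant path. -/
lemma exists_box {X E B : SSet.{v}} (p : E ⟶ B) [Fibration p] (H H' : X ⟶ (ihom Δ[1]).obj E)
    (h₀ : H ≫ pathEv E 0 = H' ≫ pathEv E 0)
    (hp : H ≫ (ihom Δ[1]).map p = H' ≫ (ihom Δ[1]).map p) :
    ∃ K : X ⟶ (ihom Δ[1]).obj E, K ≫ pathEv E 0 = H ≫ pathEv E 1 ∧
      K ≫ pathEv E 1 = H' ≫ pathEv E 1 ∧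
      K ≫ (ihom Δ[1]).map p = H ≫ pathEv E 1 ≫ p ≫ constPath B := by
  -- Fill a square whose two sides are `H` and `H'` and whose bottom is constant at their common
  -- start, over the common image path taken constant in the other direction. The top edge of the
  -- filler is the required path.
  obtain ⟨l, hl₁, hl₂, hl₃⟩ := exists_lift_pushoutProduct (i := twoVtx) (j := endpt 0 X) (p := p)
    (.inl ⟨inferInstance, anodyne_endpt 0 X⟩)
    (f := twoDesc (MonoidalClosed.uncurry H) (MonoidalClosed.uncurry H'))
    (g := snd _ _ ≫ H ≫ pathEv E 0) (b := snd _ _ ≫ MonoidalClosed.uncurry (H ≫ (ihom Δ[1]).map p))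
    (by
      apply twoDesc_hom_ext
      · change endpt 0 X ≫ MonoidalClosed.uncurry H = H ≫ pathEv E 0
        rw [comp_pathEv]
      · change endpt 0 X ≫ MonoidalClosed.uncurry H' = H ≫ pathEv E 0
        rw [h₀, comp_pathEv])
    (by
      apply twoDesc_hom_ext
      · change MonoidalClosed.uncurry (H ≫ (ihom Δ[1]).map p) = MonoidalClosed.uncurry H ≫ p
        rw [MonoidalClosed.uncurry_natural_right]
      · change MonoidalClosed.uncurry (H ≫ (ihom Δ[1]).map p) = MonoidalClosed.uncurry H' ≫ p
        rw [hp, MonoidalClosed.uncurry_natural_right])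
    (by
      change snd _ _ ≫ endpt 0 X ≫ MonoidalClosed.uncurry (H ≫ (ihom Δ[1]).map p) =
        snd _ _ ≫ (H ≫ pathEv E 0) ≫ p
      rw [← comp_pathEv, Category.assoc, map_pathEv, Category.assoc])
  refine ⟨MonoidalClosed.curry (Δ[1] ◁ endpt 1 X ≫ l), ?_, ?_, ?_⟩
  · rw [curry_pathEv, comp_pathEv]
    change endpt 1 X ≫ (λ_ _).inv ≫ FunctorToTypes.coprod.inl ▷ _ ≫ twoVtx ▷ _ ≫ l = _
    rw [hl₁]; rfl
  · rw [curry_pathEv, comp_pathEv]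
    change endpt 1 X ≫ (λ_ _).inv ≫ FunctorToTypes.coprod.inr ▷ _ ≫ twoVtx ▷ _ ≫ l = _
    rw [hl₁]; rfl
  · rw [← MonoidalClosed.curry_natural_right, Category.assoc, hl₃]
    have e : H ≫ pathEv E 1 ≫ p ≫ constPath B = (H ≫ pathEv E 1 ≫ p) ≫ constPath B := by
      simp only [Category.assoc]
    rw [e, ← curry_snd]
    congr 1

end SimplicialSets

end OperadicRigidity

/-! Weak equivalences of simplicial sets -/

namespace OperadicRigidity

section SimplicialSets

open SSet SSet.modelCategoryQuillen Simplicial CartesianMonoidalCategory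

/-- The homotopy relation on maps of simplicial sets. -/
def Htpy {X Y : SSet.{v}} (f g : X ⟶ Y) : Prop :=
  ∃ h : X ⟶ (ihom Δ[1]).obj Y, h ≫ pathEv Y 0 = f ∧ h ≫ pathEv Y 1 = g

namespace Htpy

variable {W X Y Z : SSet.{v}}

lemma refl (f : X ⟶ Y) : Htpy f f := ⟨f ≫ constPath Y, by simp, by simp⟩

lemma pre {f g : X ⟶ Y} (h : Htpy f g) (k : W ⟶ X) : Htpy (k ≫ f) (k ≫ g) := by
  obtain ⟨h, rfl, rfl⟩ := h
  exact ⟨k ≫ h, Category.assoc _ _ _, Category.assoc _ _ _⟩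

lemma post {f g : X ⟶ Y} (h : Htpy f g) (k : Y ⟶ Z) : Htpy (f ≫ k) (g ≫ k) := by
  obtain ⟨h, rfl, rfl⟩ := h
  exact ⟨h ≫ (ihom Δ[1]).map k, by simp [map_pathEv], by simp [map_pathEv]⟩

variable [KanComplex Y]

/-- This is `exists_box` over the point. Together with reflexivity it gives symmetry and
transitivity. -/
lemma euclidean {f g g' : X ⟶ Y} (h : Htpy f g) (h' : Htpy f g') : Htpy g g' := by
  obtain ⟨h, rfl, rfl⟩ := h
  obtain ⟨h', e, rfl⟩ := h'
  obtain ⟨K, hK, hK', -⟩ := exists_box (Limits.terminal.from Y) h h' e.symm (by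
    apply MonoidalClosed.uncurry_injective
    rw [MonoidalClosed.uncurry_natural_right]
    exact Limits.terminal.hom_ext _ _)
  exact ⟨K, hK, hK'⟩

lemma symm {f g : X ⟶ Y} (h : Htpy f g) : Htpy g f := h.euclidean (refl f)

lemma trans {f g k : X ⟶ Y} (h : Htpy f g) (h' : Htpy g k) : Htpy f k := h.symm.euclidean h'

end Htpy

/-! ### Components of internal homs as homotopy classes of maps -/

/-- The vertex of the internal hom given by a map. -/
def homVertex {X Y : SSet.{v}} (f : X ⟶ Y) : ((ihom X).obj Y) _⦋0⦌ :=
  unitHomEquiv _ (MonoidalClosed.curry ((ρ_ X).hom ≫ f))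

lemma homVertex_surjective {X Y : SSet.{v}} (x : ((ihom X).obj Y) _⦋0⦌) :
    ∃ f : X ⟶ Y, homVertex f = x :=
  ⟨(ρ_ X).inv ≫ MonoidalClosed.uncurry ((unitHomEquiv _).symm x), by simp [homVertex]⟩

lemma homVertex_symm {X Y : SSet.{v}} (f : X ⟶ Y) :
    SSet.const (homVertex f) = MonoidalClosed.curry ((ρ_ X).hom ≫ f) :=
  (unitHomEquiv _).symm_apply_apply _

lemma pre_homVertex {X Y Z : SSet.{v}} (f : X ⟶ Y) (g : Y ⟶ Z) :
    ((MonoidalClosed.pre f).app Z).app _ (homVertex g) = homVertex (f ≫ g) := by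
  have := MonoidalClosed.curry_pre_app f ((ρ_ Y).hom ≫ g)
  rw [rightUnitor_naturality_assoc] at this
  exact app_congr this _ PUnit.unit

lemma nonempty_edge_iff {K : SSet.{v}} (x y : K _⦋0⦌) : Nonempty (Edge x y) ↔
    ∃ s : Δ[1] ⟶ K, vtx 0 ≫ s = SSet.const x ∧ vtx 1 ≫ s = SSet.const y := by
  have hc {x y : K _⦋0⦌} : (SSet.const x : 𝟙_ SSet.{v} ⟶ K) = SSet.const y ↔ x = y :=
    (unitHomEquiv K).symm.injective.eq_iff
  -- Face and vertex indices are opposite: deleting vertex 1 leaves vertex 0, the source of the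
  -- edge.
  have h0 (s : Δ[1] ⟶ K) : K.δ 1 (yonedaEquiv s) = s.app _ (stdSimplex.obj₀Equiv.symm 0) :=
    (app_map s _ _).symm.trans (congrArg (s.app _) (stdSimplex.obj₀Equiv.injective rfl))
  have h1 (s : Δ[1] ⟶ K) : K.δ 0 (yonedaEquiv s) = s.app _ (stdSimplex.obj₀Equiv.symm 1) :=
    (app_map s _ _).symm.trans (congrArg (s.app _) (stdSimplex.obj₀Equiv.injective rfl))
  constructor
  · rintro ⟨e⟩
    refine ⟨yonedaEquiv.symm e.edge, ?_, ?_⟩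
    · rw [SSet.const_comp, hc, ← h0]; simp
    · rw [SSet.const_comp, hc, ← h1]; simp
  · rintro ⟨s, hs, hs'⟩
    rw [SSet.const_comp, hc] at hs hs'
    exact ⟨Edge.mk (yonedaEquiv s) (by rw [h0, hs]) (by rw [h1, hs'])⟩

/-- An edge of the internal hom and a homotopy are the same map on a product with the interval,
curried in different variables; the braiding exchanges the two factors. -/
lemma π₀Rel_homVertex {X Y : SSet.{v}} (f g : X ⟶ Y) :
    π₀Rel (homVertex f) (homVertex g) ↔ Htpy f g := by
  have key (i : Fin 2) (s : Δ[1] ⟶ (ihom X).obj Y) (f : X ⟶ Y) :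
      vtx i ≫ s = SSet.const (homVertex f) ↔
        endpt i X ≫ (β_ _ _).hom ≫ MonoidalClosed.uncurry s = f := by
    rw [homVertex_symm, ← MonoidalClosed.uncurry_injective.eq_iff, MonoidalClosed.uncurry_curry,
      MonoidalClosed.uncurry_natural_left, ← Iso.inv_comp_eq]
    rfl
  rw [π₀Rel, nonempty_edge_iff]
  constructor
  · rintro ⟨s, h0, h1⟩
    rw [key] at h0 h1
    exact ⟨MonoidalClosed.curry ((β_ _ _).hom ≫ MonoidalClosed.uncurry s), by rwa [curry_pathEv],
      by rwa [curry_pathEv]⟩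
  · rintro ⟨h, h0, h1⟩
    refine ⟨MonoidalClosed.curry ((β_ _ _).hom ≫ MonoidalClosed.uncurry h), ?_, ?_⟩
    · rw [key, MonoidalClosed.uncurry_curry, SymmetricCategory.symmetry_assoc, ← comp_pathEv, h0]
    · rw [key, MonoidalClosed.uncurry_curry, SymmetricCategory.symmetry_assoc, ← comp_pathEv, h1]

/-- Components are classes of the equivalence relation generated by edges. As Y is Kan, homotopy is
already an equivalence relation, so generating adds nothing; the intermediate vertices in a chain of
edges are again maps. -/
lemma π₀_mk_homVertex {X Y : SSet.{v}} [KanComplex Y] (f g : X ⟶ Y) :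
    π₀.mk (homVertex f) = π₀.mk (homVertex g) ↔ Htpy f g := by
  rw [π₀.mk_eq_mk_iff]
  constructor
  · have key : ∀ {x y : ((ihom X).obj Y) _⦋0⦌}, Relation.EqvGen π₀Rel x y →
        ∀ f g, homVertex f = x → homVertex g = y → Htpy f g := by
      intro x y h
      induction h with
      | rel x y h => rintro f g rfl rfl; exact (π₀Rel_homVertex f g).1 h
      | refl x =>
        rintro f g rfl h
        exact (π₀Rel_homVertex f g).1 ⟨h ▸ Edge.id _⟩
      | symm x y h ih => intro f g hf hg; exact (ih g f hg hf).symm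
      | trans x y z h h' ih ih' =>
        intro f g hf hg
        obtain ⟨k, hk⟩ := homVertex_surjective y
        exact (ih f k hf hk).trans (ih' k g hk hg)
    exact fun h => key h f g rfl rfl
  · exact fun h => .rel _ _ ((π₀Rel_homVertex f g).2 h)

lemma sWeq_iff {X Y : SSet.{v}} (f : X ⟶ Y) : sWeq f ↔ ∀ (Z : SSet.{v}) [KanComplex Z],
    (∀ g h : Y ⟶ Z, Htpy (f ≫ g) (f ≫ h) → Htpy g h) ∧
      ∀ g : X ⟶ Z, ∃ h : Y ⟶ Z, Htpy (f ≫ h) g := by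
  refine forall_congr' fun Z => forall_congr' fun hZ => and_congr ⟨fun H g h hgh => ?_, fun H => ?_⟩
    ⟨fun H g => ?_, fun H => ?_⟩
  · rw [← π₀_mk_homVertex]
    apply H
    rwa [mapπ₀_mk, mapπ₀_mk, pre_homVertex, pre_homVertex, π₀_mk_homVertex]
  · intro x y
    induction x with | mk x => ?_
    induction y with | mk y => ?_
    obtain ⟨g, rfl⟩ := homVertex_surjective x
    obtain ⟨h, rfl⟩ := homVertex_surjective y
    rw [mapπ₀_mk, mapπ₀_mk, pre_homVertex, pre_homVertex, π₀_mk_homVertex, π₀_mk_homVertex]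
    exact H g h
  · obtain ⟨x, hx⟩ := H (π₀.mk (homVertex g))
    induction x with | mk x => ?_
    obtain ⟨h, rfl⟩ := homVertex_surjective x
    rw [mapπ₀_mk, pre_homVertex, π₀_mk_homVertex] at hx
    exact ⟨h, hx⟩
  · intro x
    induction x with | mk x => ?_
    obtain ⟨g, rfl⟩ := homVertex_surjective x
    obtain ⟨h, hh⟩ := H g
    exact ⟨π₀.mk (homVertex h), by rwa [mapπ₀_mk, pre_homVertex, π₀_mk_homVertex]⟩

/-- Neither X nor Y has to be Kan: homotopies are reversed and composed only after mapping on to a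
Kan complex Z. -/
lemma sWeq_of_htpy {X Y : SSet.{v}} (f : X ⟶ Y) (g : Y ⟶ X) (h : Htpy (f ≫ g) (𝟙 X))
    (h' : Htpy (g ≫ f) (𝟙 Y)) : sWeq f := by
  rw [sWeq_iff]
  refine fun Z hZ => ⟨fun a b hab => ?_, fun a => ⟨g ≫ a, by simpa using h.post a⟩⟩
  have h1 := h'.post a
  have h2 := h'.post b
  have h3 := hab.pre g
  simp only [Category.assoc, Category.id_comp] at h1 h2 h3
  exact h1.symm.trans (h3.trans h2)

/-- Surjectivity with target X produces the inverse g. Since f g f is homotopic to f, injectivity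
with target Y makes g an inverse on the other side. -/
lemma sWeq.exists_htpy {X Y : SSet.{v}} [KanComplex X] [KanComplex Y] {f : X ⟶ Y} (hf : sWeq f) :
    ∃ g : Y ⟶ X, Htpy (f ≫ g) (𝟙 X) ∧ Htpy (g ≫ f) (𝟙 Y) := by
  rw [sWeq_iff] at hf
  obtain ⟨g, hg⟩ := (hf X).2 (𝟙 X)
  exact ⟨g, hg, (hf Y).1 _ _ (by simpa using hg.post f)⟩

/-! ### Two-out-of-three and saturation -/

/-- Weak equivalences of simplicial sets are the maps inverted by a family of functors to types. -/
def kanClasses (Z : SSet.{v}) : SSet.{v} ⥤ (Type v)ᵒᵖ where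
  obj X := op (π₀ ((ihom X).obj Z))
  map f := (↾(mapπ₀ ((MonoidalClosed.pre f).app Z))).op
  map_id X := by
    apply Quiver.Hom.unop_inj
    ext x
    simp
  map_comp f g := by
    apply Quiver.Hom.unop_inj
    ext x
    simp

/-- In this form closure properties of isomorphisms carry over to weak equivalences. -/
lemma sWeq_iff_isIso {X Y : SSet.{v}} (f : X ⟶ Y) :
    sWeq f ↔ ∀ Z : SSet.{v}, KanComplex Z → IsIso ((kanClasses Z).map f) := by
  refine forall_congr' fun Z => forall_congr' fun hZ => ?_
  rw [← isIso_unop_iff, isIso_iff_bijective]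
  rfl

lemma sWeq_comp {X Y Z : SSet.{v}} {f : X ⟶ Y} {g : Y ⟶ Z} (hf : sWeq f) (hg : sWeq g) :
    sWeq (f ≫ g) := by
  rw [sWeq_iff_isIso] at *
  intro K hK
  have := hf K hK
  have := hg K hK
  rw [Functor.map_comp]; infer_instance

lemma sWeq_of_comp_left {X Y Z : SSet.{v}} {f : X ⟶ Y} {g : Y ⟶ Z} (hf : sWeq f)
    (hfg : sWeq (f ≫ g)) : sWeq g := by
  rw [sWeq_iff_isIso] at *
  intro K hK
  have := hf K hK
  have := hfg K hK
  rw [Functor.map_comp] at this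
  exact IsIso.of_isIso_comp_left ((kanClasses K).map f) _

lemma sWeq_of_comp_right {X Y Z : SSet.{v}} {f : X ⟶ Y} {g : Y ⟶ Z} (hg : sWeq g)
    (hfg : sWeq (f ≫ g)) : sWeq f := by
  rw [sWeq_iff_isIso] at *
  intro K hK
  have := hg K hK
  have := hfg K hK
  rw [Functor.map_comp] at this
  exact IsIso.of_isIso_comp_right _ ((kanClasses K).map g)

lemma sWeq_of_isIso {X Y : SSet.{v}} (f : X ⟶ Y) [IsIso f] : sWeq f := by
  rw [sWeq_iff_isIso]
  intro K hK
  infer_instance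

/-- The class of weak equivalences is saturated. -/
lemma sWeq_of_isIso_map {X Y : SSet.{v}} (f : X ⟶ Y) [IsIso (sWeq.{v}.Q.map f)] : sWeq f := by
  rw [sWeq_iff_isIso]
  intro K hK
  -- The functor `kanClasses K` inverts weak equivalences, so it factors through the localization,
  -- and a map that becomes invertible there is inverted by it as well.
  have hi : sWeq.{v}.IsInvertedBy (kanClasses K) := fun _ _ g hg => (sWeq_iff_isIso g).1 hg K hK
  let e := Localization.fac (kanClasses K) hi sWeq.Q
  rw [← NatIso.isIso_map_iff e]
  dsimp
  infer_instance

end SimplicialSets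

end OperadicRigidity

/-! Mapping path spaces -/

namespace OperadicRigidity

section SimplicialSets

open SSet SSet.modelCategoryQuillen Simplicial CartesianMonoidalCategory

instance mono_whiskerRight {X Y : SSet.{v}} (f : X ⟶ Y) [Mono f] (Z : SSet.{v}) :
    Mono (f ▷ Z) := by
  apply +allowSynthFailures NatTrans.mono_of_mono_app
  intro n
  rw [mono_iff_injective]
  rintro ⟨x, z⟩ ⟨x', z'⟩ h
  have h' := congrArg Prod.fst h
  have hf := (mono_iff_injective (f.app n)).1 inferInstance h'
  exact Prod.ext hf (congrArg Prod.snd h :)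

lemma fibration_of_rlp_anodyne {E B : SSet.{v}} (p : E ⟶ B)
    (h : ∀ ⦃K L : SSet.{v}⦄ (j : K ⟶ L), anodyneExtensions j → HasLiftingProperty j p) :
    Fibration p := by
  rw [fibration_iff]
  intro K L j hj
  exact h j (by rw [anodyneExtensions_eq_llp_rlp]; exact MorphismProperty.le_llp_rlp _ _ hj)

lemma trivFib.fibration {E B : SSet.{v}} {p : E ⟶ B} (h : trivFib p) : Fibration p := by
  rw [fibration_iff]
  intro K L j hj
  exact h j (J_le_monomorphisms _ hj)

lemma hom_path_terminal_ext {X : SSet.{v}} (f g : X ⟶ (ihom Δ[1]).obj (⊤_ SSet.{v})) : f = g :=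
  MonoidalClosed.uncurry_injective (Limits.terminal.hom_ext _ _)

/-- Lifting against the empty inclusion into B gives a section; lifting against the inclusion of
both ends of the cylinder on E gives a homotopy between p followed by this section and the identity.
-/
lemma trivFib.sWeq {E B : SSet.{v}} {p : E ⟶ B} (h : trivFib p) : sWeq p := by
  have h1 := h (Limits.initial.to B) (inferInstance : Mono _)
  have sq1 : CommSq (Limits.initial.to E) (Limits.initial.to B) p (𝟙 B) := ⟨by simp⟩
  have h2 := h (twoVtx ▷ E) (inferInstance : Mono _)
  have sq2 : CommSq (twoDesc (p ≫ sq1.lift) (𝟙 E)) (twoVtx ▷ E) p (snd _ _ ≫ p) := ⟨by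
    apply twoDesc_hom_ext
    · change (p ≫ sq1.lift) ≫ p = p
      simp
    · rfl⟩
  refine sWeq_of_htpy p sq1.lift ⟨MonoidalClosed.curry sq2.lift, ?_, ?_⟩
    (by simpa using Htpy.refl _)
  · rw [curry_pathEv]
    change (λ_ _).inv ≫ FunctorToTypes.coprod.inl ▷ _ ≫ twoVtx ▷ _ ≫ sq2.lift = _
    rw [sq2.fac_left]; rfl
  · rw [curry_pathEv]
    change (λ_ _).inv ≫ FunctorToTypes.coprod.inr ▷ _ ≫ twoVtx ▷ _ ≫ sq2.lift = _
    rw [sq2.fac_left]; rfl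

/-- A fibration between Kan complexes which is a weak equivalence is a trivial fibration. -/
lemma trivFib_of_fibration_of_sWeq {E B : SSet.{v}} [KanComplex E] [KanComplex B] (p : E ⟶ B)
    [Fibration p] (hp : sWeq p) : trivFib p := by
  obtain ⟨g, h₁, h, hg, h1⟩ := hp.exists_htpy
  -- The homotopy `h` from `g ≫ p` to the identity is lifted to a homotopy starting at `g`. Its end
  -- `s` is a strict section of `p`.
  obtain ⟨H, -, hH, hH'⟩ := exists_path_lift 0 (Limits.initial.to B) p (Limits.initial.to _) h g
    (by simp) (by simp) hg
  obtain ⟨s, hs⟩ : ∃ s, H ≫ pathEv E 1 = s := ⟨_, rfl⟩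
  have hsp : s ≫ p = 𝟙 B := by rw [← hs, Category.assoc, ← map_pathEv, reassoc_of% hH', h1]
  obtain ⟨K, hK, hK'⟩ : Htpy (p ≫ s) (𝟙 E) := by
    refine Htpy.euclidean ?_ h₁
    exact Htpy.pre ⟨H, hH, hs⟩ p
  -- The homotopy `K` from `p ≫ s` to the identity need not be fibrewise. It has the same start and
  -- the same image in `B` as its composite with `p ≫ s`, so the box between the two gives a
  -- homotopy `F` from `p ≫ s` to the identity over constant paths.
  obtain ⟨F, hF, hF', hFp⟩ := exists_box p (K ≫ (ihom Δ[1]).map (p ≫ s)) K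
    (by rw [Category.assoc, map_pathEv, reassoc_of% hK, reassoc_of% hsp, hK])
    (by rw [Category.assoc, ← Functor.map_comp, Category.assoc, hsp, Category.comp_id])
  have e : K ≫ pathEv E 1 ≫ p ≫ s = p ≫ s := by rw [reassoc_of% hK']
  rw [Category.assoc, map_pathEv, e] at hF
  rw [hK'] at hF'
  rw [Category.assoc, ← Category.assoc _ (pathEv E 1), map_pathEv, Category.assoc, Category.assoc,
    reassoc_of% hK', reassoc_of% hsp] at hFp
  intro A C i hi
  have : Mono i := hi
  refine ⟨fun {a c} sq => ?_⟩
  -- The candidate `c ≫ s` lies over `c` but restricts to `a ≫ p ≫ s` on `A`. Extending the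
  -- correction `a ≫ F` fibrewise to `C` and taking its end repairs this.
  obtain ⟨L, h1, h2, h3⟩ := exists_path_lift 0 i p (a ≫ F) (c ≫ constPath B) (c ≫ s)
    (by rw [Category.assoc, hF, reassoc_of% sq.w])
    (by rw [Category.assoc, hFp, reassoc_of% sq.w])
    (by rw [Category.assoc, constPath_pathEv, Category.assoc, hsp])
  exact ⟨⟨{
    l := L ≫ pathEv E 1
    fac_left := by rw [reassoc_of% h1, hF', Category.comp_id]
    fac_right := by rw [Category.assoc, ← map_pathEv, reassoc_of% h3, constPath_pathEv,
      Category.comp_id] }⟩⟩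

/-- This is `exists_path_lift` over the point: a homotopy given on K and at one end of L extends to
L. -/
lemma trivFib_pathEv (i : Fin 2) (B : SSet.{v}) [KanComplex B] : trivFib (pathEv B i) := by
  intro K L k hk
  have : Mono k := hk
  refine ⟨fun {h e} sq => ?_⟩
  obtain ⟨H, h1, h2, -⟩ := exists_path_lift i k (Limits.terminal.from B) h
    (e ≫ Limits.terminal.from _ ≫ constPath _) e sq.w (hom_path_terminal_ext _ _)
    (Limits.terminal.hom_ext _ _)
  exact ⟨⟨{ l := H, fac_left := h1, fac_right := h2 }⟩⟩

section

variable {A B : SSet.{v}} (w : A ⟶ B)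

/-- The mapping path space of a map. -/
abbrev cocyl : SSet.{v} := Limits.pullback w (pathEv B 0)

/-- The end point map of the mapping path space. -/
abbrev cocylEnd : cocyl w ⟶ B := Limits.pullback.snd w (pathEv B 0) ≫ pathEv B 1

lemma trivFib_cocyl_fst [KanComplex B] : trivFib (Limits.pullback.fst w (pathEv B 0)) :=
  MorphismProperty.pullback_fst _ _ (trivFib_pathEv 0 B)

/-- A lift consists of a point of A and a path. The point exists because A is Kan; then both ends of
the path are known, and the path is filled in the Kan complex B against the pushout product of the
two ends of the interval with j. -/
instance fibration_cocylEnd [KanComplex A] [KanComplex B] : Fibration (cocylEnd w) := by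
  refine fibration_of_rlp_anodyne _ fun K L j hj => ⟨fun {a c} sq => ?_⟩
  have h1 : HasLiftingProperty j (Limits.terminal.from A) :=
    hj _ ((HomotopicalAlgebra.fibration_iff _).1 inferInstance)
  have sq1 : CommSq (a ≫ Limits.pullback.fst _ _) j (Limits.terminal.from A)
    (Limits.terminal.from _) := ⟨Limits.terminal.hom_ext _ _⟩
  obtain ⟨l, h1, h2, -⟩ := exists_lift_pushoutProduct (i := twoVtx) (j := j)
    (p := Limits.terminal.from B) (.inl ⟨inferInstance, hj⟩) (f := twoDesc (sq1.lift ≫ w) c)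
    (g := MonoidalClosed.uncurry (a ≫ Limits.pullback.snd _ _)) (b := Limits.terminal.from _) (by
      apply twoDesc_hom_ext
      · change j ≫ sq1.lift ≫ w = endpt 0 K ≫ MonoidalClosed.uncurry (a ≫ Limits.pullback.snd _ _)
        rw [← comp_pathEv, Category.assoc, ← Limits.pullback.condition, sq1.fac_left_assoc,
          Category.assoc]
      · change j ≫ c = endpt 1 K ≫ MonoidalClosed.uncurry (a ≫ Limits.pullback.snd _ _)
        rw [← comp_pathEv, ← sq.w, Category.assoc])
    (Limits.terminal.hom_ext _ _) (Limits.terminal.hom_ext _ _)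
  have h3 : endpt 0 L ≫ l = sq1.lift ≫ w := by
    change (λ_ _).inv ≫ FunctorToTypes.coprod.inl ▷ _ ≫ twoVtx ▷ _ ≫ l = _
    rw [h1]; rfl
  have h4 : endpt 1 L ≫ l = c := by
    change (λ_ _).inv ≫ FunctorToTypes.coprod.inr ▷ _ ≫ twoVtx ▷ _ ≫ l = _
    rw [h1]; rfl
  exact ⟨⟨{
    l := Limits.pullback.lift sq1.lift (MonoidalClosed.curry l) (by rw [curry_pathEv, h3])
    fac_left := by
      apply Limits.pullback.hom_ext
      · rw [Category.assoc, Limits.pullback.lift_fst, sq1.fac_left]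
      · rw [Category.assoc, Limits.pullback.lift_snd, ← MonoidalClosed.curry_natural_left, h2,
          MonoidalClosed.curry_uncurry]
    fac_right := by rw [Limits.pullback.lift_snd_assoc, curry_pathEv, h4] }⟩⟩

instance kanComplex_cocyl [KanComplex A] [KanComplex B] : KanComplex (cocyl w) := by
  have := (trivFib_cocyl_fst w).fibration
  exact isFibrant_of_fibration (Limits.pullback.fst w (pathEv B 0))

/-- The inclusion of constant paths. -/
def toCocyl : A ⟶ cocyl w := Limits.pullback.lift (𝟙 A) (w ≫ constPath B) (by simp)

lemma toCocyl_cocylEnd : toCocyl w ≫ cocylEnd w = w := by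
  rw [toCocyl, Limits.pullback.lift_snd_assoc, Category.assoc, constPath_pathEv, Category.comp_id]

lemma sWeq_toCocyl [KanComplex B] : sWeq (toCocyl w) :=
  sWeq_of_comp_right (trivFib_cocyl_fst w).sWeq (by
    rw [toCocyl, Limits.pullback.lift_fst]; exact sWeq_of_isIso (𝟙 A))

variable {w}

/-- The end point map is a fibration between Kan complexes in any case, and it is a weak equivalence
together with w because `toCocyl w` is one. -/
lemma sWeq.trivFib_cocylEnd [KanComplex A] [KanComplex B] (hw : sWeq w) : trivFib (cocylEnd w) :=
  trivFib_of_fibration_of_sWeq _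
    (sWeq_of_comp_left (sWeq_toCocyl w) (by rwa [toCocyl_cocylEnd]))

/-- The source A need not be Kan here, so the result applies to levels of End(f) without showing
that they are Kan. -/
lemma sWeq_of_trivFib_cocylEnd [KanComplex B] (hw : trivFib (cocylEnd w)) : sWeq w := by
  rw [← toCocyl_cocylEnd w]
  exact sWeq_comp (sWeq_toCocyl w) hw.sWeq

/-- A form of right properness. The lifting problem is solved after mapping it to w; the resulting
path in B is then lifted backwards along the fibration c, from its end to its start. -/
lemma trivFib_cocylEnd_of_isPullback {A' C : SSet.{v}} {a : A' ⟶ A} {w' : A' ⟶ C} {c : C ⟶ B}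
    [Fibration c] (sq : IsPullback a w' w c) (hw : trivFib (cocylEnd w)) :
    trivFib (cocylEnd w') := by
  intro K L k hk
  have hk' : Mono k := hk
  refine ⟨fun {u d} s => ?_⟩
  have h1 := hw k hk
  have sq1 : CommSq (Limits.pullback.lift (u ≫ Limits.pullback.fst _ _ ≫ a)
      (u ≫ Limits.pullback.snd _ _ ≫ (ihom Δ[1]).map c) (by
        simp only [Category.assoc]
        rw [sq.w, map_pathEv, Limits.pullback.condition_assoc])) k (cocylEnd w) (d ≫ c) := ⟨by
      rw [Limits.pullback.lift_snd_assoc, ← reassoc_of% s.w]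
      simp only [Category.assoc]
      rw [map_pathEv]⟩
  obtain ⟨m, hm⟩ : ∃ m, sq1.lift = m := ⟨_, rfl⟩
  have hm1 := sq1.fac_left
  have hm2 := sq1.fac_right
  rw [hm] at hm1 hm2
  -- Only the end `d` of the path is prescribed on all of `L`, so lifting starts from endpoint 1,
  -- relative to the path already given on `K`.
  obtain ⟨H, hH1, hH2, hH3⟩ := exists_path_lift 1 k c (u ≫ Limits.pullback.snd _ _)
    (m ≫ Limits.pullback.snd _ _) d (by rw [← s.w, Category.assoc])
    (by rw [reassoc_of% hm1, Limits.pullback.lift_snd, Category.assoc])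
    (by rw [← hm2, Category.assoc])
  -- The start of the lifted path in `C` and the point of `A` agree in `B`, so together they define
  -- a point of the pullback.
  have hl : (m ≫ Limits.pullback.fst _ _) ≫ w = (H ≫ pathEv C 0) ≫ c := by
    rw [Category.assoc, Limits.pullback.condition, ← Category.assoc m, ← hH3, Category.assoc,
      map_pathEv, Category.assoc]
  refine ⟨⟨{
    l := Limits.pullback.lift (sq.lift _ _ hl) H (by simp)
    fac_left := ?_
    fac_right := by rw [Limits.pullback.lift_snd_assoc, hH2] }⟩⟩
  apply Limits.pullback.hom_ext
  · rw [Category.assoc, Limits.pullback.lift_fst]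
    apply sq.hom_ext
    · rw [Category.assoc, sq.lift_fst, reassoc_of% hm1, Limits.pullback.lift_fst, Category.assoc]
    · rw [Category.assoc, sq.lift_snd, reassoc_of% hH1, Category.assoc, Limits.pullback.condition]
  · rw [Category.assoc, Limits.pullback.lift_snd, hH1]

end

end SimplicialSets

end OperadicRigidity

/-! Simplices of internal homs and of mapping spaces of operads -/

namespace OperadicRigidity

open SSet SSet.modelCategoryQuillen Simplicial CartesianMonoidalCategory

/-! ### Simplices of internal homs as natural families of functions -/

section Elements

variable {J X Y : SSet.{v}} {q r : SimplexCategoryᵒᵖ}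

/-- The value of a simplex of an internal hom. -/
def ival (x : ((ihom J).obj X).obj q) {c : SimplexCategoryᵒᵖ} (a : q ⟶ c) (j : J.obj c) : X.obj c :=
  Functor.HomObj.app (F := J) (G := X) x c a j

lemma ival_natural (x : ((ihom J).obj X).obj q) {c d : SimplexCategoryᵒᵖ} (a : q ⟶ c) (f : c ⟶ d)
    (j : J.obj c) : ival x (a ≫ f) (J.map f j) = X.map f (ival x a j) :=
  ConcreteCategory.congr_hom (Functor.HomObj.naturality (F := J) (G := X) x f a) j

lemma ival_map (x : ((ihom J).obj X).obj q) (b : q ⟶ r) {c : SimplexCategoryᵒᵖ} (a : r ⟶ c)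
    (j : J.obj c) : ival (((ihom J).obj X).map b x) a j = ival x (b ≫ a) j := rfl

lemma ihom_ext {x y : ((ihom J).obj X).obj q}
    (h : ∀ (c : SimplexCategoryᵒᵖ) (a : q ⟶ c) (j : J.obj c), ival x a j = ival y a j) : x = y := by
  apply Functor.HomObj.ext
  funext c a
  ext j
  exact h c a j

/-- Simplices of an internal hom. -/
def imk (φ : ∀ (c : SimplexCategoryᵒᵖ) (_ : q ⟶ c) (_ : J.obj c), X.obj c)
    (h : ∀ {c d : SimplexCategoryᵒᵖ} (a : q ⟶ c) (f : c ⟶ d) (j : J.obj c),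
      φ d (a ≫ f) (J.map f j) = X.map f (φ c a j)) : ((ihom J).obj X).obj q :=
  Functor.HomObj.mk (F := J) (G := X) (fun c a => ↾(φ c a)) (fun f a => by ext j; exact h a f j)

@[simp] lemma ival_imk (φ : ∀ (c : SimplexCategoryᵒᵖ) (_ : q ⟶ c) (_ : J.obj c), X.obj c)
    (h : ∀ {c d : SimplexCategoryᵒᵖ} (a : q ⟶ c) (f : c ⟶ d) (j : J.obj c),
      φ d (a ≫ f) (J.map f j) = X.map f (φ c a j)) {c : SimplexCategoryᵒᵖ} (a : q ⟶ c)
    (j : J.obj c) : ival (imk φ h) a j = φ c a j := rfl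

lemma uncurry_app (f : Y ⟶ (ihom J).obj X) (j : J.obj q) (y : Y.obj q) :
    (MonoidalClosed.uncurry f).app q (j, y) = ival (f.app q y) (𝟙 q) j := rfl

/-- Precomposition on internal homs is given by adjunction, so its value is found by uncurrying;
restricting x along a first reduces to the value at an identity. -/
lemma ival_pre {J' : SSet.{v}} (k : J' ⟶ J) (x : ((ihom J).obj X).obj q) {c : SimplexCategoryᵒᵖ}
    (a : q ⟶ c) (j : J'.obj c) :
    ival (((MonoidalClosed.pre k).app X).app q x) a j = ival x a (k.app c j) := by
  have h := app_congr (MonoidalClosed.uncurry_pre k X) c (j, ((ihom J).obj X).map a x)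
  rw [uncurry_app, app_map, ival_map, Category.comp_id] at h
  refine h.trans ?_
  change ival (((ihom J).obj X).map a x) (𝟙 c) (k.app c j) = _
  rw [ival_map, Category.comp_id]

end Elements

/-! ### Simplices of operadic mapping spaces -/

section OperadElements

variable {O P Q : SimplicialOperad.{v}} {q r : SimplexCategoryᵒᵖ}

/-- The value of a simplex of a mapping space of simplicial operads. -/
def sval (x : (sHom O P).obj q) : O.obj q ⟶ P.obj q :=
  Functor.HomObj.app (F := O) (G := P) x q (𝟙 q)

lemma sval_natural (x : (sHom O P).obj q) (f : q ⟶ r) :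
    O.map f ≫ sval ((sHom O P).map f x) = sval x ≫ P.map f := by
  rw [← show _ = sval x ≫ P.map f from Functor.HomObj.naturality (F := O) (G := P) x f (𝟙 q)]
  congr 1

/-- Maps to a mapping space of simplicial operads. -/
def smk {S : SSet.{v}} (φ : ∀ (c : SimplexCategoryᵒᵖ), S.obj c → (O.obj c ⟶ P.obj c))
    (h : ∀ (c d : SimplexCategoryᵒᵖ) (f : c ⟶ d) (s : S.obj c),
      O.map f ≫ φ d (S.map f s) = φ c s ≫ P.map f) : S ⟶ sHom O P :=
  (Functor.functorHomEquiv (F := O) (G := P) S).symm ⟨φ, fun f s => h _ _ f s⟩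

@[simp] lemma sval_smk {S : SSet.{v}} (φ : ∀ (c : SimplexCategoryᵒᵖ), S.obj c → (O.obj c ⟶ P.obj c))
    (h : ∀ (c d : SimplexCategoryᵒᵖ) (f : c ⟶ d) (s : S.obj c),
      O.map f ≫ φ d (S.map f s) = φ c s ≫ P.map f) (s : S.obj q) :
    sval ((smk φ h).app q s) = φ q s := by
  change φ q (S.map (𝟙 q) s) = φ q s
  rw [S.map_id]; rfl

/-- `sval` keeps only the component of a simplex at the identity. For a map of simplicial sets this
loses nothing: the other components are identity components of restricted simplices. -/
lemma sHom_hom_ext {S : SSet.{v}} {f g : S ⟶ sHom O P}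
    (h : ∀ (c : SimplexCategoryᵒᵖ) (s : S.obj c), sval (f.app c s) = sval (g.app c s)) : f = g := by
  apply (Functor.functorHomEquiv (F := O) (G := P) S).injective
  apply Functor.HomObj.ext
  funext c s
  exact h c s

lemma sval_post (f : P ⟶ Q) (x : (sHom O P).obj q) :
    sval ((operadMapPost O f).app q x) = sval x ≫ f.app q := rfl

end OperadElements

end OperadicRigidity

/-! Cotensors and pullbacks of simplicial operads -/

namespace OperadicRigidity

open SSet SSet.modelCategoryQuillen Simplicial CartesianMonoidalCategory

/-! ### Cotensors of operads, with pointwise operations -/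

section Cotensor

variable (J : SSet.{v}) (Q : SimplicialOperad.{v})

/-- The cotensor of a simplicial operad with a simplicial set, in simplicial degree `q`. -/
def operadPowerAt (q : SimplexCategoryᵒᵖ) : Operad.{v} where
  P n := ((ihom J).obj ((SimplicialOperad.level n).obj Q)).obj q
  act {n} σ p := imk (X := (SimplicialOperad.level n).obj Q)
    (fun c a j => (Q.obj c).act σ (ival p a j)) fun a f j => by
      rw [ival_natural]; exact ((Q.map f).act σ (ival p a j)).symm
  one := imk (X := (SimplicialOperad.level 1).obj Q) (fun c a j => (Q.obj c).one)
    fun a f j => (Q.map f).one.symm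
  comp {m n k} e p g := imk (X := (SimplicialOperad.level m).obj Q)
    (fun c a j => (Q.obj c).comp e (ival p a j) fun i => ival (g i) a j) fun a f j => by
      simp only [ival_natural]
      exact ((Q.map f).comp e (ival p a j) fun i => ival (g i) a j).symm
  one_act p := ihom_ext fun c a j => (Q.obj c).one_act _
  mul_act σ τ p := ihom_ext fun c a j => (Q.obj c).mul_act σ τ _
  act_comp σ e p g := ihom_ext fun c a j => (Q.obj c).act_comp σ e _ _
  comp_act e σ e' h p g := ihom_ext fun c a j => (Q.obj c).comp_act e σ e' h _ _
  comp_act' e e' τ h p g := ihom_ext fun c a j => (Q.obj c).comp_act' e e' τ h _ _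
  one_comp e h g := ihom_ext fun c a j => (Q.obj c).one_comp e h _
  comp_one e h p := ihom_ext fun c a j => (Q.obj c).comp_one e h _
  assoc e e₂ e₃ e₁ h p g r := ihom_ext fun c a j => (Q.obj c).assoc e e₂ e₃ e₁ h _ _ _

/-- The cotensor of a simplicial operad with a simplicial set. -/
def operadPower : SimplicialOperad.{v} where
  obj q := operadPowerAt J Q q
  map b :=
    { app := fun n p => ((ihom J).obj ((SimplicialOperad.level n).obj Q)).map b p
      act := fun σ p => rfl
      one := rfl
      comp := fun e p g => rfl }
  map_id q := by
    ext n p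
    exact ConcreteCategory.congr_hom
      (((ihom J).obj ((SimplicialOperad.level n).obj Q)).map_id q) p
  map_comp a b := by
    ext n p
    exact ConcreteCategory.congr_hom
      (((ihom J).obj ((SimplicialOperad.level n).obj Q)).map_comp a b) p

variable {J Q} {P : SimplicialOperad.{v}}

variable (J) in
/-- Functoriality of cotensors in the operad. -/
def operadPowerMap (f : P ⟶ Q) : operadPower J P ⟶ operadPower J Q where
  app q :=
    { app := fun n => ((ihom J).map ((SimplicialOperad.level n).map f)).app q
      act := fun σ p => ihom_ext fun c a j => (f.app c).act σ _
      one := ihom_ext fun c a j => (f.app c).one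
      comp := fun e p g => ihom_ext fun c a j => (f.app c).comp e _ _ }
  naturality q r a := by
    ext n p
    exact app_map ((ihom J).map ((SimplicialOperad.level n).map f)) a p

variable (Q) in
/-- Functoriality of cotensors in the simplicial set. -/
def operadPowerPre {K : SSet.{v}} (k : K ⟶ J) : operadPower J Q ⟶ operadPower K Q where
  app q :=
    { app := fun n => ((MonoidalClosed.pre k).app ((SimplicialOperad.level n).obj Q)).app q
      act := fun σ p => ihom_ext fun c a j => (ival_pre k _ a j).trans
        (congrArg ((Q.obj c).act σ) (ival_pre k p a j).symm)
      one := ihom_ext fun c a j => ival_pre k _ a j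
      comp := fun e p g => ihom_ext fun c a j => (ival_pre k _ a j).trans
        (congrArg₂ (fun s t => (Q.obj c).comp e s t) (ival_pre k p a j).symm
          (funext fun i => (ival_pre k (g i) a j).symm)) }
  naturality q r a := by
    ext n p
    exact app_map ((MonoidalClosed.pre k).app ((SimplicialOperad.level n).obj Q)) a p

variable (Q) in
/-- Evaluation of paths in a simplicial operad. -/
def operadPathEv (i : Fin 2) : operadPower Δ[1] Q ⟶ Q where
  app q :=
    { app := fun n => (pathEv ((SimplicialOperad.level n).obj Q) i).app q
      act := fun σ p => rfl
      one := rfl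
      comp := fun e p g => rfl }
  naturality q r a := by
    ext n p
    exact app_map (pathEv ((SimplicialOperad.level n).obj Q) i) a p

lemma operad_hom_ext {f g : P ⟶ Q} (h : ∀ n, (SimplicialOperad.level n).map f =
    (SimplicialOperad.level n).map g) : f = g := by
  ext q n p
  exact app_congr (h n) q p

end Cotensor

/-! ### Pullbacks of operads -/

section Pullback

variable {P Q R T : SimplicialOperad.{v}} (f : P ⟶ R) (g : Q ⟶ R)

/-- The pullback of simplicial operads, in simplicial degree `q`. -/
def operadPullbackAt (q : SimplexCategoryᵒᵖ) : Operad.{v} where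
  P n := { p : (P.obj q).P n × (Q.obj q).P n // (f.app q).app n p.1 = (g.app q).app n p.2 }
  act σ p := ⟨((P.obj q).act σ p.1.1, (Q.obj q).act σ p.1.2), by
    rw [(f.app q).act, (g.app q).act, p.2]⟩
  one := ⟨((P.obj q).one, (Q.obj q).one), by rw [(f.app q).one, (g.app q).one]⟩
  comp e p r := ⟨((P.obj q).comp e p.1.1 fun i => (r i).1.1,
    (Q.obj q).comp e p.1.2 fun i => (r i).1.2), by
      simp only [(f.app q).comp, (g.app q).comp, p.2, (r _).2]⟩
  one_act p := Subtype.ext (Prod.ext ((P.obj q).one_act _) ((Q.obj q).one_act _))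
  mul_act σ τ p := Subtype.ext (Prod.ext ((P.obj q).mul_act _ _ _) ((Q.obj q).mul_act _ _ _))
  act_comp σ e p r := Subtype.ext (Prod.ext ((P.obj q).act_comp σ e _ _)
    ((Q.obj q).act_comp σ e _ _))
  comp_act e σ e' h p r := Subtype.ext (Prod.ext ((P.obj q).comp_act e σ e' h _ _)
    ((Q.obj q).comp_act e σ e' h _ _))
  comp_act' e e' τ h p r := Subtype.ext (Prod.ext ((P.obj q).comp_act' e e' τ h _ _)
    ((Q.obj q).comp_act' e e' τ h _ _))
  one_comp e h r := Subtype.ext (Prod.ext ((P.obj q).one_comp e h _) ((Q.obj q).one_comp e h _))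
  comp_one e h p := Subtype.ext (Prod.ext ((P.obj q).comp_one e h _) ((Q.obj q).comp_one e h _))
  assoc e e₂ e₃ e₁ h p r s := Subtype.ext (Prod.ext ((P.obj q).assoc e e₂ e₃ e₁ h _ _ _)
    ((Q.obj q).assoc e e₂ e₃ e₁ h _ _ _))

lemma operad_app_map (f : P ⟶ Q) {q r : SimplexCategoryᵒᵖ} (a : q ⟶ r) (n : ℕ)
    (p : (P.obj q).P n) :
    (f.app r).app n ((P.map a).app n p) = (Q.map a).app n ((f.app q).app n p) :=
  app_map ((SimplicialOperad.level n).map f) a p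

/-- The pullback of simplicial operads. -/
def operadPullback : SimplicialOperad.{v} where
  obj q := operadPullbackAt f g q
  map a :=
    { app := fun n p => ⟨((P.map a).app n p.1.1, (Q.map a).app n p.1.2), by
        rw [operad_app_map, operad_app_map, p.2]⟩
      act := fun σ p => Subtype.ext (Prod.ext ((P.map a).act σ _) ((Q.map a).act σ _))
      one := Subtype.ext (Prod.ext (P.map a).one (Q.map a).one)
      comp := fun e p r => Subtype.ext (Prod.ext ((P.map a).comp e _ _) ((Q.map a).comp e _ _)) }
  map_id q := by
    ext n p
    exact Subtype.ext (Prod.ext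
      (ConcreteCategory.congr_hom (((SimplicialOperad.level n).obj P).map_id q) p.1.1)
      (ConcreteCategory.congr_hom (((SimplicialOperad.level n).obj Q).map_id q) p.1.2))
  map_comp a b := by
    ext n p
    exact Subtype.ext (Prod.ext
      (ConcreteCategory.congr_hom (((SimplicialOperad.level n).obj P).map_comp a b) p.1.1)
      (ConcreteCategory.congr_hom (((SimplicialOperad.level n).obj Q).map_comp a b) p.1.2))

/-- The first projection. -/
def operadPullbackFst : operadPullback f g ⟶ P where
  app q :=
    { app := fun n p => p.1.1
      act := fun σ p => rfl
      one := rfl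
      comp := fun e p r => rfl }

/-- The second projection. -/
def operadPullbackSnd : operadPullback f g ⟶ Q where
  app q :=
    { app := fun n p => p.1.2
      act := fun σ p => rfl
      one := rfl
      comp := fun e p r => rfl }

lemma operadPullback_condition :
    operadPullbackFst f g ≫ f = operadPullbackSnd f g ≫ g := by
  ext q n p
  exact p.2

variable {f g}

/-- The universal property of the pullback. -/
def operadPullbackLift (a : T ⟶ P) (b : T ⟶ Q) (w : a ≫ f = b ≫ g) : T ⟶ operadPullback f g where
  app q :=
    { app := fun n p => ⟨((a.app q).app n p, (b.app q).app n p),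
        app_congr (congrArg (SimplicialOperad.level n).map w) q p⟩
      act := fun σ p => Subtype.ext (Prod.ext ((a.app q).act σ p) ((b.app q).act σ p))
      one := Subtype.ext (Prod.ext (a.app q).one (b.app q).one)
      comp := fun e p r => Subtype.ext (Prod.ext ((a.app q).comp e _ _) ((b.app q).comp e _ _)) }
  naturality q r c := by
    ext n p
    exact Subtype.ext (Prod.ext (operad_app_map a c n p) (operad_app_map b c n p))

lemma operadPullbackLift_fst (a : T ⟶ P) (b : T ⟶ Q) (w : a ≫ f = b ≫ g) :
    operadPullbackLift a b w ≫ operadPullbackFst f g = a := rfl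

lemma operadPullbackLift_snd (a : T ⟶ P) (b : T ⟶ Q) (w : a ≫ f = b ≫ g) :
    operadPullbackLift a b w ≫ operadPullbackSnd f g = b := rfl

end Pullback

lemma sSet_isPullback {A B C E : SSet.{v}} {fst : A ⟶ B} {snd : A ⟶ C} {f : B ⟶ E} {g : C ⟶ E}
    (w : fst ≫ f = snd ≫ g)
    (h : ∀ (q : SimplexCategoryᵒᵖ) (b : B.obj q) (c : C.obj q), f.app q b = g.app q c →
      ∃! a : A.obj q, fst.app q a = b ∧ snd.app q a = c) : IsPullback fst snd f g := by
  refine IsPullback.of_forall_isPullback_app fun q => ?_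
  rw [Limits.Types.isPullback_iff]
  refine ⟨congr_app w q, fun x y e => ?_, fun b c e => ?_⟩
  · exact (h q _ _ (app_congr w q x)).unique ⟨rfl, rfl⟩ ⟨e.1.symm, e.2.symm⟩
  · obtain ⟨a, ha, -⟩ := h q b c e
    exact ⟨a, ha.1, ha.2⟩

lemma level_isPullback {P Q R : SimplicialOperad.{v}} (f : P ⟶ R) (g : Q ⟶ R) (n : ℕ) :
    IsPullback ((SimplicialOperad.level n).map (operadPullbackFst f g))
      ((SimplicialOperad.level n).map (operadPullbackSnd f g))
      ((SimplicialOperad.level n).map f) ((SimplicialOperad.level n).map g) := by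
  refine sSet_isPullback ?_ fun q b c e => ⟨⟨(b, c), e⟩, ⟨rfl, rfl⟩, fun a h => ?_⟩
  · rw [← Functor.map_comp, operadPullback_condition, Functor.map_comp]
  · exact Subtype.ext (Prod.ext h.1 h.2)

end OperadicRigidity

/-! Mapping spaces out of a cofibrant operad -/

namespace OperadicRigidity

open SSet SSet.modelCategoryQuillen Simplicial CartesianMonoidalCategory

/-- Dually, pushout products of monomorphisms are monomorphisms. It is enough to know this for two
boundary inclusions, where the pushout product is the inclusion of a subcomplex of a product of
simplices; two passages through the adjunction reduce to this case. -/
lemma trivFib.pullbackObjObjπ {X₁ Y₁ E B : SSet.{v}} {i : X₁ ⟶ Y₁} {p : E ⟶ B} [Mono i]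
    (hp : trivFib p) (sq₁₃ : MonoidalClosed.internalHom.PullbackObjObj i p) :
    trivFib sq₁₃.π := by
  change (MorphismProperty.monomorphisms _).rlp sq₁₃.π
  rw [rlp_monomorphisms]
  rintro _ _ _ ⟨n⟩
  let sq₁₂ := Functor.PushoutObjObj.ofHasPushout (curriedTensor SSet.{v}) i ∂Δ[n].ι
  rw [← MonoidalClosed.internalHomAdjunction₂.hasLiftingProperty_iff sq₁₂]
  -- The braiding exchanges `i` with the boundary inclusion, so that the second transposition leaves
  -- `i` as the map to lift against and the boundary inclusion as the exponent.
  rw [HasLiftingProperty.iff_of_arrow_iso_left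
    (show Arrow.mk sq₁₂.ι ≅ Arrow.mk sq₁₂.flipTensor.ι from
      Arrow.isoMk (Iso.refl _) (β_ _ _))]
  let sq₁₃' := Functor.PullbackObjObj.ofHasPullback MonoidalClosed.internalHom ∂Δ[n].ι p
  rw [MonoidalClosed.internalHomAdjunction₂.hasLiftingProperty_iff _ sq₁₃']
  suffices (MorphismProperty.monomorphisms _).rlp sq₁₃'.π from this _ inferInstance
  rw [rlp_monomorphisms]
  rintro _ _ _ ⟨m⟩
  rw [← MonoidalClosed.internalHomAdjunction₂.hasLiftingProperty_iff
    (Subcomplex.unionProd.pushoutObjObj.{v} _ _),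
    Subcomplex.unionProd.pushoutObjObj_ι]
  have : ∀ {Z : SSet.{v}} (A : Z.Subcomplex), Mono A.ι := fun A => inferInstance
  exact hp _ (this _)

/-! ### Maps into mapping spaces and maps into cotensors -/

section Transpose

variable {O P Q R : SimplicialOperad.{v}} {S T J : SSet.{v}}

/-- The transpose of a map to a mapping space of operads. -/
def toPower (u : S ⟶ sHom O Q) : O ⟶ operadPower S Q where
  app q :=
    { app := fun n o => imk (X := (SimplicialOperad.level n).obj Q)
        (fun c a s => (sval (u.app c s)).app n ((O.map a).app n o)) fun {c d} a f s => by
          have h := congrArg (fun t : O.obj c ⟶ Q.obj d => t.app n ((O.map a).app n o))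
            (sval_natural (u.app c s) f)
          rw [app_map, O.map_comp]
          exact h
      act := fun {n} σ p => ihom_ext fun c a s =>
        (congrArg ((sval (u.app c s)).app n) ((O.map a).act σ p)).trans ((sval (u.app c s)).act σ _)
      one := ihom_ext fun c a s =>
        (congrArg ((sval (u.app c s)).app 1) (O.map a).one).trans (sval (u.app c s)).one
      comp := fun {m n k} e p r => ihom_ext fun c a s =>
        (congrArg ((sval (u.app c s)).app m) ((O.map a).comp e p r)).trans
          ((sval (u.app c s)).comp e _ _) }
  naturality q r b := by
    ext n o
    refine ihom_ext fun c a s => ?_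
    change (sval (u.app c s)).app n ((O.map b ≫ O.map a).app n o) =
      (sval (u.app c s)).app n ((O.map (b ≫ a)).app n o)
    rw [O.map_comp]

/-- Evaluation of the cotensor of an operad at a simplex. -/
def operadPowerEval (Q : SimplicialOperad.{v}) {q : SimplexCategoryᵒᵖ} (s : S.obj q) :
    (operadPower S Q).obj q ⟶ Q.obj q where
  app n x := ival (X := (SimplicialOperad.level n).obj Q) x (𝟙 q) s
  act σ p := rfl
  one := rfl
  comp e p g := rfl

lemma operadPowerEval_natural (Q : SimplicialOperad.{v}) {q r : SimplexCategoryᵒᵖ} (f : q ⟶ r)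
    (s : S.obj q) : (operadPower S Q).map f ≫ operadPowerEval Q (S.map f s) =
      operadPowerEval Q s ≫ Q.map f := by
  ext n x
  refine Eq.trans ?_ (ival_natural (X := (SimplicialOperad.level n).obj Q) x (𝟙 q) f s)
  refine Eq.trans (ival_map (X := (SimplicialOperad.level n).obj Q) x f (𝟙 r) (S.map f s)) ?_
  rw [Category.comp_id, Category.id_comp]

/-- The map to a mapping space of operads which corresponds to a map to a cotensor. -/
def ofPower (w : O ⟶ operadPower S Q) : S ⟶ sHom O Q :=
  smk (fun c s => w.app c ≫ operadPowerEval Q s) fun c d f s => by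
    rw [← Category.assoc, w.naturality, Category.assoc, operadPowerEval_natural, Category.assoc]

lemma ofPower_toPower (u : S ⟶ sHom O Q) : ofPower (toPower u) = u := by
  refine sHom_hom_ext fun c s => ?_
  rw [ofPower, sval_smk]
  ext n o
  change (sval (u.app c s)).app n ((O.map (𝟙 c)).app n o) = _
  rw [O.map_id]
  rfl

lemma comp_ofPower (k : S ⟶ T) (w : O ⟶ operadPower T Q) :
    k ≫ ofPower w = ofPower (w ≫ operadPowerPre Q k) := by
  refine sHom_hom_ext fun c s => ?_
  rw [ofPower, ofPower, sval_smk]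
  refine (sval_smk _ _ _).trans ?_
  ext n o
  exact (ival_pre (X := (SimplicialOperad.level n).obj Q) k _ _ _).symm

lemma ofPower_post (w : O ⟶ operadPower S P) (f : P ⟶ Q) :
    ofPower w ≫ operadMapPost O f = ofPower (w ≫ operadPowerMap S f) := by
  refine sHom_hom_ext fun c s => ?_
  refine (sval_post f ((ofPower w).app c s)).trans ?_
  rw [ofPower, ofPower, sval_smk, sval_smk]
  rfl

lemma toPower_comp (k : S ⟶ T) (u : T ⟶ sHom O Q) :
    toPower (k ≫ u) = toPower u ≫ operadPowerPre Q k := by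
  ext q n o
  refine ihom_ext fun c a s => ?_
  exact Eq.trans rfl (ival_pre (X := (SimplicialOperad.level n).obj Q) k
    (((toPower u).app q).app n o) a s).symm

lemma toPower_post (u : S ⟶ sHom O P) (f : P ⟶ Q) :
    toPower (u ≫ operadMapPost O f) = toPower u ≫ operadPowerMap S f := rfl

/-- The map from a cotensor to the pullback of cotensors. -/
def operadPullbackPower (k : S ⟶ T) (f : P ⟶ Q) :
    operadPower T P ⟶ operadPullback (operadPowerMap S f) (operadPowerPre Q k) :=
  operadPullbackLift (operadPowerPre P k) (operadPowerMap T f) (by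
    apply operad_hom_ext
    intro n
    exact ((MonoidalClosed.pre k).naturality ((SimplicialOperad.level n).map f)).symm)

/-- Cotensors and pullbacks of operads are formed levelwise, so level n of this map is a
pullback-power of simplicial sets. -/
lemma trivFib_operadPullbackPower (k : S ⟶ T) [Mono k] (f : P ⟶ Q) (n : ℕ)
    (hf : trivFib ((SimplicialOperad.level n).map f)) :
    trivFib ((SimplicialOperad.level n).map (operadPullbackPower k f)) :=
  trivFib.pullbackObjObjπ (i := k) hf
    { pt := _
      fst := _
      snd := _
      isPullback := level_isPullback (operadPowerMap S f) (operadPowerPre Q k) n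
      π := (SimplicialOperad.level n).map (operadPullbackPower k f)
      π_fst := rfl
      π_snd := rfl }

/-- A lifting problem of k : S → T against Map(O, f) transposes to lifting a map out of O through
P^T → P^S ×_{Q^S} Q^T. This is a levelwise trivial fibration, hence an acyclic fibration, and O is
cofibrant. -/
lemma trivFib_operadMapPost (hO : IsCofibrantOperad O) (f : P ⟶ Q)
    (hf : ∀ n, trivFib ((SimplicialOperad.level n).map f)) : trivFib (operadMapPost O f) := by
  intro S T k hk
  have : Mono k := hk
  refine ⟨fun {a b} sq => ?_⟩
  have h (n : ℕ) := trivFib_operadPullbackPower k f n (hf n)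
  have h0 : toPower a ≫ operadPowerMap S f = toPower b ≫ operadPowerPre Q k := by
    rw [← toPower_post, ← toPower_comp, sq.w]
  obtain ⟨w, hw⟩ := hO (operadPullbackPower k f) (fun n => (h n).fibration) (fun n => (h n).sWeq)
    (operadPullbackLift (toPower a) (toPower b) h0)
  have h1 : w ≫ operadPowerPre P k = toPower a := by
    rw [← operadPullbackLift_fst (toPower a) (toPower b) h0, ← hw]; rfl
  have h2 : w ≫ operadPowerMap T f = toPower b := by
    rw [← operadPullbackLift_snd (toPower a) (toPower b) h0, ← hw]; rfl
  exact ⟨⟨{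
    l := ofPower w
    fac_left := by rw [comp_ofPower, h1, ofPower_toPower]
    fac_right := by rw [ofPower_post, h2, ofPower_toPower] }⟩⟩

/-! ### Compatibility of mapping spaces with cotensors and pullbacks -/

variable (O Q) in
/-- The comparison map from the cotensor of a mapping space to the mapping space to the
cotensor. -/
def powerToMap (J : SSet.{v}) : (ihom J).obj (sHom O Q) ⟶ sHom O (operadPower J Q) :=
  smk (fun q x =>
    { app := fun n o => imk (X := (SimplicialOperad.level n).obj Q)
        (fun c a j => (sval (ival x a j)).app n ((O.map a).app n o)) fun {c d} a f j => by
          have h := congrArg (fun t : O.obj c ⟶ Q.obj d => t.app n ((O.map a).app n o))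
            (sval_natural (ival x a j) f)
          rw [ival_natural, O.map_comp]
          exact h
      act := fun {n} σ p => ihom_ext fun c a s =>
        (congrArg ((sval (ival x a s)).app n) ((O.map a).act σ p)).trans
          ((sval (ival x a s)).act σ _)
      one := ihom_ext fun c a s =>
        (congrArg ((sval (ival x a s)).app 1) (O.map a).one).trans (sval (ival x a s)).one
      comp := fun {m n k} e p r => ihom_ext fun c a s =>
        (congrArg ((sval (ival x a s)).app m) ((O.map a).comp e p r)).trans
          ((sval (ival x a s)).comp e _ _) }) fun q r b x => by
    ext n o
    refine ihom_ext fun c a s => ?_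
    change (sval (ival x (b ≫ a) s)).app n ((O.map b ≫ O.map a).app n o) =
      (sval (ival x (b ≫ a) s)).app n ((O.map (b ≫ a)).app n o)
    rw [O.map_comp]

variable (O Q) in
/-- The comparison map from the mapping space to a cotensor to the cotensor of the mapping
space. -/
def mapToPower (J : SSet.{v}) : sHom O (operadPower J Q) ⟶ (ihom J).obj (sHom O Q) :=
  MonoidalClosed.curry (smk (fun q x => sval x.2 ≫ operadPowerEval Q x.1) fun q r f x => by
    have h := sval_natural x.2 f
    have h' := operadPowerEval_natural Q f x.1
    change O.map f ≫ sval ((sHom O (operadPower J Q)).map f x.2) ≫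
      operadPowerEval Q (J.map f x.1) = _
    rw [reassoc_of% h, h', Category.assoc])

/-- This composite is all that is needed: paths are moved into Map(O, Q^J), a lift is found there,
and the lift is moved back. -/
lemma powerToMap_mapToPower (J : SSet.{v}) : powerToMap O Q J ≫ mapToPower O Q J = 𝟙 _ := by
  apply MonoidalClosed.uncurry_injective
  rw [mapToPower, ← MonoidalClosed.curry_natural_left, MonoidalClosed.uncurry_curry]
  refine sHom_hom_ext fun c x => ?_
  obtain ⟨j, x⟩ := x
  refine (sval_smk (S := J ⊗ sHom O (operadPower J Q)) _ _ (j, (powerToMap O Q J).app c x)).trans ?_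
  change sval ((powerToMap O Q J).app c x) ≫ operadPowerEval Q j = sval (ival x (𝟙 c) j)
  rw [powerToMap, sval_smk]
  ext n o
  change (sval (ival x (𝟙 c) j)).app n ((O.map (𝟙 c)).app n o) = _
  rw [O.map_id]
  rfl

lemma powerToMap_post (i : Fin 2) :
    powerToMap O Q Δ[1] ≫ operadMapPost O (operadPathEv Q i) = pathEv _ i := by
  refine sHom_hom_ext fun c x => ?_
  refine (sval_post (operadPathEv Q i) ((powerToMap O Q Δ[1]).app c x)).trans ?_
  rw [powerToMap, sval_smk]
  ext n o
  change (sval (ival x (𝟙 c) ((vtx i).app c PUnit.unit))).app n ((O.map (𝟙 c)).app n o) = _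
  rw [O.map_id]
  rfl

lemma mapToPower_pathEv (i : Fin 2) :
    mapToPower O Q Δ[1] ≫ pathEv _ i = operadMapPost O (operadPathEv Q i) := by
  rw [mapToPower, curry_pathEv]
  refine sHom_hom_ext fun c x => ?_
  refine (sval_smk (S := Δ[1] ⊗ sHom O (operadPower Δ[1] Q)) _ _
    ((vtx i).app c PUnit.unit, x)).trans rfl

/-- Maps from the mapping spaces of operads to that of a pullback. -/
def sHomPullbackLift {f : P ⟶ R} {g : Q ⟶ R} (a : S ⟶ sHom O P) (b : S ⟶ sHom O Q)
    (w : a ≫ operadMapPost O f = b ≫ operadMapPost O g) : S ⟶ sHom O (operadPullback f g) :=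
  smk (fun c s =>
    { app := fun n o => ⟨((sval (a.app c s)).app n o, (sval (b.app c s)).app n o),
        congrArg (fun t : O.obj c ⟶ R.obj c => t.app n o) (congrArg sval (app_congr w c s))⟩
      act := fun σ p => Subtype.ext (Prod.ext ((sval (a.app c s)).act σ p)
        ((sval (b.app c s)).act σ p))
      one := Subtype.ext (Prod.ext (sval (a.app c s)).one (sval (b.app c s)).one)
      comp := fun e p r => Subtype.ext (Prod.ext ((sval (a.app c s)).comp e _ _)
        ((sval (b.app c s)).comp e _ _)) }) fun c d m s => by
    have h := sval_natural (a.app c s) m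
    have h' := sval_natural (b.app c s) m
    rw [← app_map] at h h'
    ext n o
    exact Subtype.ext (Prod.ext (congrArg (fun t : O.obj c ⟶ P.obj d => t.app n o) h)
      (congrArg (fun t : O.obj c ⟶ Q.obj d => t.app n o) h'))

lemma sHomPullbackLift_fst {f : P ⟶ R} {g : Q ⟶ R} (a : S ⟶ sHom O P) (b : S ⟶ sHom O Q)
    (w : a ≫ operadMapPost O f = b ≫ operadMapPost O g) :
    sHomPullbackLift a b w ≫ operadMapPost O (operadPullbackFst f g) = a := by
  refine sHom_hom_ext fun c s => ?_
  refine (sval_post (operadPullbackFst f g) ((sHomPullbackLift a b w).app c s)).trans ?_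
  rw [sHomPullbackLift, sval_smk]
  rfl

lemma sHomPullbackLift_snd {f : P ⟶ R} {g : Q ⟶ R} (a : S ⟶ sHom O P) (b : S ⟶ sHom O Q)
    (w : a ≫ operadMapPost O f = b ≫ operadMapPost O g) :
    sHomPullbackLift a b w ≫ operadMapPost O (operadPullbackSnd f g) = b := by
  refine sHom_hom_ext fun c s => ?_
  refine (sval_post (operadPullbackSnd f g) ((sHomPullbackLift a b w).app c s)).trans ?_
  rw [sHomPullbackLift, sval_smk]
  rfl

lemma operadMapPost_comp (f : P ⟶ Q) (g : Q ⟶ R) :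
    operadMapPost O (f ≫ g) = operadMapPost O f ≫ operadMapPost O g := by
  refine sHom_hom_ext fun c s => ?_
  refine (sval_post _ _).trans ?_
  exact ((sval_post g ((operadMapPost O f).app c s)).trans
    (congrArg (· ≫ g.app c) (sval_post f s)) |>.trans (Category.assoc _ _ _)).symm

end Transpose

end OperadicRigidity

/-! Mapping path operads -/

namespace OperadicRigidity

open SSet SSet.modelCategoryQuillen Simplicial CartesianMonoidalCategory

section PathOperad

variable {O P Q : SimplicialOperad.{v}} (p : P ⟶ Q)

/-- The mapping path operad of a map of simplicial operads. -/
abbrev operadCocyl : SimplicialOperad.{v} := operadPullback p (operadPathEv Q 0)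

/-- The end point map of the mapping path operad. -/
abbrev operadCocylEnd : operadCocyl p ⟶ Q :=
  operadPullbackSnd p (operadPathEv Q 0) ≫ operadPathEv Q 1

variable {p}

/-- Level n of the path operad is a pullback of the same diagram as the mapping path space of level
n, and isomorphisms do not affect trivial fibrations. -/
lemma trivFib_operadCocylEnd (n : ℕ) (h : trivFib (cocylEnd ((SimplicialOperad.level n).map p))) :
    trivFib ((SimplicialOperad.level n).map (operadCocylEnd p)) := by
  have sq := level_isPullback p (operadPathEv Q 0) n
  have e : (SimplicialOperad.level n).map (operadCocylEnd p) =
      sq.isoPullback.hom ≫ cocylEnd ((SimplicialOperad.level n).map p) := by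
    exact (congrArg (· ≫ pathEv ((SimplicialOperad.level n).obj Q) 1)
      sq.isoPullback_hom_snd).symm.trans (Category.assoc _ _ _)
  rw [e]
  exact MorphismProperty.comp_mem _ _ _ (MorphismProperty.of_isIso _ _) h

/-- A point of Map(O, P) with a path in Map(O, Q) amounts to a point of Map(O, -) of the path
operad, whose end point map is levelwise a trivial fibration. The lifting problem is carried to that
mapping space, solved there and carried back. -/
lemma trivFib_cocylEnd_operadMapPost (hO : IsCofibrantOperad O)
    (h : ∀ n, trivFib (cocylEnd ((SimplicialOperad.level n).map p))) :
    trivFib (cocylEnd (operadMapPost O p)) := by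
  have h1 := trivFib_operadMapPost hO (operadCocylEnd p) fun n => trivFib_operadCocylEnd n (h n)
  intro S T k hk
  have := h1 k hk
  refine ⟨fun {a b} sq => ?_⟩
  -- The two components of `a`, with the path rewritten as a map to the path operad, agree in `sHom
  -- O Q` and so define a map to the mapping space of the pullback.
  have hw : (a ≫ Limits.pullback.fst _ _) ≫ operadMapPost O p =
      (a ≫ Limits.pullback.snd _ _ ≫ powerToMap O Q Δ[1]) ≫
        operadMapPost O (operadPathEv Q 0) := by
    rw [Category.assoc, Limits.pullback.condition, Category.assoc, Category.assoc, powerToMap_post]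
  have sq1 : CommSq (sHomPullbackLift _ _ hw) k (operadMapPost O (operadCocylEnd p)) b := ⟨by
    rw [← sq.w, operadMapPost_comp, ← Category.assoc, sHomPullbackLift_snd, Category.assoc,
      Category.assoc, powerToMap_post]⟩
  obtain ⟨m, hm1, hm2⟩ : ∃ m, k ≫ m = sHomPullbackLift _ _ hw ∧
      m ≫ operadMapPost O (operadCocylEnd p) = b := ⟨sq1.lift, sq1.fac_left, sq1.fac_right⟩
  refine ⟨⟨{
    l := Limits.pullback.lift (m ≫ operadMapPost O (operadPullbackFst p (operadPathEv Q 0)))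
      (m ≫ operadMapPost O (operadPullbackSnd p (operadPathEv Q 0)) ≫ mapToPower O Q Δ[1]) (by
        rw [Category.assoc, Category.assoc, Category.assoc, mapToPower_pathEv,
          ← operadMapPost_comp, ← operadMapPost_comp, operadPullback_condition])
    fac_left := ?_
    fac_right := by
      rw [Limits.pullback.lift_snd_assoc, Category.assoc, Category.assoc, mapToPower_pathEv,
        ← operadMapPost_comp, hm2] }⟩⟩
  apply Limits.pullback.hom_ext
  · rw [Category.assoc, Limits.pullback.lift_fst, reassoc_of% hm1, sHomPullbackLift_fst]
  · rw [Category.assoc, Limits.pullback.lift_snd, reassoc_of% hm1, ← Category.assoc,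
      sHomPullbackLift_snd, Category.assoc, Category.assoc, powerToMap_mapToPower, Category.comp_id]

/-- By construction the homotopy fiber is the pullback of `cocylEnd` along the vertex θ, so it maps
to the point by a base change of a trivial fibration. -/
lemma contractible_homotopyFiber_operadMapPost (hO : IsCofibrantOperad O)
    (h : ∀ n, trivFib (cocylEnd ((SimplicialOperad.level n).map p))) (θ : O ⟶ Q) :
    Contractible (homotopyFiber (operadMapPost O p) (operadMapVertex θ)) := by
  have h1 : trivFib (Limits.pullback.snd (cocylEnd (operadMapPost O p)) (operadMapVertex θ)) :=
    MorphismProperty.pullback_snd _ _ (trivFib_cocylEnd_operadMapPost hO h)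
  have h2 : IsIso (Limits.terminal.from (𝟙_ SSet.{v})) :=
    Limits.isIso_of_isTerminal (SemiCartesianMonoidalCategory.isTerminalTensorUnit)
      Limits.terminalIsTerminal _
  have := sWeq_comp h1.sWeq (sWeq_of_isIso (Limits.terminal.from (𝟙_ SSet.{v})))
  rwa [Limits.terminal.hom_ext (_ ≫ _) (Limits.terminal.from _)] at this

end PathOperad

end OperadicRigidity

/-! Mapping spaces and tensor powers in an operadic model category -/

namespace OperadicRigidity

open SSet.modelCategoryQuillen

/-! ### Fibrations of mapping spaces and cofibrancy of tensor powers -/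

section ModelCat

variable {D : Type u} [Category.{v} D] [ModelCategory D] [SimplicialCategory D]
  [MonoidalCategory D] [SymmetricCategory D] [SymmetricMonoidalEnrichment D]
  [OperadicModelCategory D]

/-- Apply SM7 to the map from the initial object to A. Mapping spaces out of the chosen initial
object are points, so the pullback-power is composition with p itself. -/
lemma fibration_map (A : D) [IsCofibrant A] {y z : D} (p : y ⟶ z) [Fibration p] :
    Fibration (eHomWhiskerLeft SSet.{v} A p) := by
  obtain ⟨T, ⟨hT⟩, hT'⟩ := exists_initial (D := D)
  have : Cofibration (hT.to A) := (isCofibrant_iff_of_isInitial _ hT).1 inferInstance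
  let sq : (sHomFunctor D).PullbackObjObj (hT.to A) p :=
    { pt := sHom A z
      fst := (hT' y).some.from _
      snd := 𝟙 _
      isPullback := by
        have h1 : IsIso (((sHomFunctor D).obj (op T)).map p) :=
          Limits.isIso_of_isTerminal (hT' y).some (hT' z).some _
        apply +allowSynthFailures IsPullback.of_vert_isIso
        · exact IsIso.id (sHom A z)
        · exact ⟨(hT' z).some.hom_ext _ _⟩
      π := eHomWhiskerLeft SSet.{v} A p
      π_fst := (hT' y).some.hom_ext _ _
      π_snd := Category.comp_id _ }
  exact (OperadicModelCategory.sm7 (hT.to A) p sq).1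

/-- The hypothesis replaces cofibrancy of A, which is not available when A is the unit. -/
lemma kanComplex_map {A : D} (hA : ∀ {y z : D} (p : y ⟶ z) [Fibration p],
    Fibration (eHomWhiskerLeft SSet.{v} A p)) (Y : D) [IsFibrant Y] :
    SSet.KanComplex (sHom A Y) := by
  obtain ⟨C, ⟨hC⟩, hC'⟩ := exists_terminal (D := D)
  have : Fibration (hC.from Y) := (isFibrant_iff_of_isTerminal _ hC).1 inferInstance
  exact (isFibrant_iff_of_isTerminal _ (hC' A).some).2 (hA (hC.from Y))

/-- Tensoring with the initial object T gives initial objects, so the pushout corner for T → A and T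
→ B is the initial object T ⊗ B, and the pushout product is its map to A ⊗ B. -/
instance isCofibrant_tensor (A B : D) [IsCofibrant A] [IsCofibrant B] : IsCofibrant (A ⊗ B) := by
  obtain ⟨T, ⟨hT⟩, -⟩ := exists_initial (D := D)
  have : Cofibration (hT.to A) := (isCofibrant_iff_of_isInitial _ hT).1 inferInstance
  have : Cofibration (hT.to B) := (isCofibrant_iff_of_isInitial _ hT).1 inferInstance
  have h1 := (OperadicModelCategory.initial_tensor T B ⟨hT⟩).some
  have h2 := (OperadicModelCategory.tensor_initial A T ⟨hT⟩).some
  have h3 := (OperadicModelCategory.tensor_initial T T ⟨hT⟩).some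
  let sq : (curriedTensor D).PushoutObjObj (hT.to A) (hT.to B) :=
    { pt := T ⊗ B
      inl := h2.to _
      inr := 𝟙 _
      isPushout := by
        have h4 : IsIso (((curriedTensor D).map (hT.to A)).app T) :=
          Limits.isIso_of_isInitial h3 h2 _
        apply +allowSynthFailures IsPushout.of_horiz_isIso
        · exact ⟨h3.hom_ext _ _⟩
      ι := h1.to _
      inl_ι := h2.hom_ext _ _
      inr_ι := h1.hom_ext _ _ }
  rw [isCofibrant_iff_of_isInitial (h1.to (A ⊗ B)) h1]
  exact (OperadicModelCategory.pushoutProduct (hT.to A) (hT.to B) sq).1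

lemma isCofibrant_of_isoTo {A B : D} (e : A ≅ B) [IsCofibrant A] : IsCofibrant B := by
  obtain ⟨T, ⟨hT⟩, -⟩ := exists_initial (D := D)
  have : Cofibration (hT.to A) := (isCofibrant_iff_of_isInitial _ hT).1 inferInstance
  rw [isCofibrant_iff_of_isInitial (hT.to A ≫ e.hom) hT]
  infer_instance

/-- The exponent starts at 1 because the zeroth power is the unit, which need not be cofibrant. -/
instance isCofibrant_pw (X : D) [IsCofibrant X] : ∀ n : ℕ, IsCofibrant (pw (n + 1) X)
  | 0 => isCofibrant_of_isoTo (ρ_ X).symm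
  | n + 1 =>
    have := isCofibrant_pw X n
    isCofibrant_tensor X (pw (n + 1) X)

lemma fibration_map_pw (X : D) [IsCofibrant X] (n : ℕ) {y z : D} (p : y ⟶ z) [Fibration p] :
    Fibration (eHomWhiskerLeft SSet.{v} (pw n X) p) := by
  cases n with
  | zero => exact (OperadicModelCategory.unit_fibration p).1
  | succ n => exact fibration_map _ p

/-! ### Morphisms that become equivalences on mapping into Y -/

/-- The morphisms which induce isomorphisms on mapping spaces to `Y` in the homotopy category
of spaces. -/
def localMaps (Y : D) : MorphismProperty D := fun _ _ g =>
  IsIso (sWeq.{v}.Q.map (eHomWhiskerRight SSet.{v} g Y))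

/-- As an inverse image of the isomorphisms, the class inherits two-out-of-three and invariance
under isomorphism of arrows. -/
lemma localMaps_eq (Y : D) : localMaps Y = ((MorphismProperty.isomorphisms _).inverseImage
    ((sHomFunctor D).flip.obj Y ⋙ sWeq.{v}.Q)).unop := rfl

instance (Y : D) : (localMaps Y).HasTwoOutOfThreeProperty := by
  rw [localMaps_eq]; infer_instance

instance (Y : D) : (localMaps Y).RespectsIso := by
  rw [localMaps_eq]; infer_instance

lemma localMaps_of_isIso (Y : D) {A B : D} (g : A ⟶ B) [IsIso g] : localMaps Y g := by
  change IsIso (((sHomFunctor D).flip.obj Y ⋙ sWeq.{v}.Q).map g.op)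
  infer_instance

lemma localMaps_of_weq (Y : D) [IsFibrant Y] {A B : D} (g : A ⟶ B) [IsCofibrant A] [IsCofibrant B]
    [WeakEquivalence g] : localMaps Y g := isIso_map_weq_left g Y


/-! ### Rigidity in the homotopy category and its consequences in D -/

section Derived

/-- The derived tensor product of cofibrant objects. -/
def derivedTensorIso : (((Functor.whiskeringLeft₂ (Ho D)).obj (CofibrantObject.ι ⋙ toHo D)).obj
    (CofibrantObject.ι ⋙ toHo D)).obj (derivedTensor D) ≅ cofTensor D :=
  Localization.Lifting₂.iso (CofibrantObject.ι ⋙ toHo D) (CofibrantObject.ι ⋙ toHo D)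
    (weakEquivalences (CofibrantObject D)) (weakEquivalences (CofibrantObject D)) (cofTensor D)
    (Localization.lift₂ (cofTensor D) (cofTensor_inverts D) (CofibrantObject.ι ⋙ toHo D)
      (CofibrantObject.ι ⋙ toHo D))

/-- The derived mapping spaces from cofibrant to fibrant objects. -/
def derivedMapIso : (((Functor.whiskeringLeft₂ HoSSet.{v}).obj
    (CofibrantObject.ι ⋙ toHo D).op).obj (FibrantObject.ι ⋙ toHo D)).obj (derivedMap D) ≅
      cofFibMap D :=
  Localization.Lifting₂.iso (CofibrantObject.ι ⋙ toHo D).op (FibrantObject.ι ⋙ toHo D)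
    (weakEquivalences (CofibrantObject D)).op (weakEquivalences (FibrantObject D)) (cofFibMap D)
    (Localization.lift₂ (cofFibMap D) (cofFibMap_inverts D) (CofibrantObject.ι ⋙ toHo D).op
      (FibrantObject.ι ⋙ toHo D))

/-- The derived tensor product of cofibrant objects. -/
def dtensIso (A B : D) [IsCofibrant A] [IsCofibrant B] :
    dtens ((toHo D).obj A) ((toHo D).obj B) ≅ (toHo D).obj (A ⊗ B) :=
  (derivedTensorIso.app (CofibrantObject.mk A)).app (CofibrantObject.mk B)

lemma dtensIso_natural (A : D) [IsCofibrant A] {B C : D} [IsCofibrant B] [IsCofibrant C]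
    (f : B ⟶ C) : ((derivedTensor D).obj ((toHo D).obj A)).map ((toHo D).map f) ≫
      (dtensIso A C).hom = (dtensIso A B).hom ≫ (toHo D).map (A ◁ f) := by
  exact (derivedTensorIso.hom.app (CofibrantObject.mk A)).naturality (CofibrantObject.homMk f)

/-- The morphisms which induce isomorphisms on derived mapping spaces to `z`. -/
def derivedLocalMaps (z : Ho D) : MorphismProperty (Ho D) := fun _ _ g =>
  IsIso (((derivedMap D).map g.op).app z)

instance (z : Ho D) : (derivedLocalMaps z).RespectsIso := by
  rw [show derivedLocalMaps z = ((MorphismProperty.isomorphisms _).inverseImage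
    ((derivedMap D).flip.obj z)).unop from rfl]
  infer_instance

lemma derivedLocalMaps_of_iso {z z' : Ho D} (e : z ≅ z') {a b : Ho D} {g : a ⟶ b}
    (h : derivedLocalMaps z g) : derivedLocalMaps z' g :=
  ((MorphismProperty.isomorphisms _).arrow_mk_iso_iff
    (Arrow.isoMk (((derivedMap D).obj (op b)).mapIso e) (((derivedMap D).obj (op a)).mapIso e)
      (((derivedMap D).map g.op).naturality e.hom))).1 h

/-- Between cofibrant and fibrant objects the derived mapping space is naturally the image of the
actual one. -/
lemma localMaps_of_derivedLocalMaps (Y : D) [IsFibrant Y] {A B : D} [IsCofibrant A] [IsCofibrant B]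
    (g : A ⟶ B) (h : derivedLocalMaps ((toHo D).obj Y) ((toHo D).map g)) : localMaps Y g :=
  ((MorphismProperty.isomorphisms _).arrow_mk_iso_iff
    (Arrow.isoMk ((derivedMapIso.app (op (CofibrantObject.mk B))).app (FibrantObject.mk Y))
      ((derivedMapIso.app (op (CofibrantObject.mk A))).app (FibrantObject.mk Y))
      (NatTrans.congr_app (derivedMapIso.hom.naturality (CofibrantObject.homMk g).op)
        (FibrantObject.mk Y)).symm)).1 h

/-- Naturality of the adjunction map in the middle variable gives a square. Its two adjunction maps
are invertible by hypothesis, and its side on maps out of a is induced by F(y, y) → F(x, y),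
invertible by rigidity; hence so is the remaining side. -/
lemma WeakFunctionObject.derivedLocalMaps_tensor (W : WeakFunctionObject D) {x y : Ho D} {η : x ⟶ y}
    (hη : W.IsRigid η) {a : Ho D} (hx : W.ProvidesAdjoint a x y) (hy : W.ProvidesAdjoint a y y) :
    derivedLocalMaps y (((derivedTensor D).obj a).map η) := by
  have : IsIso ((W.F.map η.op).app y) := hη
  have : IsIso (W.adj a x y) := hx
  have : IsIso (W.adj a y y) := hy
  have h := W.adj_natural_middle a η y
  have : IsIso (((derivedMap D).map (((derivedTensor D).obj a).map η).op).app y ≫ W.adj a x y) := by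
    rw [h]; infer_instance
  exact IsIso.of_isIso_comp_right _ (W.adj a x y)

lemma WeakFunctionObject.localMaps_whiskerLeft (W : WeakFunctionObject D) {x y : Ho D} {η : x ⟶ y}
    (hη : W.IsRigid η) {a : Ho D} (hx : W.ProvidesAdjoint a x y) (hy : W.ProvidesAdjoint a y y)
    {X Y A : D} [IsCofibrant X] [IsCofibrant Y] [IsFibrant Y] [IsCofibrant A] (f : X ⟶ Y)
    (e : Arrow.mk ((toHo D).map f) ≅ Arrow.mk η) (i : (toHo D).obj A ≅ a) :
    localMaps Y (A ◁ f) := by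
  apply localMaps_of_derivedLocalMaps
  have h1 := derivedLocalMaps_of_iso (Arrow.rightFunc.mapIso e).symm
    (W.derivedLocalMaps_tensor hη hx hy)
  -- All objects are cofibrant, so `A ◁ f` computes the derived tensor product; it remains to change
  -- the representatives of `a` and `η`.
  refine ((derivedLocalMaps _).arrow_mk_iso_iff
    (?_ : Arrow.mk ((toHo D).map (A ◁ f)) ≅ Arrow.mk (((derivedTensor D).obj a).map η))).2 h1
  have e1 : Arrow.mk (((derivedTensor D).obj ((toHo D).obj A)).map ((toHo D).map f)) ≅
      Arrow.mk ((toHo D).map (A ◁ f)) :=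
    Arrow.isoMk (dtensIso A X) (dtensIso A Y) (dtensIso_natural A f).symm
  refine e1.symm ≪≫ ?_ ≪≫ ((derivedTensor D).obj a).mapArrow.mapIso e
  exact Arrow.isoMk (((derivedTensor D).mapIso i).app _) (((derivedTensor D).mapIso i).app _)
    (((derivedTensor D).map i.hom).naturality _).symm

/-- Tensor powers of cofibrant objects, bracketed to the left and starting with a cofibrant
replacement of the unit object. -/
def cofPow (X : D) : ℕ → D
  | 0 => CofibrantObject.HoCat.resolutionObj (𝟙_ D)
  | n + 1 => cofPow X n ⊗ X

instance isCofibrant_cofPow (X : D) [IsCofibrant X] : ∀ n, IsCofibrant (cofPow X n)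
  | 0 => inferInstanceAs (IsCofibrant (CofibrantObject.HoCat.resolutionObj (𝟙_ D)))
  | n + 1 =>
    have := isCofibrant_cofPow X n
    isCofibrant_tensor _ X

/-- Functoriality of derived tensor products in isomorphisms. -/
def dtensMapIso {x x' y y' : Ho D} (e : x ≅ x') (e' : y ≅ y') : dtens x y ≅ dtens x' y' :=
  ((derivedTensor D).mapIso e).app y ≪≫ ((derivedTensor D).obj x').mapIso e'

variable (D) in
/-- The cofibrant replacement of the unit object in the homotopy category. -/
def resolutionUnitIso :
    (toHo D).obj (CofibrantObject.HoCat.resolutionObj (𝟙_ D)) ≅ (toHo D).obj (𝟙_ D) :=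
  Localization.isoOfHom (toHo D) (weakEquivalences D)
    (CofibrantObject.HoCat.pResolutionObj (𝟙_ D)) (mem_weakEquivalences _)

/-- The left bracketed tensor powers represent the derived tensor powers. -/
def cofPowIso (X : D) [IsCofibrant X] {x : Ho D} (e : (toHo D).obj X ≅ x) :
    ∀ n, (toHo D).obj (cofPow X n) ≅ dpow x n
  | 0 => resolutionUnitIso D
  | n + 1 => (dtensIso (cofPow X n) X).symm ≪≫ dtensMapIso (cofPowIso X e n) e

/-- Functoriality of the left bracketed tensor powers. -/
def cofPowMap {X Y : D} (f : X ⟶ Y) : ∀ n, cofPow X n ⟶ cofPow Y n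
  | 0 => 𝟙 _
  | n + 1 => cofPowMap f n ⊗ₘ f

/-- The comparison between tensor powers. -/
def cofPowTo (X : D) : ∀ n, cofPow X n ⟶ pw n X
  | 0 => CofibrantObject.HoCat.pResolutionObj (𝟙_ D)
  | n + 1 => cofPowTo X n ▷ X ≫ (β_ (pw n X) X).hom

lemma cofPowTo_natural {X Y : D} (f : X ⟶ Y) :
    ∀ n, cofPowTo X n ≫ pmap n f = cofPowMap f n ≫ cofPowTo Y n
  | 0 => (Category.comp_id _).trans (Category.id_comp _).symm
  | n + 1 => by
    change (cofPowTo X n ▷ X ≫ (β_ (pw n X) X).hom) ≫ (f ⊗ₘ pmap n f) =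
      (cofPowMap f n ⊗ₘ f) ≫ cofPowTo Y n ▷ Y ≫ (β_ (pw n Y) Y).hom
    rw [Category.assoc, ← BraidedCategory.braiding_naturality, ← tensorHom_id,
      tensorHom_comp_tensorHom_assoc, cofPowTo_natural f n, Category.id_comp, ← tensorHom_id,
      tensorHom_comp_tensorHom_assoc, Category.comp_id]

/-- Only the factor X has to be cofibrant for tensoring to preserve a weak equivalence, so the
possibly non-cofibrant zeroth power is harmless. -/
instance weakEquivalence_cofPowTo (X : D) [IsCofibrant X] : ∀ n, WeakEquivalence (cofPowTo X n)
  | 0 => inferInstanceAs (WeakEquivalence (CofibrantObject.HoCat.pResolutionObj (𝟙_ D)))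
  | n + 1 =>
    have := weakEquivalence_cofPowTo X n
    have := OperadicModelCategory.weq_whiskerRight (cofPowTo X n) X
    inferInstanceAs (WeakEquivalence (cofPowTo X n ▷ X ≫ (β_ (pw n X) X).hom))

/-! ### Replacing the factors X by Y one at a time -/

section

variable {X Y : D} [IsCofibrant X] [IsCofibrant Y] [IsFibrant Y] {f : X ⟶ Y}

/-- Induction on n for all m at once: the last factor X is changed to Y and then absorbed into the
powers of Y, which raises m by one. -/
lemma localMaps_cofPowMap_whiskerRight
    (h : ∀ n m, localMaps Y ((cofPow X n ⊗ cofPow Y m) ◁ f)) :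
    ∀ n m, localMaps Y (cofPowMap f n ▷ cofPow Y m)
  | 0, m => by
    have : IsIso (cofPowMap f 0 ▷ cofPow Y m) :=
      inferInstanceAs (IsIso (𝟙 (CofibrantObject.HoCat.resolutionObj (𝟙_ D)) ▷ cofPow Y m))
    exact localMaps_of_isIso Y _
  | n + 1, m => by
    have e : cofPowMap f (n + 1) ▷ cofPow Y m =
        (cofPow X n ◁ f) ▷ cofPow Y m ≫ (cofPowMap f n ▷ Y) ▷ cofPow Y m := by
      rw [← comp_whiskerRight]
      exact congrArg (· ▷ cofPow Y m) (tensorHom_def' (cofPowMap f n) f)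
    rw [e]
    refine (localMaps Y).comp_mem _ _ ?_ ?_
    -- Moving the changing factor past the powers of `Y` by symmetry turns this map into the
    -- hypothesis for `n` and `m`.
    · refine ((localMaps Y).arrow_mk_iso_iff (?_ : Arrow.mk ((cofPow X n ◁ f) ▷ cofPow Y m) ≅
        Arrow.mk ((cofPow X n ⊗ cofPow Y m) ◁ f))).2 (h n m)
      have : cofPow X n ◁ f ▷ cofPow Y m ≫ cofPow X n ◁ (β_ Y (cofPow Y m)).hom =
          cofPow X n ◁ (β_ X (cofPow Y m)).hom ≫ cofPow X n ◁ cofPow Y m ◁ f := by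
        rw [← whiskerLeft_comp, BraidedCategory.braiding_naturality_left, whiskerLeft_comp]
      exact Arrow.isoMk
        (α_ _ _ _ ≪≫ whiskerLeftIso _ (β_ _ _) ≪≫ (α_ _ _ _).symm)
        (α_ _ _ _ ≪≫ whiskerLeftIso _ (β_ _ _) ≪≫ (α_ _ _ _).symm) (by simp [reassoc_of% this])
    · refine ((localMaps Y).arrow_mk_iso_iff (?_ : Arrow.mk ((cofPowMap f n ▷ Y) ▷ cofPow Y m) ≅
        Arrow.mk (cofPowMap f n ▷ cofPow Y (m + 1)))).2
          (localMaps_cofPowMap_whiskerRight h n (m + 1))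
      exact Arrow.isoMk (α_ _ _ _ ≪≫ whiskerLeftIso (cofPow X n) (β_ Y (cofPow Y m)))
        (α_ _ _ _ ≪≫ whiskerLeftIso (cofPow Y n) (β_ Y (cofPow Y m))) (by
          have : cofPowMap f n ▷ Y ▷ cofPow Y m ≫ (α_ _ _ _).hom ≫
            cofPow Y n ◁ (β_ Y (cofPow Y m)).hom = ((α_ _ _ _).hom ≫
              cofPow X n ◁ (β_ Y (cofPow Y m)).hom) ≫ cofPowMap f n ▷ (cofPow Y m ⊗ Y) := by
            rw [associator_naturality_left_assoc, ← whisker_exchange, Category.assoc]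
          exact this.symm)

/-- For m = 0 the extra factor is the cofibrant replacement of the unit; collapsing it to the unit
is a weak equivalence between cofibrant objects, and two-out-of-three removes it. -/
lemma localMaps_cofPowMap (h : ∀ n m, localMaps Y ((cofPow X n ⊗ cofPow Y m) ◁ f)) (n : ℕ) :
    localMaps Y (cofPowMap f n) := by
  let r := CofibrantObject.HoCat.pResolutionObj (𝟙_ D)
  have hr (Z : D) [IsCofibrant Z] : localMaps Y (Z ◁ r ≫ (ρ_ Z).hom) := by
    have := OperadicModelCategory.weq_whiskerLeft Z r
    exact localMaps_of_weq Y _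
  have h1 := localMaps_cofPowMap_whiskerRight h n 0
  refine (localMaps Y).of_precomp _ _ (hr (cofPow X n)) ?_
  have e : (cofPow X n ◁ r ≫ (ρ_ _).hom) ≫ cofPowMap f n =
      cofPowMap f n ▷ cofPow Y 0 ≫ (cofPow Y n ◁ r ≫ (ρ_ _).hom) := by
    have := whisker_exchange_assoc (cofPowMap f n) r (ρ_ (cofPow Y n)).hom
    refine Eq.trans ?_ this
    rw [Category.assoc, rightUnitor_naturality]
  rw [e]
  exact (localMaps Y).comp_mem _ _ h1 (hr _)

/-- In positive arity the powers are cofibrant and can be compared with `cofPow`. In arity 0 the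
source is the unit, to which this comparison does not apply, but the map is an identity. Saturation
returns from the homotopy category of spaces to weak equivalences. -/
lemma sWeq_map_pmap (h : ∀ n m, localMaps Y ((cofPow X n ⊗ cofPow Y m) ◁ f)) (n : ℕ) :
    sWeq (eHomWhiskerRight SSet.{v} (pmap n f) Y) := by
  have : localMaps Y (pmap n f) := by
    cases n with
    | zero =>
      have : IsIso (pmap 0 f) := inferInstanceAs (IsIso (𝟙 (𝟙_ D)))
      exact localMaps_of_isIso Y _
    | succ n =>
      refine (localMaps Y).of_precomp _ _ (localMaps_of_weq Y (cofPowTo X (n + 1))) ?_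
      rw [cofPowTo_natural]
      exact (localMaps Y).comp_mem _ _ (localMaps_cofPowMap h _)
        (localMaps_of_weq Y (cofPowTo Y (n + 1)))
  have : IsIso (sWeq.{v}.Q.map (eHomWhiskerRight SSet.{v} (pmap n f) Y)) := this
  exact sWeq_of_isIso_map _

end

end Derived

end ModelCat

end OperadicRigidity

/-! The endomorphism operad of a rigid morphism -/

namespace OperadicRigidity

open SSet.modelCategoryQuillen

/-! ### Representing a morphism by a fibration -/

section Represent

variable {D : Type u} [Category.{v} D] [ModelCategory D]

/-- A morphism between bifibrant objects of the homotopy category comes from D. Factoring it as a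
trivial cofibration and a fibration keeps the middle object bifibrant and changes the arrow only up
to isomorphism. -/
lemma exists_represents {x y : Ho D} (η : x ⟶ y) :
    ∃ (X Y : D) (f : X ⟶ Y), Represents f η := by
  have : (BifibrantObject.ι ⋙ toHo D).EssSurj :=
    Localization.essSurj _ (weakEquivalences (BifibrantObject D))
  let X := (BifibrantObject.ι ⋙ toHo D).objPreimage x
  let Y := (BifibrantObject.ι ⋙ toHo D).objPreimage y
  let eX : (toHo D).obj X.obj ≅ x := (BifibrantObject.ι ⋙ toHo D).objObjPreimageIso x
  let eY : (toHo D).obj Y.obj ≅ y := (BifibrantObject.ι ⋙ toHo D).objObjPreimageIso y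
  obtain ⟨g, hg⟩ := map_surjective_of_isLocalization (toHo D) (X := X.obj) (Y := Y.obj)
    (eX.hom ≫ η ≫ eY.inv)
  let h := MorphismProperty.factorizationData (trivialCofibrations D) (fibrations D) g
  have hi : Cofibration h.i := ⟨h.hi.1⟩
  have hi' : WeakEquivalence h.i := ⟨h.hi.2⟩
  have hp : Fibration h.p := ⟨h.hp⟩
  have : IsIso ((toHo D).map h.i) :=
    Localization.inverts (toHo D) (weakEquivalences D) _ (mem_weakEquivalences _)
  refine ⟨h.Z, Y.obj, h.p, ⟨hp, isCofibrant_of_cofibration h.i,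
    isFibrant_of_fibration h.p, inferInstance, inferInstance, ⟨Arrow.isoMk
      ((asIso ((toHo D).map h.i)).symm ≪≫ eX) eY ?_⟩⟩⟩
  have h1 : (toHo D).map h.i ≫ (toHo D).map h.p = eX.hom ≫ η ≫ eY.inv := by
    rw [← Functor.map_comp, h.fac, hg]
  change (inv ((toHo D).map h.i) ≫ eX.hom) ≫ η = (toHo D).map h.p ≫ eY.hom
  rw [Category.assoc, IsIso.inv_comp_eq, reassoc_of% h1, eY.inv_hom_id, Category.comp_id]

end Represent

/-! ### Rigidity and the projection from End(f) to End(X) -/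

section EndOperads

variable {D : Type u} [Category.{v} D] [ModelCategory D] [SimplicialCategory D]
  [MonoidalCategory D] [SymmetricCategory D] [SymmetricMonoidalEnrichment D]

/-- The projection from the endomorphism operad of a morphism to that of its target. -/
def levelEndArrowToTarget {X Y : D} (f : X ⟶ Y) (n : ℕ) :
    (SimplicialOperad.level n).obj (endArrow f) ⟶ sHom (pw n Y) Y where
  app q := ↾fun p => p.1.2

/-- The square is oriented so that the projection to End(X) is a base change of precomposition with
the power of f, along the fibration given by composition with f. -/
lemma level_endArrow_isPullback {X Y : D} (f : X ⟶ Y) (n : ℕ) :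
    IsPullback (levelEndArrowToTarget f n) ((SimplicialOperad.level n).map (endArrowToSource f))
      (eHomWhiskerRight SSet.{v} (pmap n f) Y) (eHomWhiskerLeft SSet.{v} (pw n X) f) := by
  refine sSet_isPullback ?_ fun q b c e => ⟨⟨(c, b), e.symm⟩, ⟨rfl, rfl⟩, fun a h => ?_⟩
  · ext q p
    exact p.2.symm
  · exact Subtype.ext (Prod.ext h.2 h.1)

variable [OperadicModelCategory D]

/-- Precomposition with the power of f is a weak equivalence of Kan complexes by rigidity; its end
point map is then a trivial fibration, and this passes to the pullback. -/
lemma trivFib_cocylEnd_endArrowToSource (W : WeakFunctionObject D) {x y : Ho D} {η : x ⟶ y}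
    (hη : W.IsRigid η)
    (hx : ∀ n m : ℕ, W.ProvidesAdjoint (dtens (dpow x n) (dpow y m)) x y)
    (hy : ∀ n m : ℕ, W.ProvidesAdjoint (dtens (dpow x n) (dpow y m)) y y)
    {X Y : D} {f : X ⟶ Y} (hf : Represents f η) (n : ℕ) :
    trivFib (cocylEnd ((SimplicialOperad.level n).map (endArrowToSource f))) := by
  have := hf.fibration
  have := hf.cofibrant_source
  have := hf.cofibrant_target
  have := hf.fibrant_target
  obtain ⟨e⟩ := hf.iso
  have h : ∀ n m, localMaps Y ((cofPow X n ⊗ cofPow Y m) ◁ f) := fun n m =>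
    W.localMaps_whiskerLeft hη (hx n m) (hy n m) f e ((dtensIso _ _).symm ≪≫
      dtensMapIso (cofPowIso X (Arrow.leftFunc.mapIso e) n)
        (cofPowIso Y (Arrow.rightFunc.mapIso e) m))
  have := kanComplex_map (fibration_map_pw X n) Y
  have := kanComplex_map (fibration_map_pw Y n) Y
  exact @trivFib_cocylEnd_of_isPullback _ _ _ _ _ _ _ _ (fibration_map_pw X n f)
    (level_endArrow_isPullback f n)
    (sWeq_map_pmap h n).trivFib_cocylEnd

end EndOperads

end OperadicRigidity

end

theorem theorem3p3 {D : Type u} [Category.{v} D] [ModelCategory D] [SimplicialCategory D]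
    [MonoidalCategory D] [SymmetricCategory D] [SymmetricMonoidalEnrichment D]
    [OperadicModelCategory D] (W : WeakFunctionObject D) {x y : Ho D} (η : x ⟶ y)
    (hη : W.IsRigid η)
    (hx : ∀ n m : ℕ, W.ProvidesAdjoint (dtens (dpow x n) (dpow y m)) x y)
    (hy : ∀ n m : ℕ, W.ProvidesAdjoint (dtens (dpow x n) (dpow y m)) y y) :
    (∃ (X Y : D) (f : X ⟶ Y), Represents f η) ∧
    ∀ (X Y : D) (f : X ⟶ Y), Represents f η →
      operadWeq (endArrowToSource f) ∧
      ∀ O : SimplicialOperad.{v}, IsCofibrantOperad O → ∀ θ : O ⟶ endOperad X,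
        Contractible (homotopyFiber (operadMapPost O (endArrowToSource f))
          (operadMapVertex θ)) := by
  refine ⟨exists_represents η, fun X Y f hf => ?_⟩
  -- Both conclusions follow from this: in each arity directly, and through mapping spaces for the
  -- homotopy fibers.
  have h := trivFib_cocylEnd_endArrowToSource W hη hx hy hf
  refine ⟨fun n => ?_, fun O hO θ => contractible_homotopyFiber_operadMapPost hO h θ⟩
  have := hf.cofibrant_source
  have := hf.fibrant_source
  have : SSet.KanComplex ((SimplicialOperad.level n).obj (endOperad X)) :=
    kanComplex_map (fibration_map_pw X n) X
  exact sWeq_of_trivFib_cocylEnd (h n)
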